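/- **Setting.** Fix a finite set $\mathsf{Tid}$ of threads, a set $\mathsf{Loc}$ of locations and a set $\mathsf{Val}$ of values with a distinguished value $0$. Event labels are $\mathtt R(x,v)$, $\mathtt W(x,v)$ and $\mathtt{RMW}(x,v_R,v_W)$. A sequential program is a labeled transition system (LTS) whose labels are event labels; a program $P$ assigns one to each thread and runs by interleaving, with labels in $\mathsf{Tid}\times\mathsf{ELab}$. A memory system $\mathcal M$ is an LTS with observable labels in $\mathsf{Tid}\times\mathsf{ELab}$ and further silent labels. A behavior maps each thread to a finite or infinite sequence of event labels; the behavior of a run is obtained by projecting its observable labels to each thread. $\mathrm{Beh}(P)$ is the set of behaviors of runs of $P$; $\mathrm{Beh}^{\mathsf{tf}}(P)$ is the set of those of thread-fair runs (finite, or every thread enabled from index $k$ on steps at some index $\ge k$); $\mathrm{Beh}^{\mathsf{mf}}(\mathcal M)$ is the set of behaviors of memory-fair runs of $\mathcal M$ (finite, or every silent label enabled from index $k$ on is taken at some index $\ge k$). The memory-fair (thread&memory-fair) behaviors of $P$ under $\mathcal M$ are $\mathrm{Beh}(P)\cap\mathrm{Beh}^{\mathsf{mf}}(\mathcal M)$ (respectively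 $\mathrm{Beh}^{\mathsf{tf}}(P)\cap\mathrm{Beh}^{\mathsf{mf}}(\mathcal M)$). **Memory systems.** $\mathcal M_{\mathsf{SC}}$ is the interleaving memory $\mathsf{Loc}\to\mathsf{Val}$, initially $0$, without silent labels. $\mathcal M_{\mathsf{TSO}}$ adds a FIFO store buffer for each thread, with silent labels $\mathtt{prop}(\tau)$ that flush the oldest entry of the buffer of $\tau$; a thread reads the newest entry for the location in its own buffer, and otherwise the memory; RMWs require an empty buffer and act on the memory. $\mathcal M_{\mathsf{RA}}$ has a set of messages $\langle x,v,t,V\rangle$ with timestamps $t\in\mathbb N$ and views $V:\mathsf{Loc}\to\mathbb N$, and a view for each thread: a write picks a timestamp that is fresh for $x$ and above the thread's view of $x$; a read picks a message with timestamp at least the thread's view of $x$ and joins $V$ into the thread's view; an RMW is a read followed by a write at the next timestamp; the silent label $\mathtt{prop}(\tau,m)$ raises the view of $\tau$ at the location of $m$ to the timestamp of $m$ if it was smaller. $\mathcal M_{\mathsf{StrongCOH}}$ differs in that a read only sets the thread's view of $x$ to $t$. **Execution graphs.** An execution graph $G$ consists of a well-formed set $E$ of events (an initialization write of $0$ to each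 location, and events $\langle k,\tau,l\rangle$ whose serial numbers $k$ in each thread are distinct and form an initial segment of $\mathbb N$), a reads-from relation $\mathtt{rf}$ linking each read to exactly one write of the same location and value, and a modification order $\mathtt{mo}$, the union of a strict total order on the writes to each location; RMWs are both reads and writes. Program order $\mathtt{po}$ orders each thread by serial number and puts initialization before everything else; $\mathtt{fr}=(\mathtt{rf}^{-1};\mathtt{mo})\setminus\mathrm{id}$. $G$ is *fair* if in $\mathtt{mo}$ and in $\mathtt{fr}$ every event has finitely many predecessors. Write $R|_{\mathtt{loc}}$ for the restriction of $R$ to pairs of events on the same location, and let $\mathtt{hb}_{\mathsf{RA}}=(\mathtt{po}\cup\mathtt{rf})^+$ and $\mathtt{sc}_{\mathtt{loc}}=(\mathtt{po}|_{\mathtt{loc}}\cup\mathtt{rf}\cup\mathtt{mo}\cup\mathtt{fr})^+$. Then - $G\in\mathcal G_{\mathsf{SC}}$ iff $\mathtt{po}\cup\mathtt{rf}\cup\mathtt{mo}\cup\mathtt{fr}$ is acyclic; - $G\in\mathcal G_{\mathsf{TSO}}$ iff $\mathtt{sc}_{\mathtt{loc}}$ is irreflexive and $\mathtt{ppo}\cup(\mathtt{rf}\setminus\mathtt{po})\cup\mathtt{mo}\cup\mathtt{fr}$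 is acyclic, where $\mathtt{ppo}$ is $\mathtt{po}$ without the pairs from a non-RMW write to a non-RMW read; - $G\in\mathcal G_{\mathsf{RA}}$ iff $\mathtt{hb}_{\mathsf{RA}}|_{\mathtt{loc}}\cup\mathtt{rf}\cup\mathtt{mo}\cup\mathtt{fr}$ is acyclic; - $G\in\mathcal G_{\mathsf{StrongCOH}}$ iff $\mathtt{hb}_{\mathsf{RA}}$ and $\mathtt{sc}_{\mathtt{loc}}$ are irreflexive. For $\mathsf{RC11}$, labels carry C11 access modes $\mathsf{na}\sqsubset\mathsf{rlx}\sqsubset\mathsf{acq},\mathsf{rel}\sqsubset\mathsf{acqrel}\sqsubset\mathsf{sc}$ and fences are added (under $\mathsf{SC}$, modes and fences have no effect). $\mathcal G_{\mathsf{RC11}}$ is the RC11 consistency predicate of Lahav et al. (PLDI 2017) for single-event RMWs: $\mathtt{hb};\mathtt{eco}^?$ and $\mathtt{eco}$ are irreflexive, and $\mathtt{psc}$ and $\mathtt{po}\cup\mathtt{rf}$ are acyclic, where - $\mathtt{eco}=(\mathtt{rf}\cup\mathtt{mo}\cup\mathtt{fr})^+$ and $\mathtt{hb}=(\mathtt{po}\cup\mathtt{sw})^+$;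 - $\mathtt{rs}=[\mathtt W];\mathtt{po}|_{\mathtt{loc}}^?;[\mathtt W^{\sqsupseteq\mathsf{rlx}}];(\mathtt{rf};[\mathtt{RMW}])^*$; - $\mathtt{sw}=[\mathtt E^{\sqsupseteq\mathsf{rel}}];([\mathtt F];\mathtt{po})^?;\mathtt{rs};\mathtt{rf};[\mathtt R^{\sqsupseteq\mathsf{rlx}}];(\mathtt{po};[\mathtt F])^?;[\mathtt E^{\sqsupseteq\mathsf{acq}}]$; - $\mathtt{scb}=\mathtt{po}\cup\mathtt{po}|_{\neq\mathtt{loc}};\mathtt{hb};\mathtt{po}|_{\neq\mathtt{loc}}\cup\mathtt{hb}|_{\mathtt{loc}}\cup\mathtt{mo}\cup\mathtt{fr}$, where $\mathtt{po}|_{\neq\mathtt{loc}}=\mathtt{po}\setminus\mathtt{po}|_{\mathtt{loc}}$; - $\mathtt{psc}=([\mathtt E^{\mathsf{sc}}]\cup[\mathtt F^{\mathsf{sc}}];\mathtt{hb}^?);\mathtt{scb};([\mathtt E^{\mathsf{sc}}]\cup\mathtt{hb}^?;[\mathtt F^{\mathsf{sc}}])\ \cup\ [\mathtt F^{\mathsf{sc}}];(\mathtt{hb}\cup\mathtt{hb};\mathtt{eco};\mathtt{hb});[\mathtt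 F^{\mathsf{sc}}]$. As RC11 is a purely declarative model, "$\beta\in\mathrm{Beh}^{\mathsf{mf}}(\mathcal M_{\mathsf{RC11}})$" means that the events of $\beta$ together with the initialization events are the event set of some fair $G\in\mathcal G_{\mathsf{RC11}}$. **Robustness.** $P$ is *finitely execution-graph robust* against $\mathcal G$ if for every finite $\beta\in\mathrm{Beh}(P)$, every $G\in\mathcal G$ whose events are the events of $\beta$ together with the initialization events belongs to $\mathcal G_{\mathsf{SC}}$. **Corollary.** Let $X\in\{\mathsf{TSO},\mathsf{RA},\mathsf{StrongCOH},\mathsf{RC11}\}$ and let $P$ be a program that is finitely execution-graph robust against $\mathcal G_X$. Then the set of memory-fair behaviors of $P$ under $\mathcal M_X$ coincides with the set of memory-fair behaviors of $P$ under $\mathcal M_{\mathsf{SC}}$, and the set of thread&memory-fair behaviors of $P$ under $\mathcal M_X$ coincides with the set of thread&memory-fair behaviors of $P$ under $\mathcal M_{\mathsf{SC}}$. -/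

import Mathlib

namespace WeakMem

universe u v w

/-! ### Finite or infinite sequences

`Stream'.Seq α` is Mathlib's type of finite or infinite sequences over `α`; `s.get? k` is the
`k`-th entry, or `none` when `k` lies outside the domain; `s.Terminates` says that `s` is finite. -/

section Sequences

variable {α : Type u} {β : Type v}

/-- The `i`-th entry of `s` survives the partial map `f`. -/
def Kept (f : α → Option β) (s : Stream'.Seq α) (i : ℕ) : Prop :=
  ∃ b, (s.get? i).bind f = some b

open Classical in
/-- The `k`-th entry of the restriction of `s` along the partial map `f`: it comes from the position
`i` of `s` which survives and which has exactly `k` surviving positions before it. -/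
noncomputable def restrictFun (f : α → Option β) (s : Stream'.Seq α) (k : ℕ) : Option β :=
  if h : ∃ i, Kept f s i ∧ Nat.count (Kept f s) i = k then (s.get? h.choose).bind f else none

theorem restrictFun_isSeq (f : α → Option β) (s : Stream'.Seq α) :
    Stream'.IsSeq (restrictFun f s) := by
  classical
  intro n hn
  change restrictFun f s n = none at hn
  unfold restrictFun at hn ⊢
  rw [dif_neg]
  rintro ⟨i, hi, hc⟩
  have hex : ∃ j, Kept f s j ∧ Nat.count (Kept f s) j = n := by
    clear hn hi
    induction i with
    | zero => simp at hc
    | succ m ih =>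
      rw [Nat.count_succ] at hc
      by_cases hm : Kept f s m
      · rw [if_pos hm] at hc
        exact ⟨m, hm, by convert Nat.succ.inj hc⟩
      · rw [if_neg hm] at hc
        exact ih hc
  rw [dif_pos hex] at hn
  obtain ⟨b, hb⟩ := hex.choose_spec.1
  rw [hb] at hn
  exact absurd hn (by simp)

/-- The subsequence of the entries of `s` on which `f` is defined, with `f` applied to them. -/
noncomputable def restrict (f : α → Option β) (s : Stream'.Seq α) : Stream'.Seq β :=
  ⟨restrictFun f s, restrictFun_isSeq f s⟩

end Sequences

/-! ### Labeled transition systems -/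

/-- A labeled transition system with observable labels `S` and silent labels `T`. -/
structure LTS (S : Type u) (T : Type v) where
  Q : Type w
  init : Q
  step : Q → S ⊕ T → Q → Prop

namespace LTS

variable {S : Type u} {T : Type v}

/-- Triples (source, label, target). -/
abbrev Trans (A : LTS.{u, v, w} S T) := A.Q × (S ⊕ T) × A.Q

/-- The label `σ` is enabled in the state `q`. -/
def Enabled (A : LTS.{u, v, w} S T) (σ : S ⊕ T) (q : A.Q) : Prop := ∃ q', A.step q σ q'

/-- A run: a finite or infinite sequence of consecutive transitions from the initial state. -/
structure IsRun (A : LTS.{u, v, w} S T) (μ : Stream'.Seq A.Trans) : Prop where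
  trans : ∀ k t, μ.get? k = some t → A.step t.1 t.2.1 t.2.2
  start : ∀ t, μ.get? 0 = some t → t.1 = A.init
  consec : ∀ k t t', μ.get? k = some t → μ.get? (k + 1) = some t' → t.2.2 = t'.1

/-- The trace induced by a sequence of transitions. -/
def traceOf (A : LTS.{u, v, w} S T) (μ : Stream'.Seq A.Trans) : Stream'.Seq (S ⊕ T) :=
  μ.map (fun t => t.2.1)

/-- The observable trace induced by a sequence of transitions. -/
noncomputable def obsTraceOf (A : LTS.{u, v, w} S T) (μ : Stream'.Seq A.Trans) : Stream'.Seq S :=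
  restrict Sum.getLeft? (A.traceOf μ)

/-- The set of observable traces. -/
def OTraces (A : LTS.{u, v, w} S T) : Set (Stream'.Seq S) :=
  {ρ | ∃ μ, A.IsRun μ ∧ A.obsTraceOf μ = ρ}

/-- A run is memory-fair if it is finite, or every silent label that is continuously enabled from
some index `k` on is taken at some index `j ≥ k`. -/
def MemFairRun (A : LTS.{u, v, w} S T) (μ : Stream'.Seq A.Trans) : Prop :=
  A.IsRun μ ∧ (μ.Terminates ∨
    ∀ (θ : T) (k : ℕ),
      (∀ j ≥ k, ∀ t, μ.get? j = some t → A.Enabled (Sum.inr θ) t.1) →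
      ∃ j ≥ k, ∃ t, μ.get? j = some t ∧ t.2.1 = Sum.inr θ)

/-- The set of memory-fair observable traces. -/
def MemFairOTraces (A : LTS.{u, v, w} S T) : Set (Stream'.Seq S) :=
  {ρ | ∃ μ, A.MemFairRun μ ∧ A.obsTraceOf μ = ρ}

end LTS

/-! ### Event labels -/

/-- Event labels: reads, writes and read-modify-writes. -/
inductive ELab (Loc : Type u) (Val : Type v)
  | read (x : Loc) (vR : Val)
  | write (x : Loc) (vW : Val)
  | rmw (x : Loc) (vR vW : Val)

namespace ELab

variable {Loc : Type u} {Val : Type v}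

def loc : ELab Loc Val → Loc
  | read x _ => x
  | write x _ => x
  | rmw x _ _ => x

/-- The value read, for reads and read-modify-writes. -/
def valR : ELab Loc Val → Option Val
  | read _ v => some v
  | write _ _ => none
  | rmw _ v _ => some v

/-- The value written, for writes and read-modify-writes. -/
def valW : ELab Loc Val → Option Val
  | read _ _ => none
  | write _ v => some v
  | rmw _ _ v => some v

end ELab

/-- Access modes of RC11: non-atomic, relaxed, acquire, release, acquire-release, sequentially
consistent. -/
inductive Mode
  | na | rlx | acq | rel | acqrel | sc

/-- At least relaxed, in the order `na ⊏ rlx ⊏ acq, rel ⊏ acqrel ⊏ sc`. -/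
def Mode.AtLeastRlx (o : Mode) : Prop := o ≠ .na
/-- At least acquire. -/
def Mode.AtLeastAcq (o : Mode) : Prop := o = .acq ∨ o = .acqrel ∨ o = .sc
/-- At least release. -/
def Mode.AtLeastRel (o : Mode) : Prop := o = .rel ∨ o = .acqrel ∨ o = .sc

/-- Modes of reads. -/
inductive RMode
  | na | rlx | acq | sc
/-- Modes of writes. -/
inductive WMode
  | na | rlx | rel | sc
/-- Modes of read-modify-writes. -/
inductive UMode
  | rlx | acq | rel | acqrel | sc
/-- Modes of fences. -/
inductive FMode
  | acq | rel | acqrel | sc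

def RMode.mode : RMode → Mode
  | na => .na | rlx => .rlx | acq => .acq | sc => .sc
def WMode.mode : WMode → Mode
  | na => .na | rlx => .rlx | rel => .rel | sc => .sc
def UMode.mode : UMode → Mode
  | rlx => .rlx | acq => .acq | rel => .rel | acqrel => .acqrel | sc => .sc
def FMode.mode : FMode → Mode
  | acq => .acq | rel => .rel | acqrel => .acqrel | sc => .sc

/-- Event labels of RC11: accesses annotated with modes, and fences. -/
inductive CLab (Loc : Type u) (Val : Type v)
  | read (o : RMode) (x : Loc) (vR : Val)
  | write (o : WMode) (x : Loc) (vW : Val)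
  | rmw (o : UMode) (x : Loc) (vR vW : Val)
  | fence (o : FMode)

/-- The mode of an RC11 label. -/
def CLab.mode {Loc : Type u} {Val : Type v} : CLab Loc Val → Mode
  | read o _ _ => o.mode
  | write o _ _ => o.mode
  | rmw o _ _ _ => o.mode
  | fence o => o.mode

/-- The memory access performed by a label (`none` for fences). It allows treating the plain labels
`ELab` and the RC11 labels `CLab` uniformly. -/
class MemLabel (L : Type w) (Loc : outParam (Type u)) (Val : outParam (Type v)) where
  access : L → Option (ELab Loc Val)

instance instMemLabelELab {Loc : Type u} {Val : Type v} : MemLabel (ELab Loc Val) Loc Val :=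
  ⟨some⟩

instance instMemLabelCLab {Loc : Type u} {Val : Type v} : MemLabel (CLab Loc Val) Loc Val where
  access
    | .read _ x v => some (.read x v)
    | .write _ x v => some (.write x v)
    | .rmw _ x vR vW => some (.rmw x vR vW)
    | .fence _ => none

/-! ### Programs and behaviors -/

section Programs

variable {Tid : Type u} {L : Type v}

/-- A sequential program is an LTS over event labels without silent labels; a program assigns a
sequential program to every thread. -/
abbrev Program (Tid : Type u) (L : Type v) := Tid → LTS.{v, 0, w} L Empty

open Classical in
/-- The LTS induced by a program: interleaving semantics. -/
noncomputable def Program.lts (P : Program.{u, v, w} Tid L) :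
    LTS.{max u v, 0, max u w} (Tid × L) Empty where
  Q := ∀ τ, (P τ).Q
  init := fun τ => (P τ).init
  step p σ p' :=
    match σ with
    | Sum.inl (τ, l) => ∃ q, (P τ).step (p τ) (Sum.inl l) q ∧ p' = Function.update p τ q
    | Sum.inr e => e.elim

/-- A behavior assigns a sequential trace to every thread. -/
abbrev Behavior (Tid : Type u) (L : Type v) := Tid → Stream'.Seq L

open Classical in
/-- The behavior induced by a concurrent trace. -/
noncomputable def behOf (ρ : Stream'.Seq (Tid × L)) : Behavior Tid L :=
  fun τ => restrict (fun σ => if σ.1 = τ then some σ.2 else none) ρ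

/-- A behavior is finite if each of its sequential traces is (there are finitely many threads). -/
def Behavior.IsFinite (β : Behavior Tid L) : Prop := ∀ τ, (β τ).Terminates

/-- Behaviors of an LTS over `Tid × L`. -/
def LTS.Beh {T : Type*} (A : LTS (Tid × L) T) : Set (Behavior Tid L) := behOf '' A.OTraces

/-- Memory-fair behaviors of a memory system. -/
def LTS.BehMF {T : Type*} (A : LTS (Tid × L) T) : Set (Behavior Tid L) := behOf '' A.MemFairOTraces

/-- The thread `τ` is enabled in the program state `p`. -/
def Program.ThreadEnabled (P : Program.{u, v, w} Tid L) (τ : Tid) (p : P.lts.Q) : Prop :=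
  ∃ l : L, P.lts.Enabled (Sum.inl (τ, l)) p

/-- A run of a program is thread-fair if it is finite, or every thread that is continuously enabled
from some index `k` on makes a step at some index `j ≥ k`. -/
def Program.ThreadFairRun (P : Program.{u, v, w} Tid L) (μ : Stream'.Seq P.lts.Trans) : Prop :=
  P.lts.IsRun μ ∧ (μ.Terminates ∨
    ∀ (τ : Tid) (k : ℕ),
      (∀ j ≥ k, ∀ t, μ.get? j = some t → P.ThreadEnabled τ t.1) →
      ∃ j ≥ k, ∃ t, μ.get? j = some t ∧ ∃ l : L, t.2.1 = Sum.inl (τ, l))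

/-- Behaviors of a program. -/
def Program.Beh (P : Program.{u, v, w} Tid L) : Set (Behavior Tid L) := P.lts.Beh

/-- Thread-fair behaviors of a program. -/
def Program.BehTF (P : Program.{u, v, w} Tid L) : Set (Behavior Tid L) :=
  {β | ∃ μ, P.ThreadFairRun μ ∧ behOf (P.lts.obsTraceOf μ) = β}

/-- Memory-fair behaviors of `P` under the memory system `M`. -/
def Program.MemFairBehUnder (P : Program.{u, v, w} Tid L) {T : Type*} (M : LTS (Tid × L) T) :
    Set (Behavior Tid L) := P.Beh ∩ M.BehMF

/-- Thread&memory-fair behaviors of `P` under the memory system `M`. -/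
def Program.ThreadMemFairBehUnder (P : Program.{u, v, w} Tid L) {T : Type*}
    (M : LTS (Tid × L) T) : Set (Behavior Tid L) := P.BehTF ∩ M.BehMF

end Programs

/-! ### Operational memory systems -/

section Operational

variable (Tid : Type u) (Loc : Type v) (Val : Type w) [Zero Val]

open Classical in
/-- Sequential consistency. There are no silent transitions; fences, where the label type has them,
and access modes have no effect. -/
noncomputable def MSC (L : Type*) [MemLabel L Loc Val] : LTS (Tid × L) Empty where
  Q := Loc → Val
  init := fun _ => 0
  step M σ M' :=
    match σ with
    | Sum.inl (_, l) =>
      match MemLabel.access l with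
      | some (.read x v) => M x = v ∧ M' = M
      | some (.write x v) => M' = Function.update M x v
      | some (.rmw x vR vW) => M x = vR ∧ M' = Function.update M x vW
      | none => M' = M
    | Sum.inr e => e.elim

open Classical in
/-- Total store order: a memory and a FIFO store buffer for every thread, newest entry first. The
silent label `τ` propagates the oldest entry of the buffer of `τ` to the memory. -/
noncomputable def MTSO : LTS (Tid × ELab Loc Val) Tid where
  Q := (Loc → Val) × (Tid → List (Loc × Val))
  init := (fun _ => 0, fun _ => [])
  step q σ q' :=
    match σ with
    | Sum.inl (τ, .write x v) => q' = (q.1, Function.update q.2 τ ((x, v) :: q.2 τ))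
    | Sum.inl (τ, .read x v) =>
      (q.2 τ).foldr (fun p M => Function.update M p.1 p.2) q.1 x = v ∧ q' = q
    | Sum.inl (τ, .rmw x vR vW) =>
      q.2 τ = [] ∧ q.1 x = vR ∧ q' = (Function.update q.1 x vW, q.2)
    | Sum.inr τ => ∃ b x v, q.2 τ = b ++ [(x, v)] ∧
      q' = (Function.update q.1 x v, Function.update q.2 τ b)

/-- Views map locations to timestamps. -/
abbrev View (Loc : Type v) := Loc → ℕ

/-- Messages of the timestamp-based memory systems. -/
structure Msg (Loc : Type v) (Val : Type w) where
  loc : Loc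
  val : Val
  ts : ℕ
  view : View Loc

/-- States of the timestamp-based memory systems: a set of messages and a view for every thread. -/
abbrev ViewState := Set (Msg Loc Val) × (Tid → View Loc)

variable {Tid Loc Val}

open Classical in
/-- Write step of thread `τ`. -/
def viewWrite (τ : Tid) (x : Loc) (v : Val) (q q' : ViewState Tid Loc Val) : Prop :=
  ∃ t : ℕ, (¬ ∃ m ∈ q.1, m.loc = x ∧ m.ts = t) ∧ q.2 τ x < t ∧
    q'.2 = Function.update q.2 τ (Function.update (q.2 τ) x t) ∧
    q'.1 = q.1 ∪ {⟨x, v, t, q'.2 τ⟩}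

open Classical in
/-- Read step of thread `τ`, where `upd V m` is the new view of a thread with view `V` that reads
the message `m`. -/
def viewRead (upd : View Loc → Msg Loc Val → View Loc) (τ : Tid) (x : Loc) (v : Val)
    (q q' : ViewState Tid Loc Val) : Prop :=
  ∃ m ∈ q.1, m.loc = x ∧ m.val = v ∧ q.2 τ x ≤ m.ts ∧
    q' = (q.1, Function.update q.2 τ (upd (q.2 τ) m))

open Classical in
/-- The timestamp-based memory system with read update `upd`. The silent label `(τ, m)` propagates
the message `m` to the thread `τ`. -/
noncomputable def viewMem (upd : View Loc → Msg Loc Val → View Loc) :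
    LTS (Tid × ELab Loc Val) (Tid × Msg Loc Val) where
  Q := ViewState Tid Loc Val
  init := ({m | ∃ x, m = ⟨x, 0, 0, fun _ => 0⟩}, fun _ _ => 0)
  step q σ q' :=
    match σ with
    | Sum.inl (τ, .write x v) => viewWrite τ x v q q'
    | Sum.inl (τ, .read x v) => viewRead upd τ x v q q'
    | Sum.inl (τ, .rmw x vR vW) => ∃ q₁, viewRead upd τ x vR q q₁ ∧ viewWrite τ x vW q₁ q' ∧
      q'.2 τ x = q₁.2 τ x + 1
    | Sum.inr (τ, m) => m ∈ q.1 ∧ q.2 τ m.loc < m.ts ∧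
      q' = (q.1, Function.update q.2 τ (Function.update (q.2 τ) m.loc m.ts))

variable (Tid Loc Val)

/-- Release/acquire: a reader joins the view of the message into its own. -/
noncomputable def MRA : LTS (Tid × ELab Loc Val) (Tid × Msg Loc Val) :=
  viewMem (fun V m => V ⊔ m.view)

open Classical in
/-- Strong coherence: a reader only takes over the timestamp of the message. -/
noncomputable def MStrongCOH : LTS (Tid × ELab Loc Val) (Tid × Msg Loc Val) :=
  viewMem (fun V m => Function.update V m.loc m.ts)

end Operational

/-! ### Events and execution graphs -/

/-- Events: the initialization event of a location, or an event with a serial number, a thread and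
a label. -/
inductive Event (Tid : Type*) (Loc : Type*) (L : Type*)
  | init (x : Loc)
  | ev (k : ℕ) (τ : Tid) (l : L)

namespace Event

variable {Tid Loc Val L : Type*} [MemLabel L Loc Val] [Zero Val]

def IsInit : Event Tid Loc L → Prop
  | init _ => True
  | ev _ _ _ => False

/-- The memory access of an event; initialization events write `0`. -/
def access : Event Tid Loc L → Option (ELab Loc Val)
  | init x => some (.write x 0)
  | ev _ _ l => MemLabel.access l

/-- The location of an event (`none` for fences). -/
def loc (e : Event Tid Loc L) : Option Loc := (access e).map ELab.loc
/-- The value read by an event, if any. -/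
def valR (e : Event Tid Loc L) : Option Val := (access e).bind ELab.valR
/-- The value written by an event, if any. -/
def valW (e : Event Tid Loc L) : Option Val := (access e).bind ELab.valW

/-- Reads, including read-modify-writes. -/
def IsR (e : Event Tid Loc L) : Prop := (valR e).isSome
/-- Writes, including read-modify-writes. -/
def IsW (e : Event Tid Loc L) : Prop := (valW e).isSome
/-- Read-modify-writes. -/
def IsRMW (e : Event Tid Loc L) : Prop := IsR e ∧ IsW e

/-- Both events access a common location. -/
def SameLoc (a b : Event Tid Loc L) : Prop := ∃ x, loc a = some x ∧ loc b = some x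

/-- The sequenced-before order. -/
def Sb : Event Tid Loc L → Event Tid Loc L → Prop
  | init _, ev _ _ _ => True
  | ev k τ _, ev k' τ' _ => τ = τ' ∧ k < k'
  | _, init _ => False

end Event

section Graphs

variable {Tid Loc Val L : Type*}

/-- The set of events extracted from a behavior. -/
def eventsOf (Loc : Type*) (β : Behavior Tid L) : Set (Event Tid Loc L) :=
  {e | (∃ x, e = .init x) ∨ ∃ k τ l, (β τ).get? k = some l ∧ e = .ev k τ l}

/-- Well-formed sets of events. -/
structure WellFormed (E : Set (Event Tid Loc L)) : Prop where
  init_mem : ∀ x, Event.init x ∈ E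
  unique : ∀ k τ l l', Event.ev k τ l ∈ E → Event.ev k τ l' ∈ E → l = l'
  closed : ∀ k τ l, Event.ev k τ l ∈ E → ∀ j < k, ∃ l', Event.ev j τ l' ∈ E

variable [MemLabel L Loc Val] [Zero Val]

variable (Tid L) in
/-- Execution graphs: a well-formed set of events, a reads-from relation, and a modification order,
which is the union over the locations of strict total orders on the writes to that location. -/
structure EGraph where
  E : Set (Event Tid Loc L)
  rf : Event Tid Loc L → Event Tid Loc L → Prop
  mo : Event Tid Loc L → Event Tid Loc L → Prop
  wf : WellFormed E
  rf_mem : ∀ w r, rf w r → w ∈ E ∧ r ∈ E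
  rf_type : ∀ w r, rf w r → w.IsW ∧ r.IsR
  rf_loc : ∀ w r, rf w r → w.loc = r.loc
  rf_val : ∀ w r, rf w r → w.valW = r.valR
  rf_fun : ∀ w w' r, rf w r → rf w' r → w = w'
  rf_total : ∀ r ∈ E, r.IsR → ∃ w, rf w r
  mo_mem : ∀ a b, mo a b → a ∈ E ∧ b ∈ E
  mo_type : ∀ a b, mo a b → a.IsW ∧ b.IsW ∧ a.SameLoc b
  mo_irrefl : ∀ a, ¬ mo a a
  mo_trans : ∀ a b c, mo a b → mo b c → mo a c
  mo_total : ∀ a ∈ E, ∀ b ∈ E, a.IsW → b.IsW → a.SameLoc b → a ≠ b → mo a b ∨ mo b a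

/-- A declarative memory system is a set of execution graphs. -/
abbrev DeclMem (Tid L : Type*) {Loc Val : Type*} [MemLabel L Loc Val] [Zero Val] :=
  Set (EGraph Tid L)

/-- The behaviors allowed by a declarative memory system. -/
def DeclMem.Beh (𝒢 : DeclMem Tid L) : Set (Behavior Tid L) :=
  {β | ∃ G ∈ 𝒢, eventsOf Loc β = G.E}

/-- Every element has finitely many predecessors. -/
def PrefixFinite {α : Type*} (R : α → α → Prop) : Prop := ∀ b, {a | R a b}.Finite

/-- `R` is irreflexive. -/
def Irrefl {α : Type*} (R : α → α → Prop) : Prop := ∀ a, ¬ R a a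

/-- `R` has no cycles. -/
def Acyclic {α : Type*} (R : α → α → Prop) : Prop := Irrefl (Relation.TransGen R)

namespace EGraph

variable (G : EGraph Tid L)

/-- Program order. -/
def po (a b : Event Tid Loc L) : Prop := a ∈ G.E ∧ b ∈ G.E ∧ a.Sb b

/-- From-read. -/
def fr (a b : Event Tid Loc L) : Prop := (∃ w, G.rf w a ∧ G.mo w b) ∧ a ≠ b

/-- SC-happens-before. -/
def hbSC : Event Tid Loc L → Event Tid Loc L → Prop :=
  Relation.TransGen fun a b => G.po a b ∨ G.rf a b ∨ G.mo a b ∨ G.fr a b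

/-- External reads-from. -/
def rfe (a b : Event Tid Loc L) : Prop := G.rf a b ∧ ¬ G.po a b

/-- Preserved program order. -/
def ppo (a b : Event Tid Loc L) : Prop :=
  G.po a b ∧ ¬ ((a.IsW ∧ ¬ a.IsRMW) ∧ (b.IsR ∧ ¬ b.IsRMW))

/-- TSO-happens-before. -/
def hbTSO : Event Tid Loc L → Event Tid Loc L → Prop :=
  Relation.TransGen fun a b => G.ppo a b ∨ G.rfe a b ∨ G.mo a b ∨ G.fr a b

/-- SC-per-location order. -/
def scLoc : Event Tid Loc L → Event Tid Loc L → Prop :=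
  Relation.TransGen fun a b => (G.po a b ∧ a.SameLoc b) ∨ G.rf a b ∨ G.mo a b ∨ G.fr a b

/-- RA-happens-before. -/
def hbRA : Event Tid Loc L → Event Tid Loc L → Prop :=
  Relation.TransGen fun a b => G.po a b ∨ G.rf a b

/-- RA-per-location order. -/
def raLoc : Event Tid Loc L → Event Tid Loc L → Prop :=
  Relation.TransGen fun a b => (G.hbRA a b ∧ a.SameLoc b) ∨ G.rf a b ∨ G.mo a b ∨ G.fr a b

/-- Fair execution graphs. -/
def Fair : Prop := PrefixFinite G.mo ∧ PrefixFinite G.fr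

/-- Extended coherence order. -/
def eco : Event Tid Loc L → Event Tid Loc L → Prop :=
  Relation.TransGen fun a b => G.rf a b ∨ G.mo a b ∨ G.fr a b

end EGraph

variable (Tid L) in
/-- The set of fair execution graphs. -/
def GFair : DeclMem Tid L := {G | G.Fair}

variable (Tid L) in
/-- The declarative memory system for SC. -/
def GSC : DeclMem Tid L := {G | Irrefl G.hbSC}

variable (Tid L) in
/-- The declarative memory system for TSO. -/
def GTSO : DeclMem Tid L := {G | Irrefl G.hbTSO ∧ Irrefl G.scLoc}

variable (Tid L) in
/-- The declarative memory system for RA. -/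
def GRA : DeclMem Tid L := {G | Irrefl G.raLoc}

variable (Tid L) in
/-- The declarative memory system for StrongCOH. -/
def GStrongCOH : DeclMem Tid L := {G | Irrefl G.hbRA ∧ Irrefl G.scLoc}

/-- `P` is finitely execution-graph robust against `𝒢`. -/
def FinitelyRobust (P : Program Tid L) (𝒢 : DeclMem Tid L) : Prop :=
  ∀ β ∈ P.Beh, β.IsFinite → ∀ G ∈ 𝒢, eventsOf Loc β = G.E → G ∈ GSC Tid L

/-- Memory-fair behaviors of `P` under a declarative memory system: behaviors of `P` explained by a
fair consistent graph. -/
def Program.DeclFairBehUnder (P : Program Tid L) (𝒢 : DeclMem Tid L) : Set (Behavior Tid L) :=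
  P.Beh ∩ DeclMem.Beh (𝒢 ∩ GFair Tid L)

/-- Thread&memory-fair behaviors of `P` under a declarative memory system. -/
def Program.DeclThreadFairBehUnder (P : Program Tid L) (𝒢 : DeclMem Tid L) :
    Set (Behavior Tid L) :=
  P.BehTF ∩ DeclMem.Beh (𝒢 ∩ GFair Tid L)

end Graphs

/-! ### The declarative model RC11 -/

section RC11

variable {Tid Loc Val : Type*} [Zero Val]

/-- The mode of an event; initialization writes are non-atomic. -/
def Event.mode : Event Tid Loc (CLab Loc Val) → Mode
  | .init _ => .na
  | .ev _ _ l => l.mode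

/-- Fence events. -/
def Event.IsFence : Event Tid Loc (CLab Loc Val) → Prop
  | .ev _ _ (.fence _) => True
  | _ => False

namespace EGraph

variable (G : EGraph Tid (CLab Loc Val))

/-- Release sequences: `[W] ; po|loc? ; [W⊒rlx] ; (rf ; [RMW])*`. -/
def rs (a b : Event Tid Loc (CLab Loc Val)) : Prop :=
  a ∈ G.E ∧ a.IsW ∧ ∃ c, (a = c ∨ (G.po a c ∧ a.SameLoc c)) ∧ c.IsW ∧ c.mode.AtLeastRlx ∧
    Relation.ReflTransGen (fun d e => G.rf d e ∧ e.IsRMW) c b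

/-- Synchronizes-with:
`[E⊒rel] ; ([F] ; po)? ; rs ; rf ; [R⊒rlx] ; (po ; [F])? ; [E⊒acq]`. -/
def sw (a b : Event Tid Loc (CLab Loc Val)) : Prop :=
  a.mode.AtLeastRel ∧ b.mode.AtLeastAcq ∧
  ∃ w w' r, (a = w ∨ (a.IsFence ∧ G.po a w)) ∧ G.rs w w' ∧ G.rf w' r ∧ r.mode.AtLeastRlx ∧
    (r = b ∨ (G.po r b ∧ b.IsFence))

/-- RC11-happens-before. -/
def hbRC11 : Event Tid Loc (CLab Loc Val) → Event Tid Loc (CLab Loc Val) → Prop :=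
  Relation.TransGen fun a b => G.po a b ∨ G.sw a b

/-- `po` between events that do not access a common location. -/
def poNeqLoc (a b : Event Tid Loc (CLab Loc Val)) : Prop := G.po a b ∧ ¬ a.SameLoc b

/-- SC-before: `po ∪ po|≠loc ; hb ; po|≠loc ∪ hb|loc ∪ mo ∪ fr`. -/
def scb (a b : Event Tid Loc (CLab Loc Val)) : Prop :=
  G.po a b ∨ (∃ c d, G.poNeqLoc a c ∧ G.hbRC11 c d ∧ G.poNeqLoc d b) ∨
    (G.hbRC11 a b ∧ a.SameLoc b) ∨ G.mo a b ∨ G.fr a b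

/-- `([E^sc] ∪ [F^sc] ; hb?) ; scb ; ([E^sc] ∪ hb? ; [F^sc])`. -/
def pscBase (a b : Event Tid Loc (CLab Loc Val)) : Prop :=
  a.mode = .sc ∧ b.mode = .sc ∧
  ∃ c d, (a = c ∨ (a.IsFence ∧ G.hbRC11 a c)) ∧ G.scb c d ∧
    (d = b ∨ (G.hbRC11 d b ∧ b.IsFence))

/-- `[F^sc] ; (hb ∪ hb ; eco ; hb) ; [F^sc]`. -/
def pscF (a b : Event Tid Loc (CLab Loc Val)) : Prop :=
  a.mode = .sc ∧ a.IsFence ∧ b.mode = .sc ∧ b.IsFence ∧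
    (G.hbRC11 a b ∨ ∃ c d, G.hbRC11 a c ∧ G.eco c d ∧ G.hbRC11 d b)

end EGraph

variable (Tid Loc Val) in
/-- The declarative memory system RC11: coherence (`hb ; eco?` is irreflexive), atomicity,
acyclicity of `psc`, and acyclicity of `po ∪ rf`. Read-modify-writes are single events here, so that
atomicity (no write is modification-ordered between a read-modify-write and the write it reads from,
and the latter comes earlier) is irreflexivity of `eco`. -/
def GRC11 : DeclMem Tid (CLab Loc Val) :=
  {G | Irrefl G.hbRC11 ∧ (∀ a b, G.hbRC11 a b → ¬ G.eco b a) ∧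
    Irrefl G.eco ∧
    Acyclic (fun a b => G.pscBase a b ∨ G.pscF a b) ∧
    Acyclic (fun a b => G.po a b ∨ G.rf a b)}

end RC11

end WeakMem

/-! A behavior allowed by a weak memory is turned into an execution graph, robustness makes the
graph sequentially consistent, and the graph is turned back into an SC run.

A memory-fair run of `MTSO`, `MRA` or `MStrongCOH` yields a fair consistent graph on the events of
its behavior: a read is linked to the write it saw, and the writes to a location are ordered by
timestamp, or by flush time for TSO. Consistency follows from numerical measures that grow along
every edge. Memory fairness gives finiteness of `fr`-prefixes: every write eventually becomes
visible to all threads, and no later read is `fr`-before it. For RC11 the graph is given.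

Finite robustness passes to infinite graphs (`FinitelyRobust.mem_GSC`). A cycle in `po ∪ rf ∪ mo ∪
fr` involves finitely many events. Since `po ∪ rf` is acyclic and there are finitely many threads,
these have finitely many `po ∪ rf`-predecessors, apart from initialization, which is treated
separately because there may be infinitely many locations. The restriction of the graph to them is
still consistent and is a graph of a finite prefix of the behavior, cut separately in each thread,
which the program also has. Robustness excludes the cycle. A fair SC graph has finite prefixes, so
its events can be executed one after another in an order that respects all edges
(`mem_behMF_MSC_of_graph`).

Conversely, TSO and the timestamp memories simulate each SC step by the same step followed at once
by all propagations it makes possible (`mem_behMF_of_simulation`). No silent label is then enabled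
between the blocks, so the run is memory-fair. For RC11, an SC run yields a fair SC graph, and SC
graphs are RC11-consistent (`GSC_subset_GRC11`).

Runs are indexed by all of `ℕ` and may idle, which treats finite and infinite runs alike; `compact`
removes the gaps afterwards. -/

namespace WeakMem

/-! ### Removing the gaps of a partial stream -/

section Compact

universe u v

variable {α : Type u} {β : Type v}

open Classical in
/-- The number of defined entries of `g` before position `n`. -/
noncomputable def cnt (g : ℕ → Option α) (n : ℕ) : ℕ := Nat.count (fun i => ∃ a, g i = some a) n

theorem cnt_mono (g : ℕ → Option α) : Monotone (cnt g) := by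
  classical
  exact Nat.count_monotone _

theorem cnt_succ_of_some {g : ℕ → Option α} {n : ℕ} {a : α} (h : g n = some a) :
    cnt g (n + 1) = cnt g n + 1 := by
  classical
  unfold cnt
  rw [Nat.count_succ, if_pos ⟨a, h⟩]

theorem cnt_succ_of_none {g : ℕ → Option α} {n : ℕ} (h : g n = none) :
    cnt g (n + 1) = cnt g n := by
  classical
  unfold cnt
  rw [Nat.count_succ, if_neg (by simp [h]), add_zero]

theorem cnt_lt_cnt {g : ℕ → Option α} {i j : ℕ} {a : α} (h : g i = some a) (hij : i < j) :
    cnt g i < cnt g j := by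
  have := cnt_mono g (Nat.succ_le_of_lt hij)
  have h2 := cnt_succ_of_some h
  simp only [Nat.succ_eq_add_one] at this
  omega

theorem cnt_inj {g : ℕ → Option α} {i j : ℕ} {a b : α} (hi : g i = some a) (hj : g j = some b)
    (h : cnt g i = cnt g j) : i = j := by
  rcases lt_trichotomy i j with hij | hij | hij
  · exact absurd h (cnt_lt_cnt hi hij).ne
  · exact hij
  · exact absurd h (cnt_lt_cnt hj hij).ne'

theorem lt_of_cnt_lt {g : ℕ → Option α} {i j : ℕ} (h : cnt g i < cnt g j) : i < j :=
  (cnt_mono g).reflect_lt h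

theorem cnt_congr {g : ℕ → Option α} {g' : ℕ → Option β} {n : ℕ}
    (h : ∀ i < n, g i = none ↔ g' i = none) : cnt g n = cnt g' n := by
  induction n with
  | zero => simp [cnt]
  | succ n ih =>
    have ih := ih fun i hi => h i (by omega)
    have hn := h n (by omega)
    rcases hg : g n with _ | a
    · rw [cnt_succ_of_none hg, cnt_succ_of_none (hn.1 hg), ih]
    · rcases hg' : g' n with _ | b
      · rw [hn.2 hg'] at hg
        cases hg
      · rw [cnt_succ_of_some hg, cnt_succ_of_some hg', ih]

/-- A surviving position is determined by the number of surviving positions before it, so the choice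
in `restrictFun` is harmless. -/
theorem restrict_get?_eq_some {f : α → Option β} {s : Stream'.Seq α} {k : ℕ} {b : β} :
    (restrict f s).get? k = some b ↔
      ∃ i, (s.get? i).bind f = some b ∧ cnt (fun i => (s.get? i).bind f) i = k := by
  classical
  have hcnt : ∀ i, Nat.count (Kept f s) i = cnt (fun i => (s.get? i).bind f) i := fun i => by
    unfold cnt Kept
    congr
  change restrictFun f s k = some b ↔ _
  unfold restrictFun
  constructor
  · intro h
    split_ifs at h with hex
    refine ⟨_, h, ?_⟩
    rw [← hcnt]
    convert hex.choose_spec.2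
  · rintro ⟨i, hi, hc⟩
    have hex : ∃ i, Kept f s i ∧ Nat.count (Kept f s) i = k := by
      refine ⟨i, ⟨b, hi⟩, ?_⟩
      rw [← hc, ← hcnt]
    have hex' : ∃ i, Kept f s i ∧
        @Nat.count (Kept f s) (fun a => Classical.propDecidable _) i = k := by
      convert hex
    rw [dif_pos hex']
    obtain ⟨⟨c, hc1⟩, hc2⟩ := hex'.choose_spec
    have : hex'.choose = i := by
      refine cnt_inj (g := fun i => (s.get? i).bind f) hc1 hi ?_
      rw [hc, ← hcnt]
      convert hc2
    rw [this, hi]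

/-- The sequence of all defined entries of `g`. -/
noncomputable def compact (g : ℕ → Option α) : Stream'.Seq α :=
  restrict g ⟨fun n => some n, fun h => by simp at h⟩

theorem compact_get?_eq_some {g : ℕ → Option α} {k : ℕ} {a : α} :
    (compact g).get? k = some a ↔ ∃ i, g i = some a ∧ cnt g i = k :=
  restrict_get?_eq_some

theorem compact_get?_cnt {g : ℕ → Option α} {i : ℕ} {a : α} (h : g i = some a) :
    (compact g).get? (cnt g i) = some a :=
  compact_get?_eq_some.2 ⟨i, h, rfl⟩

theorem seq_ext_some {s t : Stream'.Seq α} (h : ∀ n a, s.get? n = some a ↔ t.get? n = some a) :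
    s = t :=
  Stream'.Seq.ext fun n => Option.ext fun a => h n a

theorem restrict_eq_compact (f : α → Option β) (s : Stream'.Seq α) :
    restrict f s = compact fun i => (s.get? i).bind f :=
  seq_ext_some fun _ _ => restrict_get?_eq_some.trans compact_get?_eq_some.symm

/-- `φ` restricts to a bijection from the defined positions of `g` before `i` to those of `g'`
before `φ i`. -/
theorem cnt_reindex {g g' : ℕ → Option α} {φ : ℕ → ℕ}
    (hmono : ∀ i j a b, g i = some a → g j = some b → i < j → φ i < φ j)
    (h : ∀ n a, g' n = some a ↔ ∃ i, g i = some a ∧ φ i = n) {i : ℕ} {a : α} (hi : g i = some a) :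
    cnt g' (φ i) = cnt g i := by
  classical
  unfold cnt
  rw [Nat.count_eq_card_filter_range, Nat.count_eq_card_filter_range]
  symm
  refine Finset.card_bij (fun j _ => φ j) ?_ ?_ ?_
  · intro j hj
    simp only [Finset.mem_filter, Finset.mem_range] at hj ⊢
    obtain ⟨hj, b, hb⟩ := hj
    exact ⟨hmono _ _ _ _ hb hi hj, b, (h _ _).2 ⟨j, hb, rfl⟩⟩
  · intro j hj j' hj' e
    simp only [Finset.mem_filter, Finset.mem_range] at hj hj'
    obtain ⟨_, b, hb⟩ := hj
    obtain ⟨_, b', hb'⟩ := hj'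
    rcases lt_trichotomy j j' with hlt | hlt | hlt
    · exact absurd e (hmono _ _ _ _ hb hb' hlt).ne
    · exact hlt
    · exact absurd e (hmono _ _ _ _ hb' hb hlt).ne'
  · intro n hn
    simp only [Finset.mem_filter, Finset.mem_range] at hn
    obtain ⟨hn, b, hb⟩ := hn
    obtain ⟨j, hj, rfl⟩ := (h _ _).1 hb
    refine ⟨j, ?_, rfl⟩
    simp only [Finset.mem_filter, Finset.mem_range]
    refine ⟨?_, b, hj⟩
    rcases lt_trichotomy j i with hlt | hlt | hlt
    · exact hlt
    · subst hlt
      exact absurd hn (lt_irrefl _)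
    · exact absurd hn (hmono _ _ _ _ hi hj hlt).not_gt

/-- Moving the defined entries to other positions without changing their order does not change the
sequence of defined entries. -/
theorem compact_reindex {g g' : ℕ → Option α} (φ : ℕ → ℕ)
    (hmono : ∀ i j a b, g i = some a → g j = some b → i < j → φ i < φ j)
    (h : ∀ n a, g' n = some a ↔ ∃ i, g i = some a ∧ φ i = n) : compact g' = compact g := by
  refine seq_ext_some fun n a => ?_
  rw [compact_get?_eq_some, compact_get?_eq_some]
  constructor
  · rintro ⟨m, hm, rfl⟩
    obtain ⟨i, hi, rfl⟩ := (h _ _).1 hm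
    exact ⟨i, hi, (cnt_reindex hmono h hi).symm⟩
  · rintro ⟨i, hi, rfl⟩
    exact ⟨φ i, (h _ _).2 ⟨i, hi, rfl⟩, cnt_reindex hmono h hi⟩

theorem seq_isSome_of_le {s : Stream'.Seq α} {i j : ℕ} {a : α} (h : s.get? j = some a)
    (hij : i ≤ j) : ∃ b, s.get? i = some b :=
  Option.ne_none_iff_exists'.1 fun h0 => by
    rw [s.le_stable hij h0] at h
    cases h

theorem cnt_get? {s : Stream'.Seq α} {i : ℕ} {a : α} (h : s.get? i = some a) :
    cnt s.get? i = i := by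
  induction i generalizing a with
  | zero => simp [cnt]
  | succ n ih =>
    obtain ⟨b, hb⟩ := seq_isSome_of_le h (Nat.le_succ n)
    rw [cnt_succ_of_some hb, ih hb]

theorem compact_get? (s : Stream'.Seq α) : compact s.get? = s := by
  refine seq_ext_some fun n a => ?_
  rw [compact_get?_eq_some]
  constructor
  · rintro ⟨i, hi, rfl⟩
    rwa [cnt_get? hi]
  · exact fun h => ⟨n, h, cnt_get? h⟩

/-- `cnt g` is an order-preserving reindexing of the surviving entries. Thus the observable labels,
and then those of one thread, can be selected directly in a sequence with gaps. -/
theorem compact_bind (g : ℕ → Option α) (f : α → Option β) :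
    (compact fun k => ((compact g).get? k).bind f) = compact fun i => (g i).bind f := by
  refine compact_reindex (cnt g) ?_ ?_
  · intro i j a b hi _ hij
    obtain ⟨c, hc, _⟩ := Option.bind_eq_some_iff.1 hi
    exact cnt_lt_cnt hc hij
  · intro n a
    constructor
    · intro h
      obtain ⟨c, hc, hca⟩ := Option.bind_eq_some_iff.1 h
      obtain ⟨i, hi, rfl⟩ := compact_get?_eq_some.1 hc
      exact ⟨i, by rw [hi]; exact hca, rfl⟩
    · rintro ⟨i, hi, rfl⟩
      obtain ⟨c, hc, hca⟩ := Option.bind_eq_some_iff.1 hi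
      rw [compact_get?_cnt hc]
      exact hca

theorem compact_terminates_of_eventually_none {g : ℕ → Option α} {N : ℕ}
    (h : ∀ n ≥ N, g n = none) : (compact g).Terminates := by
  refine ⟨cnt g N, ?_⟩
  change (compact g).get? _ = none
  by_contra hne
  obtain ⟨a, ha⟩ := Option.ne_none_iff_exists'.1 hne
  obtain ⟨i, hi, hc⟩ := compact_get?_eq_some.1 ha
  have hiN : i < N := by
    by_contra hiN
    rw [h i (by omega)] at hi
    cases hi
  exact absurd hc (cnt_lt_cnt hi hiN).ne

theorem exists_ge_of_not_compact_terminates {g : ℕ → Option α} (h : ¬ (compact g).Terminates)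
    (N : ℕ) : ∃ n ≥ N, ∃ a, g n = some a := by
  by_contra hne
  push Not at hne
  exact h (compact_terminates_of_eventually_none fun n hn =>
    Option.eq_none_iff_forall_ne_some.2 fun a => hne n hn a)

end Compact

/-! ### Runs with idle steps -/

section Stutter

universe u v w

variable {S : Type u} {T : Type v}

/-- A run that may idle: `q n` is the state at time `n`, and `l n` is the label of the step taken at
time `n`, or `none` if nothing happens. -/
structure StutterRun (A : LTS.{u, v, w} S T) (q : ℕ → A.Q) (l : ℕ → Option (S ⊕ T)) : Prop where
  init : q 0 = A.init
  step : ∀ n σ, l n = some σ → A.step (q n) σ (q (n + 1))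
  idle : ∀ n, l n = none → q (n + 1) = q n

/-- Silent labels that stay enabled are eventually taken. -/
def StutterFair (A : LTS.{u, v, w} S T) (q : ℕ → A.Q) (l : ℕ → Option (S ⊕ T)) : Prop :=
  ∀ (θ : T) (k : ℕ), (∀ j ≥ k, A.Enabled (Sum.inr θ) (q j)) → ∃ j ≥ k, l j = some (Sum.inr θ)

variable {A : LTS.{u, v, w} S T}

theorem StutterRun.state_eq {q : ℕ → A.Q} {l : ℕ → Option (S ⊕ T)} (h : StutterRun A q l) {i j : ℕ}
    (hij : i ≤ j) (hl : ∀ n, i ≤ n → n < j → l n = none) : q j = q i := by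
  induction j, hij using Nat.le_induction with
  | base => rfl
  | succ j hij ih =>
    rw [h.idle j (hl j hij (Nat.lt_succ_self j)), ih fun n h1 h2 => hl n h1 (by omega)]

/-- The run obtained by dropping the idle steps. -/
noncomputable def compactRun (q : ℕ → A.Q) (l : ℕ → Option (S ⊕ T)) : Stream'.Seq A.Trans :=
  compact fun n => (l n).map fun σ => (q n, σ, q (n + 1))

theorem cnt_map {α β : Type*} (g : ℕ → Option α) (f : ℕ → α → β) (n : ℕ) :
    cnt (fun n => (g n).map (f n)) n = cnt g n :=
  cnt_congr fun i _ => by simp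

theorem compactRun_get?_eq_some {q : ℕ → A.Q} {l : ℕ → Option (S ⊕ T)} {k : ℕ} {t : A.Trans} :
    (compactRun q l).get? k = some t ↔
      ∃ n σ, l n = some σ ∧ cnt l n = k ∧ t = (q n, σ, q (n + 1)) := by
  unfold compactRun
  rw [compact_get?_eq_some]
  constructor
  · rintro ⟨n, hn, hc⟩
    rw [cnt_map l (fun n σ => (q n, σ, q (n + 1)))] at hc
    obtain ⟨σ, hσ, rfl⟩ := Option.map_eq_some_iff.1 hn
    exact ⟨n, σ, hσ, hc, rfl⟩
  · rintro ⟨n, σ, hσ, hc, rfl⟩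
    refine ⟨n, by simp [hσ], ?_⟩
    rw [cnt_map l (fun n σ => (q n, σ, q (n + 1))), hc]

theorem StutterRun.isRun {q : ℕ → A.Q} {l : ℕ → Option (S ⊕ T)} (h : StutterRun A q l) :
    A.IsRun (compactRun q l) where
  trans k t ht := by
    obtain ⟨n, σ, hσ, -, rfl⟩ := compactRun_get?_eq_some.1 ht
    exact h.step n σ hσ
  start t ht := by
    obtain ⟨n, σ, hσ, hc, rfl⟩ := compactRun_get?_eq_some.1 ht
    change q n = _
    rw [h.state_eq (Nat.zero_le n), h.init]
    intro m _ hm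
    by_contra hne
    obtain ⟨a, ha⟩ := Option.ne_none_iff_exists'.1 hne
    have := cnt_lt_cnt ha hm
    omega
  consec k t t' ht ht' := by
    obtain ⟨n, σ, hσ, hc, rfl⟩ := compactRun_get?_eq_some.1 ht
    obtain ⟨n', σ', hσ', hc', rfl⟩ := compactRun_get?_eq_some.1 ht'
    have hlt : n < n' := lt_of_cnt_lt (g := l) (by omega)
    change q (n + 1) = q n'
    rw [h.state_eq (Nat.succ_le_of_lt hlt)]
    intro m hm hm'
    by_contra hne
    obtain ⟨a, ha⟩ := Option.ne_none_iff_exists'.1 hne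
    have h1 := cnt_lt_cnt ha hm'
    have h2 := cnt_lt_cnt hσ (show n < m by omega)
    omega

/-- Only runs with infinitely many steps need an argument. The state while idling is the source of
the next actual step, so a label enabled at all late steps of the compacted run is enabled at all
late times. -/
theorem StutterRun.memFairRun {q : ℕ → A.Q} {l : ℕ → Option (S ⊕ T)} (h : StutterRun A q l)
    (hf : StutterFair A q l) : A.MemFairRun (compactRun q l) := by
  refine ⟨h.isRun, or_iff_not_imp_left.2 fun hterm θ k hen => ?_⟩
  obtain ⟨t, ht⟩ : ∃ t, (compactRun q l).get? k = some t :=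
    Option.ne_none_iff_exists'.1 fun hn => hterm ⟨k, hn⟩
  obtain ⟨n, σ, hσ, hc, -⟩ := compactRun_get?_eq_some.1 ht
  have hnext : ∀ N, ∃ m, N ≤ m ∧ ∃ σ, l m = some σ := fun N => by
    obtain ⟨m, hm, a, ha⟩ := exists_ge_of_not_compact_terminates hterm N
    obtain ⟨σ, hσ, -⟩ := Option.map_eq_some_iff.1 ha
    exact ⟨m, hm, σ, hσ⟩
  obtain ⟨j, hj, hlj⟩ := hf θ n fun j hj => by
    classical
    obtain ⟨hm, σ', hσ'⟩ := Nat.find_spec (hnext j)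
    set m := Nat.find (hnext j) with hmdef
    have hqm : q m = q j := h.state_eq hm fun i hi hi' => by
      have := Nat.find_min (hnext j) (hmdef ▸ hi')
      push Not at this
      exact Option.eq_none_iff_forall_ne_some.2 fun a => this hi a
    rw [← hqm]
    exact hen (cnt l m) (hc ▸ cnt_mono l (hj.trans hm)) _
      (compactRun_get?_eq_some.2 ⟨m, σ', hσ', rfl, rfl⟩)
  exact ⟨cnt l j, hc ▸ cnt_mono l hj, _, compactRun_get?_eq_some.2 ⟨j, _, hlj, rfl, rfl⟩, rfl⟩

/-- The state reached before the `n`-th step of a run, or its last state. -/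
def stateAt (A : LTS.{u, v, w} S T) (μ : Stream'.Seq A.Trans) : ℕ → A.Q
  | 0 => A.init
  | n + 1 => match μ.get? n with
    | some t => t.2.2
    | none => stateAt A μ n

theorem stateAt_succ_of_some {μ : Stream'.Seq A.Trans} {n : ℕ} {t : A.Trans}
    (h : μ.get? n = some t) : stateAt A μ (n + 1) = t.2.2 := by
  simp [stateAt, h]

theorem stateAt_succ_of_none {μ : Stream'.Seq A.Trans} {n : ℕ}
    (h : μ.get? n = none) : stateAt A μ (n + 1) = stateAt A μ n := by
  simp [stateAt, h]

theorem IsRun.fst_eq_stateAt {μ : Stream'.Seq A.Trans} (h : A.IsRun μ) {n : ℕ} {t : A.Trans}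
    (ht : μ.get? n = some t) : t.1 = stateAt A μ n := by
  cases n with
  | zero => exact h.start t ht
  | succ n =>
    obtain ⟨t', ht'⟩ := seq_isSome_of_le ht (Nat.le_succ n)
    rw [stateAt_succ_of_some ht', ← h.consec n t' t ht' ht]

theorem IsRun.stutterRun {μ : Stream'.Seq A.Trans} (h : A.IsRun μ) :
    StutterRun A (stateAt A μ) (A.traceOf μ).get? where
  init := rfl
  step n σ hσ := by
    unfold LTS.traceOf at hσ
    rw [Stream'.Seq.map_get?] at hσ
    obtain ⟨t, ht, rfl⟩ := Option.map_eq_some_iff.1 hσ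
    rw [← IsRun.fst_eq_stateAt h ht, stateAt_succ_of_some ht]
    exact h.trans n t ht
  idle n hn := by
    unfold LTS.traceOf at hn
    rw [Stream'.Seq.map_get?] at hn
    exact stateAt_succ_of_none (Option.map_eq_none_iff.1 hn)

/-- A finite run is memory-fair whatever labels are enabled at its end, so its idling continuation
need not be fair; hence the two cases. -/
theorem MemFairRun.stutterFair {μ : Stream'.Seq A.Trans} (h : A.MemFairRun μ) :
    (∃ N, ∀ n ≥ N, (A.traceOf μ).get? n = none) ∨
      StutterFair A (stateAt A μ) (A.traceOf μ).get? := by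
  rcases h.2 with ⟨N, hN⟩ | hf
  · refine Or.inl ⟨N, fun n hn => ?_⟩
    unfold LTS.traceOf
    rw [Stream'.Seq.map_get?, μ.le_stable hn hN]
    rfl
  · refine Or.inr fun θ k hen => ?_
    obtain ⟨j, hj, t, ht, htθ⟩ := hf θ k fun j hj t ht => by
      rw [IsRun.fst_eq_stateAt h.1 ht]
      exact hen j hj
    refine ⟨j, hj, ?_⟩
    unfold LTS.traceOf
    rw [Stream'.Seq.map_get?, ht]
    simp [htθ]

section Extend

variable (q : ℕ → A.Q) (l : ℕ → Option (S ⊕ T)) (N : ℕ) (sched : ℕ → Option T)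

open Classical in
/-- From time `N` on, try the silent label `sched n` at time `n`. -/
noncomputable def extendState : ℕ → A.Q
  | 0 => q 0
  | n + 1 => if n < N then q (n + 1) else
    if h : ∃ θ q', sched n = some θ ∧ A.step (extendState n) (Sum.inr θ) q' then
      h.choose_spec.choose else extendState n

open Classical in
/-- The labels of the steps taken by `extendState`. -/
noncomputable def extendLabel (n : ℕ) : Option (S ⊕ T) :=
  if n < N then l n else
    if ∃ θ q', sched n = some θ ∧ A.step (extendState q N sched n) (Sum.inr θ) q' then
      (sched n).map Sum.inr else none

variable {q l N sched}

theorem extendState_of_le {n : ℕ} (h : n ≤ N) : extendState q N sched n = q n := by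
  cases n with
  | zero => rfl
  | succ n => rw [extendState, if_pos (by omega)]

theorem StutterRun.extend (h : StutterRun A q l) :
    StutterRun A (extendState q N sched) (extendLabel q l N sched) where
  init := h.init
  step n σ hσ := by
    unfold extendLabel at hσ
    by_cases hn : n < N
    · rw [if_pos hn] at hσ
      rw [extendState_of_le hn.le, extendState_of_le (Nat.succ_le_of_lt hn)]
      exact h.step n σ hσ
    · rw [if_neg hn] at hσ
      split_ifs at hσ with hex
      rw [extendState, if_neg hn, dif_pos hex]
      have := hex.choose_spec.choose_spec
      rw [this.1] at hσ
      cases hσ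
      exact this.2
  idle n hn' := by
    unfold extendLabel at hn'
    by_cases hn : n < N
    · rw [if_pos hn] at hn'
      rw [extendState_of_le hn.le, extendState_of_le (Nat.succ_le_of_lt hn)]
      exact h.idle n hn'
    · rw [if_neg hn] at hn'
      split_ifs at hn' with hex
      · obtain ⟨θ, _, hθ, _⟩ := hex
        simp [hθ] at hn'
      · rw [extendState, if_neg hn, dif_neg hex]

/-- A label that stays enabled is taken when the schedule next proposes it after time `N`. -/
theorem stutterFair_extend (hs : ∀ θ k, ∃ j ≥ k, sched j = some θ) :
    StutterFair A (extendState q N sched) (extendLabel q l N sched) := by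
  intro θ k hen
  obtain ⟨j, hj, hjθ⟩ := hs θ (max k N)
  refine ⟨j, (le_max_left _ _).trans hj, ?_⟩
  obtain ⟨q', hq'⟩ := hen j ((le_max_left _ _).trans hj)
  unfold extendLabel
  rw [if_neg (by have := le_max_right k N; omega), if_pos ⟨θ, q', hjθ, hq'⟩, hjθ]
  rfl

end Extend

/-- A schedule in which every element of a countable type occurs infinitely often. -/
theorem exists_schedule (T : Type*) [Countable T] :
    ∃ sched : ℕ → Option T, ∀ θ k, ∃ j ≥ k, sched j = some θ := by
  obtain ⟨f, hf⟩ := exists_injective_nat T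
  classical
  -- Time `n`, read as a pair, proposes the label coded by its first component; pairing that code
  -- with `k` gives a time `≥ k`.
  refine ⟨fun n => if h : ∃ θ, f θ = n.unpair.1 then some h.choose else none, fun θ k =>
    ⟨Nat.pair (f θ) k, Nat.right_le_pair _ _, ?_⟩⟩
  have h : ∃ θ', f θ' = (Nat.pair (f θ) k).unpair.1 := ⟨θ, by simp⟩
  simp only [dif_pos h]
  exact congrArg some (hf (h.choose_spec.trans (by simp)))

end Stutter

/-! ### Behaviors of runs with idle steps -/

section StutterBeh

universe u v w x

variable {Tid : Type u} {L : Type v} {T : Type x}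

open Classical in
/-- The event label of thread `τ` carried by an observable label. -/
noncomputable def proj (τ : Tid) (σ : Tid × L) : Option L := if σ.1 = τ then some σ.2 else none

theorem proj_eq_some {τ : Tid} {σ : Tid × L} {a : L} : proj τ σ = some a ↔ σ = (τ, a) := by
  obtain ⟨τ', a'⟩ := σ
  unfold proj
  split_ifs with h
  · simp at h
    simp [h]
  · simp at h
    simp [h]

/-- The observable part of a sequence of labels. -/
def obs (l : ℕ → Option ((Tid × L) ⊕ T)) (n : ℕ) : Option (Tid × L) := (l n).bind Sum.getLeft?

theorem obs_eq_some {l : ℕ → Option ((Tid × L) ⊕ T)} {n : ℕ} {σ : Tid × L} :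
    obs l n = some σ ↔ l n = some (Sum.inl σ) := by
  unfold obs
  rcases l n with _ | (σ' | θ) <;> simp

/-- The labels of thread `τ` in a history. -/
noncomputable def thr (h : ℕ → Option (Tid × L)) (τ : Tid) (n : ℕ) : Option L := (h n).bind (proj τ)

theorem thr_eq_some {h : ℕ → Option (Tid × L)} {τ : Tid} {n : ℕ} {a : L} :
    thr h τ n = some a ↔ h n = some (τ, a) := by
  unfold thr
  rw [Option.bind_eq_some_iff]
  simp [proj_eq_some]

/-- The behavior of a history. -/
noncomputable def histBeh (h : ℕ → Option (Tid × L)) : Behavior Tid L := fun τ => compact (thr h τ)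

theorem behOf_obsTraceOf (A : LTS.{max u v, x, w} (Tid × L) T) (μ : Stream'.Seq A.Trans) :
    behOf (A.obsTraceOf μ) = histBeh (obs (A.traceOf μ).get?) := by
  funext τ
  unfold behOf LTS.obsTraceOf histBeh
  rw [restrict_eq_compact, restrict_eq_compact, compact_bind]
  rfl

theorem behOf_obsTraceOf_compactRun {A : LTS.{max u v, x, w} (Tid × L) T} {q : ℕ → A.Q}
    {l : ℕ → Option ((Tid × L) ⊕ T)} : behOf (A.obsTraceOf (compactRun q l)) = histBeh (obs l) := by
  rw [behOf_obsTraceOf]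
  funext τ
  unfold histBeh thr obs
  have h : ∀ k, (A.traceOf (compactRun q l)).get? k =
      ((compactRun q l).get? k).bind fun t => some t.2.1 := fun k => by
    unfold LTS.traceOf
    rw [Stream'.Seq.map_get?, Option.map_eq_bind]
    rfl
  simp only [h, Option.bind_assoc]
  unfold compactRun
  rw [compact_bind]
  congr 1
  funext n
  rcases l n with _ | σ <;> rfl

variable {A : LTS.{max u v, x, w} (Tid × L) T}

/-- A finite run idles forever after its last step, so finite and infinite behaviors are described
by the same kind of run. -/
theorem mem_beh_iff {β : Behavior Tid L} :
    β ∈ A.Beh ↔ ∃ q l, StutterRun A q l ∧ β = histBeh (obs l) := by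
  constructor
  · rintro ⟨ρ, ⟨μ, hμ, rfl⟩, rfl⟩
    exact ⟨_, _, IsRun.stutterRun hμ, behOf_obsTraceOf A μ⟩
  · rintro ⟨q, l, h, rfl⟩
    exact ⟨_, ⟨_, h.isRun, rfl⟩, behOf_obsTraceOf_compactRun⟩

theorem StutterRun.mem_behMF {q : ℕ → A.Q} {l : ℕ → Option ((Tid × L) ⊕ T)} (h : StutterRun A q l)
    (hf : StutterFair A q l) : histBeh (obs l) ∈ A.BehMF :=
  ⟨_, ⟨_, h.memFairRun hf, rfl⟩, behOf_obsTraceOf_compactRun⟩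

theorem exists_stutterRun_of_mem_behMF {β : Behavior Tid L} (h : β ∈ A.BehMF) :
    ∃ q l, StutterRun A q l ∧ β = histBeh (obs l) ∧
      ((∃ N, ∀ n ≥ N, l n = none) ∨ StutterFair A q l) := by
  obtain ⟨ρ, ⟨μ, hμ, rfl⟩, rfl⟩ := h
  exact ⟨_, _, IsRun.stutterRun hμ.1, behOf_obsTraceOf A μ, MemFairRun.stutterFair hμ⟩

/-- A finite run is prolonged by silent steps along a fair schedule, which leaves the observable
history unchanged. TSO needs this: a finite run may end with nonempty buffers, while the
modification order is read off from the flushes. -/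
theorem exists_fair_stutterRun_of_mem_behMF [Countable T] {β : Behavior Tid L} (h : β ∈ A.BehMF) :
    ∃ q l, StutterRun A q l ∧ β = histBeh (obs l) ∧ StutterFair A q l := by
  obtain ⟨q, l, hr, rfl, ⟨N, hN⟩ | hf⟩ := exists_stutterRun_of_mem_behMF h
  · obtain ⟨sched, hs⟩ := exists_schedule T
    refine ⟨_, _, hr.extend (N := N) (sched := sched), ?_, stutterFair_extend hs⟩
    congr 1
    funext n
    unfold obs extendLabel
    by_cases hn : n < N
    · rw [if_pos hn]
    · rw [if_neg hn, hN n (by omega)]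
      split_ifs
      · rcases sched n with _ | θ <;> rfl
      · rfl
  · exact ⟨q, l, hr, rfl, hf⟩

theorem mem_behMF_of_isEmpty [IsEmpty T] {q : ℕ → A.Q} {l : ℕ → Option ((Tid × L) ⊕ T)}
    (h : StutterRun A q l) : histBeh (obs l) ∈ A.BehMF :=
  h.mem_behMF fun θ => isEmptyElim θ

end StutterBeh

/-! ### Events of a history -/

section Histories

variable {Tid Loc Val L : Type*}

theorem init_mem_eventsOf (β : Behavior Tid L) (x : Loc) : Event.init x ∈ eventsOf Loc β :=
  Or.inl ⟨x, rfl⟩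

theorem ev_mem_eventsOf {β : Behavior Tid L} {k : ℕ} {τ : Tid} {a : L} :
    Event.ev k τ a ∈ eventsOf Loc β ↔ (β τ).get? k = some a := by
  constructor
  · rintro (⟨x, h⟩ | ⟨k', τ', a', h, e⟩)
    · cases h
    · cases e
      exact h
  · exact fun h => Or.inr ⟨k, τ, a, h, rfl⟩

theorem wellFormed_eventsOf (β : Behavior Tid L) : WellFormed (eventsOf Loc β) where
  init_mem := init_mem_eventsOf β
  unique k τ a a' h h' := by
    rw [ev_mem_eventsOf] at h h'
    exact Option.some.inj (h.symm.trans h')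
  closed k τ a h j hj := by
    rw [ev_mem_eventsOf] at h
    obtain ⟨b, hb⟩ := seq_isSome_of_le h hj.le
    exact ⟨b, ev_mem_eventsOf.2 hb⟩

/-- The event `e` is issued at time `n` of the history `h`. -/
def OccursAt (h : ℕ → Option (Tid × L)) (n : ℕ) (e : Event Tid Loc L) : Prop :=
  ∃ τ a, h n = some (τ, a) ∧ e = .ev (cnt (thr h τ) n) τ a

variable {h : ℕ → Option (Tid × L)}

theorem OccursAt.time_unique {n m : ℕ} {e : Event Tid Loc L} (hn : OccursAt h n e)
    (hm : OccursAt h m e) : n = m := by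
  obtain ⟨τ, a, hn, rfl⟩ := hn
  obtain ⟨τ', a', hm, e⟩ := hm
  injection e with hc hτ ha
  subst hτ ha
  exact cnt_inj (thr_eq_some.2 hn) (thr_eq_some.2 hm) hc

theorem OccursAt.event_unique {n : ℕ} {e e' : Event Tid Loc L} (hn : OccursAt h n e)
    (hm : OccursAt h n e') : e = e' := by
  obtain ⟨τ, a, hn, rfl⟩ := hn
  obtain ⟨τ', a', hm, rfl⟩ := hm
  rw [hn] at hm
  cases hm
  rfl

theorem mem_eventsOf_histBeh {e : Event Tid Loc L} :
    e ∈ eventsOf Loc (histBeh h) ↔ (∃ x, e = .init x) ∨ ∃ n, OccursAt h n e := by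
  refine or_congr_right ?_
  constructor
  · rintro ⟨k, τ, a, hk, rfl⟩
    obtain ⟨n, hn, rfl⟩ := compact_get?_eq_some.1 hk
    exact ⟨n, τ, a, thr_eq_some.1 hn, rfl⟩
  · rintro ⟨n, τ, a, hn, rfl⟩
    exact ⟨_, τ, a, compact_get?_cnt (thr_eq_some.2 hn), rfl⟩

theorem OccursAt.mem {n : ℕ} {e : Event Tid Loc L} (hn : OccursAt h n e) :
    e ∈ eventsOf Loc (histBeh h) := mem_eventsOf_histBeh.2 (Or.inr ⟨n, hn⟩)

theorem OccursAt.not_init {n : ℕ} {e : Event Tid Loc L} (hn : OccursAt h n e) (x : Loc) :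
    e ≠ .init x := by
  obtain ⟨τ, a, _, rfl⟩ := hn
  exact fun h => by cases h

open Classical in
/-- The position of an event in the history: `0` for initialization events, and `n + 1` for the
event issued at time `n`. -/
noncomputable def time (h : ℕ → Option (Tid × L)) (e : Event Tid Loc L) : ℕ :=
  if hn : ∃ n, OccursAt h n e then hn.choose + 1 else 0

theorem OccursAt.time_eq {n : ℕ} {e : Event Tid Loc L} (hn : OccursAt h n e) :
    time h e = n + 1 := by
  have hex : ∃ n, OccursAt h n e := ⟨n, hn⟩
  unfold time
  rw [dif_pos hex, hex.choose_spec.time_unique hn]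

@[simp]
theorem time_init (x : Loc) : time h (Event.init x : Event Tid Loc L) = 0 := by
  unfold time
  rw [dif_neg]
  rintro ⟨n, hn⟩
  exact hn.not_init x rfl

/-- `time h` is injective on the events that occur in the history. -/
theorem finite_of_time_le {s : Set (Event Tid Loc L)} (N : ℕ) (hs : ∀ e ∈ s, ∃ n ≤ N, OccursAt h n e) :
    s.Finite := by
  refine Set.Finite.of_finite_image (f := time h) ?_ ?_
  · refine (Set.finite_Iic (N + 1)).subset ?_
    rintro _ ⟨e, he, rfl⟩
    obtain ⟨n, hn, hne⟩ := hs e he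
    rw [hne.time_eq]
    exact Nat.succ_le_succ hn
  · intro e he e' he' heq
    obtain ⟨n, hn, hne⟩ := hs e he
    obtain ⟨n', hn', hne'⟩ := hs e' he'
    rw [hne.time_eq, hne'.time_eq] at heq
    cases heq
    exact hne.event_unique hne'

theorem sb_iff_of_occursAt {n m : ℕ} {τ τ' : Tid} {a b : L} (hn : h n = some (τ, a))
    (hm : h m = some (τ', b)) :
    Event.Sb (.ev (cnt (thr h τ) n) τ a : Event Tid Loc L) (.ev (cnt (thr h τ') m) τ' b) ↔
      τ = τ' ∧ n < m := by
  change τ = τ' ∧ _ ↔ _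
  refine and_congr_right ?_
  rintro rfl
  exact ⟨lt_of_cnt_lt, cnt_lt_cnt (thr_eq_some.2 hn)⟩

/-- Program order is either from an initialization event, or within a thread and forward in time. -/
theorem sb_cases {a b : Event Tid Loc L} (ha : a ∈ eventsOf Loc (histBeh h))
    (hb : b ∈ eventsOf Loc (histBeh h)) (hab : a.Sb b) :
    ((∃ x, a = .init x) ∧ ∃ n, OccursAt h n b) ∨
      ∃ n m τ la lb, n < m ∧ h n = some (τ, la) ∧ h m = some (τ, lb) ∧
        a = .ev (cnt (thr h τ) n) τ la ∧ b = .ev (cnt (thr h τ) m) τ lb := by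
  rcases mem_eventsOf_histBeh.1 hb with ⟨x, rfl⟩ | ⟨m, hm⟩
  · cases a <;> exact hab.elim
  · rcases mem_eventsOf_histBeh.1 ha with ⟨x, rfl⟩ | ⟨n, hn⟩
    · exact Or.inl ⟨⟨x, rfl⟩, m, hm⟩
    · obtain ⟨τ, la, hn, rfl⟩ := hn
      obtain ⟨τ', lb, hm, rfl⟩ := hm
      obtain ⟨rfl, hlt⟩ := (sb_iff_of_occursAt hn hm).1 hab
      exact Or.inr ⟨n, m, τ, la, lb, hlt, hn, hm, rfl, rfl⟩

theorem time_lt_of_sb {a b : Event Tid Loc L} (ha : a ∈ eventsOf Loc (histBeh h))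
    (hb : b ∈ eventsOf Loc (histBeh h)) (hab : a.Sb b) : time h a < time h b := by
  rcases sb_cases ha hb hab with ⟨⟨x, rfl⟩, n, hn⟩ | ⟨n, m, τ, la, lb, hlt, hn, hm, rfl, rfl⟩
  · rw [time_init, hn.time_eq]
    exact Nat.succ_pos n
  · rw [OccursAt.time_eq ⟨τ, la, hn, rfl⟩, OccursAt.time_eq ⟨τ, lb, hm, rfl⟩]
    exact Nat.succ_lt_succ hlt

end Histories

/-! ### Graphs from read sources and timestamps -/

section MkGraph

variable {Tid Loc Val L : Type*} [MemLabel L Loc Val] [Zero Val]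

theorem Event.isW_init (x : Loc) : (Event.init x : Event Tid Loc L).IsW := rfl

theorem Event.not_isR_init (x : Loc) : ¬ (Event.init x : Event Tid Loc L).IsR :=
  Bool.false_ne_true

theorem Event.not_sb_init (a : Event Tid Loc L) (x : Loc) : ¬ a.Sb (.init x) := by
  cases a <;> exact id

theorem Event.exists_loc_of_isR {e : Event Tid Loc L} (h : e.IsR) : ∃ x, e.loc = some x := by
  unfold Event.IsR Event.valR at h
  unfold Event.loc
  rcases hacc : e.access with _ | a
  · rw [hacc] at h
    cases h
  · exact ⟨_, rfl⟩

/-- `src` gives every read a write to read from, and `ts` separates the writes to a location. -/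
structure SourceData (E : Set (Event Tid Loc L)) (src : Event Tid Loc L → Event Tid Loc L)
    (ts : Event Tid Loc L → ℕ) : Prop where
  wf : WellFormed E
  src_mem : ∀ r ∈ E, r.IsR → src r ∈ E
  src_isW : ∀ r ∈ E, r.IsR → (src r).IsW
  src_loc : ∀ r ∈ E, r.IsR → (src r).loc = r.loc
  src_val : ∀ r ∈ E, r.IsR → (src r).valW = r.valR
  ts_inj : ∀ a ∈ E, ∀ b ∈ E, a.IsW → b.IsW → a.SameLoc b → ts a = ts b → a = b

variable {E : Set (Event Tid Loc L)} {src : Event Tid Loc L → Event Tid Loc L}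
  {ts : Event Tid Loc L → ℕ}

/-- The execution graph in which `r` reads from `src r` and writes are ordered by `ts`. -/
def SourceData.graph (d : SourceData E src ts) : EGraph Tid L where
  E := E
  rf w r := r ∈ E ∧ r.IsR ∧ w = src r
  mo a b := a ∈ E ∧ b ∈ E ∧ a.IsW ∧ b.IsW ∧ a.SameLoc b ∧ ts a < ts b
  wf := d.wf
  rf_mem := by
    rintro w r ⟨hr, hR, rfl⟩
    exact ⟨d.src_mem r hr hR, hr⟩
  rf_type := by
    rintro w r ⟨hr, hR, rfl⟩
    exact ⟨d.src_isW r hr hR, hR⟩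
  rf_loc := by
    rintro w r ⟨hr, hR, rfl⟩
    exact d.src_loc r hr hR
  rf_val := by
    rintro w r ⟨hr, hR, rfl⟩
    exact d.src_val r hr hR
  rf_fun := by
    rintro w w' r ⟨_, _, rfl⟩ ⟨_, _, rfl⟩
    rfl
  rf_total r hr hR := ⟨_, hr, hR, rfl⟩
  mo_mem a b h := ⟨h.1, h.2.1⟩
  mo_type a b h := ⟨h.2.2.1, h.2.2.2.1, h.2.2.2.2.1⟩
  mo_irrefl a h := lt_irrefl _ h.2.2.2.2.2
  mo_trans := by
    rintro a b c ⟨ha, hb, haW, hbW, ⟨x, hx, hx'⟩, hab⟩ ⟨_, hc, _, hcW, ⟨y, hy, hy'⟩, hbc⟩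
    refine ⟨ha, hc, haW, hcW, ⟨x, hx, ?_⟩, hab.trans hbc⟩
    rw [hy', ← hx', hy]
  mo_total a ha b hb haW hbW hl hne := by
    have hl' : b.SameLoc a := by
      obtain ⟨x, h1, h2⟩ := hl
      exact ⟨x, h2, h1⟩
    rcases lt_trichotomy (ts a) (ts b) with h | h | h
    · exact Or.inl ⟨ha, hb, haW, hbW, hl, h⟩
    · exact absurd (d.ts_inj a ha b hb haW hbW hl h) hne
    · exact Or.inr ⟨hb, ha, hbW, haW, hl', h⟩

/-- Timestamps are natural numbers and separate the writes to one location, so the `mo` half of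
fairness is automatic for these graphs. -/
theorem SourceData.mo_prefixFinite (d : SourceData E src ts) : PrefixFinite d.graph.mo := by
  intro b
  refine Set.Finite.of_finite_image (f := ts) ?_ ?_
  · refine (Set.finite_Iio (ts b)).subset ?_
    rintro _ ⟨a, ha, rfl⟩
    exact ha.2.2.2.2.2
  · rintro a ⟨ha, _, haW, _, ⟨x, hx, hbx⟩, _⟩ a' ⟨ha', _, haW', _, ⟨y, hy, hby⟩, _⟩ he
    rw [hbx] at hby
    cases hby
    exact d.ts_inj a ha a' ha' haW haW' ⟨x, hx, hy⟩ he

theorem EGraph.sameLoc_of_fr {G : EGraph Tid L} {a b : Event Tid Loc L} (h : G.fr a b) :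
    a.SameLoc b := by
  obtain ⟨⟨w, hw, hm⟩, _⟩ := h
  obtain ⟨_, _, x, hx, hx'⟩ := G.mo_type _ _ hm
  exact ⟨x, by rw [← G.rf_loc _ _ hw, hx], hx'⟩

end MkGraph

/-! ### Acyclicity by measures -/

section Measure

variable {α : Type*}

theorem transGen_mono {R S : α → α → Prop} {a b : α} (h : Relation.TransGen R a b)
    (hRS : ∀ a b, R a b → S a b) : Relation.TransGen S a b :=
  Relation.TransGen.lift id hRS _ _ h

theorem irrefl_transGen_of_measure {R : α → α → Prop} (f : α → ℕ) (h : ∀ a b, R a b → f a < f b) :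
    Irrefl (Relation.TransGen R) := by
  have key : ∀ a b, Relation.TransGen R a b → f a < f b := fun a b hab => by
    induction hab with
    | single h1 => exact h _ _ h1
    | tail _ h1 ih => exact ih.trans (h _ _ h1)
  exact fun a ha => lt_irrefl _ (key a a ha)

theorem irrefl_transGen_of_lex {R : α → α → Prop} (f g : α → ℕ)
    (h : ∀ a b, R a b → f a < f b ∨ (f a ≤ f b ∧ g a < g b)) : Irrefl (Relation.TransGen R) := by
  have key : ∀ a b, Relation.TransGen R a b → f a < f b ∨ (f a ≤ f b ∧ g a < g b) :=
    fun a b hab => by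
      induction hab with
      | single h1 => exact h _ _ h1
      | tail _ h1 ih => have := h _ _ h1; omega
  exact fun a ha => by have := key a a ha; omega

end Measure

/-! ### Finite prefixes of program behaviors -/

section ProgramPrefix

universe u v w

variable {Tid : Type u} {L : Type v}

section

variable (h : ℕ → Option (Tid × L)) (N : Tid → ℕ)

open Classical in
/-- The history `h` with only the first `N τ` labels of each thread `τ`. -/
noncomputable def truncate (n : ℕ) : Option (Tid × L) :=
  (h n).bind fun σ => if cnt (thr h σ.1) n < N σ.1 then some σ else none

variable {h N}

theorem truncate_eq_some {n : ℕ} {τ : Tid} {a : L} :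
    truncate h N n = some (τ, a) ↔ h n = some (τ, a) ∧ cnt (thr h τ) n < N τ := by
  unfold truncate
  rw [Option.bind_eq_some_iff]
  constructor
  · rintro ⟨σ, hσ, hs⟩
    split_ifs at hs with hlt
    cases hs
    exact ⟨hσ, hlt⟩
  · rintro ⟨hσ, hlt⟩
    exact ⟨_, hσ, if_pos hlt⟩

theorem cnt_thr_truncate (τ : Tid) (n : ℕ) :
    cnt (thr (truncate h N) τ) n = min (cnt (thr h τ) n) (N τ) := by
  induction n with
  | zero => simp [cnt]
  | succ n ih =>
    rcases ht : thr (truncate h N) τ n with _ | a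
    · rw [cnt_succ_of_none ht, ih]
      rcases ht' : thr h τ n with _ | a
      · rw [cnt_succ_of_none ht']
      · rw [cnt_succ_of_some ht']
        have : ¬ cnt (thr h τ) n < N τ := fun hlt => by
          rw [thr_eq_some.2 (truncate_eq_some.2 ⟨thr_eq_some.1 ht', hlt⟩)] at ht
          cases ht
        omega
    · obtain ⟨h1, h2⟩ := truncate_eq_some.1 (thr_eq_some.1 ht)
      rw [cnt_succ_of_some ht, cnt_succ_of_some (thr_eq_some.2 h1), ih]
      omega

theorem histBeh_truncate {τ : Tid} {k : ℕ} {a : L} :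
    (histBeh (truncate h N) τ).get? k = some a ↔ k < N τ ∧ (histBeh h τ).get? k = some a := by
  unfold histBeh
  rw [compact_get?_eq_some, compact_get?_eq_some]
  constructor
  · rintro ⟨n, hn, rfl⟩
    obtain ⟨h1, h2⟩ := truncate_eq_some.1 (thr_eq_some.1 hn)
    rw [cnt_thr_truncate, min_eq_left h2.le]
    exact ⟨h2, n, thr_eq_some.2 h1, rfl⟩
  · rintro ⟨h2, n, hn, rfl⟩
    refine ⟨n, thr_eq_some.2 (truncate_eq_some.2 ⟨thr_eq_some.1 hn, h2⟩), ?_⟩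
    rw [cnt_thr_truncate, min_eq_left h2.le]

end

open Classical in
/-- The states of a program that follows `q` for the labels in `h` only. -/
noncomputable def followState {Q : Tid → Type w} (q : ℕ → ∀ τ, Q τ) (h : ℕ → Option (Tid × L)) :
    ℕ → ∀ τ, Q τ
  | 0 => q 0
  | n + 1 => fun τ => if ∃ a, h n = some (τ, a) then q (n + 1) τ else followState q h n τ

/-- Without a memory the threads do not interact, so each can be stopped after its own number of
labels while the others go on. Cutting the run at a single time would not do: the finite subgraphs
considered later need not be initial segments of the run. -/
theorem Program.exists_prefix_mem_beh {P : Program.{u, v, w} Tid L} {β : Behavior Tid L}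
    (hβ : β ∈ P.Beh) (N : Tid → ℕ) :
    ∃ β' ∈ P.Beh, ∀ τ k a, (β' τ).get? k = some a ↔ k < N τ ∧ (β τ).get? k = some a := by
  classical
  obtain ⟨(q : ℕ → ∀ τ, (P τ).Q), l, hr, rfl⟩ := mem_beh_iff.1 hβ
  set h := obs l with hh
  have hstep : ∀ n τ a, h n = some (τ, a) →
      ∃ s, (P τ).step (q n τ) (Sum.inl a) s ∧ q (n + 1) = Function.update (q n) τ s :=
    fun n τ a hn => hr.step n _ (obs_eq_some.1 hn)
  have hother : ∀ n τ, thr h τ n = none → q (n + 1) τ = q n τ := by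
    intro n τ hn
    rcases hl : l n with _ | (⟨τ', a⟩ | e)
    · rw [hr.idle n hl]
    · obtain ⟨s, -, hs⟩ := hstep n τ' a (obs_eq_some.2 hl)
      rw [hs, Function.update_of_ne]
      rintro rfl
      rw [thr_eq_some.2 (obs_eq_some.2 hl)] at hn
      cases hn
    · exact e.elim
  have hinv : ∀ n τ, cnt (thr h τ) n ≤ N τ → followState q (truncate h N) n τ = q n τ := by
    intro n
    induction n with
    | zero => exact fun _ _ => rfl
    | succ n ih =>
      intro τ hle
      simp only [followState]
      rcases ht : thr h τ n with _ | a
      · rw [if_neg, hother n τ ht]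
        · exact ih τ (by rwa [cnt_succ_of_none ht] at hle)
        · rintro ⟨a, ha⟩
          rw [thr_eq_some.2 (truncate_eq_some.1 ha).1] at ht
          cases ht
      · rw [cnt_succ_of_some ht] at hle
        rw [if_pos ⟨a, truncate_eq_some.2 ⟨thr_eq_some.1 ht, by omega⟩⟩]
  refine ⟨histBeh (truncate h N), mem_beh_iff.2
    ⟨followState q (truncate h N), fun n => (truncate h N n).map Sum.inl, ⟨hr.init, ?_, ?_⟩, ?_⟩,
    fun τ k a => histBeh_truncate⟩
  · intro n σ hσ
    obtain ⟨⟨τ, a⟩, hτ, rfl⟩ := Option.map_eq_some_iff.1 hσ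
    obtain ⟨h1, h2⟩ := truncate_eq_some.1 hτ
    obtain ⟨s, hs, hq⟩ := hstep n τ a h1
    refine ⟨s, ?_, ?_⟩
    · rw [hinv n τ h2.le]
      exact hs
    · funext τ'
      by_cases hτ' : τ' = τ
      · subst hτ'
        simp only [followState]
        rw [if_pos ⟨a, hτ⟩, hq, Function.update_self, Function.update_self]
      · simp only [followState]
        rw [if_neg, Function.update_of_ne hτ']
        rintro ⟨b, hb⟩
        rw [hτ] at hb
        cases hb
        exact hτ' rfl
  · intro n hn
    funext τ
    simp only [followState]
    rw [if_neg]
    rintro ⟨a, ha⟩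
    rw [ha] at hn
    cases hn
  · congr 1
    funext n
    simp only [obs]
    rcases truncate h N n with _ | σ <;> rfl

end ProgramPrefix

/-! ### Prefix finiteness -/

section PrefixFinite

variable {Tid Loc L : Type*}

/-- Serial numbers separate the predecessors within the thread; initialization is left out because
there may be infinitely many locations. -/
theorem po_prefix_finite {E : Set (Event Tid Loc L)} (wf : WellFormed E) (b : Event Tid Loc L) :
    {a | a ∈ E ∧ a.Sb b ∧ ¬ a.IsInit}.Finite := by
  rcases b with x | ⟨k, τ, l⟩
  · refine Set.finite_empty.subset ?_
    rintro a ⟨_, ha, _⟩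
    cases a <;> exact ha
  · refine Set.Finite.of_finite_image (f := fun a => match a with
      | .init _ => 0
      | .ev j _ _ => j) ((Set.finite_Iio k).subset ?_) ?_
    · rintro _ ⟨a, ⟨_, hs, hi⟩, rfl⟩
      rcases a with x | ⟨j, τ', l'⟩
      · exact absurd trivial hi
      · exact hs.2
    · rintro a ⟨ha, hs, hi⟩ b ⟨hb, hs', hi'⟩ heq
      rcases a with x | ⟨j, τ', l'⟩
      · exact absurd trivial hi
      rcases b with x | ⟨j', τ'', l''⟩
      · exact absurd trivial hi'
      obtain rfl : j = j' := heq
      obtain rfl : τ' = τ := hs.1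
      obtain rfl : τ'' = τ' := hs'.1
      rw [wf.unique _ _ _ _ ha hb]

/-- `R` between non-initialization events. -/
def NonInit (R : Event Tid Loc L → Event Tid Loc L → Prop) (a b : Event Tid Loc L) : Prop :=
  R a b ∧ ¬ a.IsInit ∧ ¬ b.IsInit

theorem NonInit.transGen {R : Event Tid Loc L → Event Tid Loc L → Prop} {a b : Event Tid Loc L}
    (h : Relation.TransGen (NonInit R) a b) : Relation.TransGen R a b :=
  transGen_mono h fun _ _ h => h.1

variable [Finite Tid]

/-- With finitely many threads, an acyclic relation that contains program order and in which events
have finitely many immediate predecessors is prefix-finite, up to initialization. -/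
theorem finite_prefix_of_acyclic {E : Set (Event Tid Loc L)} (wf : WellFormed E)
    {R : Event Tid Loc L → Event Tid Loc L → Prop} (hE : ∀ a b, R a b → a ∈ E ∧ b ∈ E)
    (hpo : ∀ a ∈ E, ∀ b ∈ E, a.Sb b → R a b) (hac : Irrefl (Relation.TransGen R))
    (hfin : ∀ b, ¬ b.IsInit → {a | R a b ∧ ¬ a.IsInit}.Finite) (b : Event Tid Loc L) :
    {a | Relation.ReflTransGen (NonInit R) a b}.Finite := by
  classical
  have : Fintype Tid := Fintype.ofFinite Tid
  set r := Relation.TransGen (NonInit R) with hr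
  have hirr : ∀ a, ¬ r a a := fun a h => hac a (NonInit.transGen h)
  have : IsStrictOrder (Event Tid Loc L) r :=
    { irrefl := hirr
      trans := fun _ _ _ => Relation.TransGen.trans }
  let f : Tid → Set (Event Tid Loc L) := fun τ => {e | e ∈ E ∧ ∃ k l, e = .ev k τ l}
  -- Program order is total on a thread and contained in `R`, so by acyclicity `r` increases serial
  -- numbers within a thread.
  have hf : ∀ τ, (f τ).WellFoundedOn r := by
    intro τ
    refine Set.wellFoundedOn_iff.2 ?_
    refine Subrelation.wf (r := InvImage (· < ·) (fun a : Event Tid Loc L => match a with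
      | .init _ => 0
      | .ev j _ _ => j)) ?_ (InvImage.wf _ wellFounded_lt)
    rintro a b ⟨hab, ⟨ha, k, l, rfl⟩, hb, k', l', rfl⟩
    change k < k'
    rcases lt_trichotomy k k' with hlt | heq | hlt
    · exact hlt
    · subst heq
      rw [wf.unique _ _ _ _ ha hb] at hab
      exact absurd hab (hirr _)
    · exact absurd ((NonInit.transGen hab).tail (hpo _ hb _ ha ⟨rfl, hlt⟩)) (hac _)
  -- A strict order that is well-founded on finitely many sets is well-founded on their union; this
  -- is where finiteness of `Tid` is used.
  have hU : (⋃ τ ∈ (Finset.univ : Finset Tid), f τ).WellFoundedOn r :=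
    (Finset.wellFoundedOn_bUnion _).2 fun τ _ => hf τ
  -- The predecessors of `b` are `b` and those of its finitely many immediate predecessors; this is
  -- the step of a well-founded induction.
  have hstep : ∀ b, (∀ a, NonInit R a b → {c | Relation.ReflTransGen (NonInit R) c a}.Finite) →
      {a | Relation.ReflTransGen (NonInit R) a b}.Finite := by
    intro b ih
    by_cases hb : b.IsInit
    · refine (Set.finite_singleton b).subset ?_
      intro a ha
      rcases Relation.ReflTransGen.cases_tail ha with h | ⟨c, _, hc⟩
      · exact h.symm
      · exact absurd hb hc.2.2
    · have h1 : (⋃ a ∈ {a | R a b ∧ ¬ a.IsInit},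
          {c | Relation.ReflTransGen (NonInit R) c a}).Finite :=
        (hfin b hb).biUnion fun a ha => ih a ⟨ha.1, ha.2, hb⟩
      refine (h1.union (Set.finite_singleton b)).subset ?_
      intro a ha
      rcases Relation.ReflTransGen.cases_tail ha with h | ⟨c, hac', hc⟩
      · exact Or.inr h.symm
      · exact Or.inl (Set.mem_biUnion (show c ∈ {a | R a b ∧ ¬ a.IsInit} from ⟨hc.1, hc.2.1⟩) hac')
  have hmemU : ∀ a ∈ E, ¬ a.IsInit → a ∈ ⋃ τ ∈ (Finset.univ : Finset Tid), f τ := by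
    intro a ha hi
    rcases a with x | ⟨k, τ, l⟩
    · exact absurd trivial hi
    · exact Set.mem_biUnion (Finset.mem_coe.2 (Finset.mem_univ τ)) ⟨ha, k, l, rfl⟩
  have hmain : ∀ b ∈ ⋃ τ ∈ (Finset.univ : Finset Tid), f τ,
      {a | Relation.ReflTransGen (NonInit R) a b}.Finite := by
    intro b hb
    refine hU.induction (P := fun b => {a | Relation.ReflTransGen (NonInit R) a b}.Finite) hb
      fun b _ ih => ?_
    exact hstep b fun a ha => ih a (hmemU a (hE _ _ ha.1).1 ha.2.1) (Relation.TransGen.single ha)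
  exact hstep b fun a ha => hmain a (hmemU a (hE _ _ ha.1).1 ha.2.1)

end PrefixFinite

/-! ### Restriction of execution graphs -/

section Restrict

variable {Tid Loc Val L : Type*} [MemLabel L Loc Val] [Zero Val]

namespace EGraph

/-- Sets of events of `G` that contain initialization and are closed under `po` and `rf`. -/
structure IsPrefix (G : EGraph Tid L) (D : Set (Event Tid Loc L)) : Prop where
  sub : D ⊆ G.E
  init_mem : ∀ x, Event.init x ∈ D
  po_closed : ∀ a b, G.po a b → b ∈ D → a ∈ D
  rf_closed : ∀ a b, G.rf a b → b ∈ D → a ∈ D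

/-- The restriction of an execution graph to a prefix. -/
def restrictTo (G : EGraph Tid L) (D : Set (Event Tid Loc L)) (hD : G.IsPrefix D) :
    EGraph Tid L where
  E := D
  rf a b := G.rf a b ∧ a ∈ D ∧ b ∈ D
  mo a b := G.mo a b ∧ a ∈ D ∧ b ∈ D
  wf :=
    { init_mem := hD.init_mem
      unique := fun k τ l l' h h' => G.wf.unique k τ l l' (hD.sub h) (hD.sub h')
      closed := fun k τ l h j hj => by
        obtain ⟨l', hl'⟩ := G.wf.closed k τ l (hD.sub h) j hj
        exact ⟨l', hD.po_closed _ _ ⟨hl', hD.sub h, rfl, hj⟩ h⟩ }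
  rf_mem w r h := h.2
  rf_type w r h := G.rf_type w r h.1
  rf_loc w r h := G.rf_loc w r h.1
  rf_val w r h := G.rf_val w r h.1
  rf_fun w w' r h h' := G.rf_fun w w' r h.1 h'.1
  rf_total r hr hR := by
    obtain ⟨w, hw⟩ := G.rf_total r (hD.sub hr) hR
    exact ⟨w, hw, hD.rf_closed _ _ hw hr, hr⟩
  mo_mem a b h := h.2
  mo_type a b h := G.mo_type a b h.1
  mo_irrefl a h := G.mo_irrefl a h.1
  mo_trans a b c h h' := ⟨G.mo_trans a b c h.1 h'.1, h.2.1, h'.2.2⟩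
  mo_total a ha b hb haW hbW hl hne :=
    (G.mo_total a (hD.sub ha) b (hD.sub hb) haW hbW hl hne).imp (⟨·, ha, hb⟩) (⟨·, hb, ha⟩)

variable {G : EGraph Tid L} {D : Set (Event Tid Loc L)} {hD : G.IsPrefix D}
  {a b : Event Tid Loc L}

theorem restrictTo_po : (G.restrictTo D hD).po a b ↔ G.po a b ∧ a ∈ D ∧ b ∈ D :=
  ⟨fun h => ⟨⟨hD.sub h.1, hD.sub h.2.1, h.2.2⟩, h.1, h.2.1⟩, fun h => ⟨h.2.1, h.2.2, h.1.2.2⟩⟩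

/-- Closure of `D` under `rf` keeps the source of a read in `D`; otherwise `fr` edges could be lost.
-/
theorem restrictTo_fr : (G.restrictTo D hD).fr a b ↔ G.fr a b ∧ a ∈ D ∧ b ∈ D := by
  constructor
  · rintro ⟨⟨w, hw, hm⟩, hne⟩
    exact ⟨⟨⟨w, hw.1, hm.1⟩, hne⟩, hw.2.2, hm.2.2⟩
  · rintro ⟨⟨⟨w, hw, hm⟩, hne⟩, ha, hb⟩
    have hwD := hD.rf_closed _ _ hw ha
    exact ⟨⟨w, ⟨hw, hwD, ha⟩, hm, hwD, hb⟩, hne⟩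

/-- Being external is a negative condition, so it matters that the restriction keeps all program
order between events of `D`. -/
theorem restrictTo_rfe (h : (G.restrictTo D hD).rfe a b) : G.rfe a b :=
  ⟨h.1.1, fun hpo => h.2 (restrictTo_po.2 ⟨hpo, h.1.2⟩)⟩

theorem restrictTo_hbRA (h : (G.restrictTo D hD).hbRA a b) : G.hbRA a b :=
  transGen_mono h fun _ _ h => h.imp (fun h => (restrictTo_po.1 h).1) And.left

theorem restrictTo_scLoc (h : (G.restrictTo D hD).scLoc a b) : G.scLoc a b :=
  transGen_mono h fun _ _ h => by
    rcases h with h | h | h | h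
    · exact Or.inl ⟨(restrictTo_po.1 h.1).1, h.2⟩
    · exact Or.inr (Or.inl h.1)
    · exact Or.inr (Or.inr (Or.inl h.1))
    · exact Or.inr (Or.inr (Or.inr (restrictTo_fr.1 h).1))

theorem restrictTo_raLoc (h : (G.restrictTo D hD).raLoc a b) : G.raLoc a b :=
  transGen_mono h fun _ _ h => by
    rcases h with h | h | h | h
    · exact Or.inl ⟨restrictTo_hbRA h.1, h.2⟩
    · exact Or.inr (Or.inl h.1)
    · exact Or.inr (Or.inr (Or.inl h.1))
    · exact Or.inr (Or.inr (Or.inr (restrictTo_fr.1 h).1))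

theorem restrictTo_hbTSO (h : (G.restrictTo D hD).hbTSO a b) : G.hbTSO a b :=
  transGen_mono h fun _ _ h => by
    rcases h with h | h | h | h
    · exact Or.inl ⟨(restrictTo_po.1 h.1).1, h.2⟩
    · exact Or.inr (Or.inl (restrictTo_rfe h))
    · exact Or.inr (Or.inr (Or.inl h.1))
    · exact Or.inr (Or.inr (Or.inr (restrictTo_fr.1 h).1))

theorem restrictTo_eco (h : (G.restrictTo D hD).eco a b) : G.eco a b :=
  transGen_mono h fun _ _ h => by
    rcases h with h | h | h
    · exact Or.inl h.1
    · exact Or.inr (Or.inl h.1)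
    · exact Or.inr (Or.inr (restrictTo_fr.1 h).1)

end EGraph

/-- `𝒢` is closed under restriction to `po ∪ rf`-prefixes. -/
def PrefixClosed (𝒢 : DeclMem Tid L) : Prop :=
  ∀ G ∈ 𝒢, ∀ D (hD : G.IsPrefix D), G.restrictTo D hD ∈ 𝒢

/-- The relations of the restriction are contained in those of `G`, and consistency only asks for
irreflexivity; the same argument serves the other models. -/
theorem prefixClosed_GTSO : PrefixClosed (GTSO Tid L) := fun _ hG _ _ =>
  ⟨fun a h => hG.1 a (EGraph.restrictTo_hbTSO h), fun a h => hG.2 a (EGraph.restrictTo_scLoc h)⟩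

theorem prefixClosed_GRA : PrefixClosed (GRA Tid L) := fun _ hG _ _ a h =>
  hG a (EGraph.restrictTo_raLoc h)

theorem prefixClosed_GStrongCOH : PrefixClosed (GStrongCOH Tid L) := fun _ hG _ _ =>
  ⟨fun a h => hG.1 a (EGraph.restrictTo_hbRA h), fun a h => hG.2 a (EGraph.restrictTo_scLoc h)⟩

end Restrict

/-! ### Restriction of RC11 graphs -/

section RestrictRC11

variable {Tid Loc Val : Type*} [Zero Val]

namespace EGraph

variable {G : EGraph Tid (CLab Loc Val)} {D : Set (Event Tid Loc (CLab Loc Val))}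
  {hD : G.IsPrefix D} {a b : Event Tid Loc (CLab Loc Val)}

theorem restrictTo_rs (h : (G.restrictTo D hD).rs a b) : G.rs a b := by
  obtain ⟨ha, haW, c, hac, hcW, hc, hcb⟩ := h
  exact ⟨hD.sub ha, haW, c, hac.imp_right fun h => ⟨(restrictTo_po.1 h.1).1, h.2⟩, hcW, hc,
    Relation.ReflTransGen.lift id (fun _ _ h => ⟨h.1.1, h.2⟩) _ _ hcb⟩

theorem restrictTo_sw (h : (G.restrictTo D hD).sw a b) : G.sw a b := by
  obtain ⟨ha, hb, w, w', r, haw, hrs, hrf, hr, hrb⟩ := h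
  exact ⟨ha, hb, w, w', r, haw.imp_right fun h => ⟨h.1, (restrictTo_po.1 h.2).1⟩,
    restrictTo_rs hrs, hrf.1, hr, hrb.imp_right fun h => ⟨(restrictTo_po.1 h.1).1, h.2⟩⟩

theorem restrictTo_hbRC11 (h : (G.restrictTo D hD).hbRC11 a b) : G.hbRC11 a b :=
  transGen_mono h fun _ _ h => h.imp (fun h => (restrictTo_po.1 h).1) restrictTo_sw

theorem restrictTo_poNeqLoc (h : (G.restrictTo D hD).poNeqLoc a b) : G.poNeqLoc a b :=
  ⟨(restrictTo_po.1 h.1).1, h.2⟩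

theorem restrictTo_scb (h : (G.restrictTo D hD).scb a b) : G.scb a b := by
  rcases h with h | ⟨c, d, h1, h2, h3⟩ | h | h | h
  · exact Or.inl (restrictTo_po.1 h).1
  · exact Or.inr (Or.inl
      ⟨c, d, restrictTo_poNeqLoc h1, restrictTo_hbRC11 h2, restrictTo_poNeqLoc h3⟩)
  · exact Or.inr (Or.inr (Or.inl ⟨restrictTo_hbRC11 h.1, h.2⟩))
  · exact Or.inr (Or.inr (Or.inr (Or.inl h.1)))
  · exact Or.inr (Or.inr (Or.inr (Or.inr (restrictTo_fr.1 h).1)))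

theorem restrictTo_pscBase (h : (G.restrictTo D hD).pscBase a b) : G.pscBase a b := by
  obtain ⟨ha, hb, c, d, hac, hcd, hdb⟩ := h
  exact ⟨ha, hb, c, d, hac.imp_right fun h => ⟨h.1, restrictTo_hbRC11 h.2⟩, restrictTo_scb hcd,
    hdb.imp_right fun h => ⟨restrictTo_hbRC11 h.1, h.2⟩⟩

theorem restrictTo_pscF (h : (G.restrictTo D hD).pscF a b) : G.pscF a b := by
  obtain ⟨ha, haF, hb, hbF, h | ⟨c, d, h1, h2, h3⟩⟩ := h
  · exact ⟨ha, haF, hb, hbF, Or.inl (restrictTo_hbRC11 h)⟩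
  · exact ⟨ha, haF, hb, hbF,
      Or.inr ⟨c, d, restrictTo_hbRC11 h1, restrictTo_eco h2, restrictTo_hbRC11 h3⟩⟩

end EGraph

theorem prefixClosed_GRC11 : PrefixClosed (GRC11 Tid Loc Val) := by
  rintro G ⟨h1, h2, h3, h4, h5⟩ D hD
  refine ⟨fun a h => h1 a (EGraph.restrictTo_hbRC11 h),
    fun a b h h' => h2 a b (EGraph.restrictTo_hbRC11 h) (EGraph.restrictTo_eco h'),
    fun a h => h3 a (EGraph.restrictTo_eco h), fun a h => h4 a ?_,
    fun a h => h5 a (EGraph.restrictTo_hbRA h)⟩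
  exact transGen_mono h fun _ _ h => h.imp EGraph.restrictTo_pscBase EGraph.restrictTo_pscF

end RestrictRC11

/-! ### Robustness of infinite executions -/

section Limit

variable {Tid Loc Val L : Type*} [MemLabel L Loc Val] [Zero Val]

/-- A path has finitely many edges, so a cycle in an infinite graph lives on a finite set of events.
-/
theorem exists_finite_support_of_transGen {α : Type*} {R : α → α → Prop} {a b : α}
    (h : Relation.TransGen R a b) :
    ∃ s : Set α, s.Finite ∧ Relation.TransGen (fun x y => R x y ∧ x ∈ s ∧ y ∈ s) a b := by
  induction h with
  | @single b h =>
    exact ⟨{a, b}, by simp, Relation.TransGen.single ⟨h, by simp, by simp⟩⟩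
  | @tail b c _ h ih =>
    obtain ⟨s, hs, hab⟩ := ih
    refine ⟨s ∪ {b, c}, hs.union (by simp), Relation.TransGen.tail
      (transGen_mono hab fun _ _ h => ⟨h.1, Or.inl h.2.1, Or.inl h.2.2⟩)
      ⟨h, by simp, by simp⟩⟩

theorem EGraph.rf_prefixFinite (G : EGraph Tid L) : PrefixFinite G.rf := fun _ =>
  Set.Subsingleton.finite fun _ h₁ _ h₂ => G.rf_fun _ _ _ h₁ h₂

/-- A consistent execution graph of a finitely robust program is sequentially consistent, even if it
is infinite. -/
theorem FinitelyRobust.mem_GSC [Finite Tid] {P : Program Tid L} {𝒢 : DeclMem Tid L}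
    (hP : FinitelyRobust P 𝒢) (h𝒢 : PrefixClosed 𝒢) {β : Behavior Tid L} (hβ : β ∈ P.Beh)
    {G : EGraph Tid L} (hG : G ∈ 𝒢) (hE : eventsOf Loc β = G.E) (hac : Irrefl G.hbRA) :
    G ∈ GSC Tid L := by
  classical
  intro e he
  obtain ⟨s, hs, hcyc⟩ := exists_finite_support_of_transGen he
  let R : Event Tid Loc L → Event Tid Loc L → Prop := fun a b => G.po a b ∨ G.rf a b
  have hRE : ∀ a b, R a b → a ∈ G.E ∧ b ∈ G.E := fun a b h =>
    h.elim (fun h => ⟨h.1, h.2.1⟩) (G.rf_mem a b)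
  have hfin := finite_prefix_of_acyclic G.wf (R := R) hRE
    (fun a ha b hb h => Or.inl ⟨ha, hb, h⟩) hac fun b _ =>
      ((po_prefix_finite G.wf b).union (G.rf_prefixFinite b)).subset fun a ha =>
        ha.1.imp (fun h => ⟨h.1, h.2.2, ha.2⟩) id
  -- The events from which the support of the cycle is reached along `po ∪ rf` outside
  -- initialization.
  let D0 : Set (Event Tid Loc L) :=
    {a | a ∈ G.E ∧ ∃ b ∈ s, Relation.ReflTransGen (NonInit R) a b}
  have hD0 : D0.Finite := (hs.biUnion fun b _ => hfin b).subset fun a ha => by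
    obtain ⟨_, b, hb, hab⟩ := ha
    exact Set.mem_biUnion hb hab
  let D : Set (Event Tid Loc L) := {a | a.IsInit ∨ a ∈ D0}
  have hclosed : ∀ a b, R a b → b ∈ D → a ∈ D := by
    intro a b hab hb
    by_cases ha : a.IsInit
    · exact Or.inl ha
    have hbi : ¬ b.IsInit := by
      rcases b with x | ⟨k, τ, l⟩
      · rcases hab with h | h
        · exact absurd h.2.2 (Event.not_sb_init _ _)
        · exact absurd (G.rf_type _ _ h).2 (Event.not_isR_init x)
      · exact id
    rcases hb with hb | ⟨_, c, hc, hbc⟩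
    · exact absurd hb hbi
    · exact Or.inr ⟨(hRE a b hab).1, c, hc, Relation.ReflTransGen.head ⟨hab, ha, hbi⟩ hbc⟩
  have hD : G.IsPrefix D :=
    { sub := fun a ha => by
        rcases ha with ha | ha
        · rcases a with x | _
          · exact G.wf.init_mem x
          · exact ha.elim
        · exact ha.1
      init_mem := fun x => Or.inl trivial
      po_closed := fun a b h => hclosed a b (Or.inl h)
      rf_closed := fun a b h => hclosed a b (Or.inr h) }
  have hsD : ∀ a ∈ s, a ∈ G.E → a ∈ D := fun a ha haE => Or.inr ⟨haE, a, ha, .refl⟩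
  -- `D0` uses finitely many serial numbers; the least one missing in a thread becomes the length of
  -- its prefix.
  have hex : ∀ τ, ∃ k, ∀ l, Event.ev k τ l ∉ D := by
    intro τ
    obtain ⟨k, hk⟩ := (hD0.image (fun a : Event Tid Loc L => match a with
      | .init _ => 0
      | .ev j _ _ => j)).infinite_compl.nonempty
    refine ⟨k, fun l hl => hk ?_⟩
    rcases hl with hl | hl
    · exact hl.elim
    · exact ⟨_, hl, rfl⟩
  obtain ⟨β', hβ', hget⟩ := Program.exists_prefix_mem_beh hβ fun τ => Nat.find (hex τ)
  have hfinβ : β'.IsFinite := fun τ => ⟨Nat.find (hex τ), by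
    by_contra hne
    obtain ⟨a, ha⟩ := Option.ne_none_iff_exists'.1 hne
    exact lt_irrefl _ ((hget _ _ _).1 ha).1⟩
  have hE' : eventsOf Loc β' = D := by
    ext a
    rcases a with x | ⟨k, τ, l⟩
    · exact ⟨fun _ => Or.inl trivial, fun _ => init_mem_eventsOf β' x⟩
    · rw [ev_mem_eventsOf, hget, ← ev_mem_eventsOf (Loc := Loc), hE]
      constructor
      · rintro ⟨hk, hmem⟩
        have := Nat.find_min (hex τ) hk
        push Not at this
        obtain ⟨l', hl'⟩ := this
        rwa [G.wf.unique _ _ _ _ hmem (hD.sub hl')]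
      · intro h
        refine ⟨?_, hD.sub h⟩
        -- An event of `D` at or beyond the first missing serial number would bring that number into
        -- `D` by closure under `po`.
        by_contra hk
        rcases Nat.lt_or_eq_of_le (not_lt.1 hk) with hlt | heq
        · obtain ⟨l', hl'⟩ := G.wf.closed _ _ _ (hD.sub h) _ hlt
          exact Nat.find_spec (hex τ) l' (hD.po_closed _ _ ⟨hl', hD.sub h, rfl, hlt⟩ h)
        · have := Nat.find_spec (hex τ) l
          rw [heq] at this
          exact this h
  -- All edges of the cycle have both ends in `s`, hence in `D`, so the cycle survives in the finite
  -- graph.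
  refine hP β' hβ' hfinβ _ (h𝒢 G hG D hD) hE' e (transGen_mono hcyc ?_)
  rintro a b ⟨hab, has, hbs⟩
  rcases hab with h | h | h | h
  · exact Or.inl (EGraph.restrictTo_po.2 ⟨h, hsD a has h.1, hsD b hbs h.2.1⟩)
  · exact Or.inr (Or.inl ⟨h, hsD a has (G.rf_mem _ _ h).1, hsD b hbs (G.rf_mem _ _ h).2⟩)
  · exact Or.inr (Or.inr (Or.inl ⟨h, hsD a has (G.mo_mem _ _ h).1, hsD b hbs (G.mo_mem _ _ h).2⟩))
  · refine Or.inr (Or.inr (Or.inr (EGraph.restrictTo_fr.2 ⟨h, ?_, ?_⟩)))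
    · obtain ⟨⟨w, hw, _⟩, _⟩ := h
      exact hsD a has (G.rf_mem _ _ hw).2
    · obtain ⟨⟨w, _, hm⟩, _⟩ := h
      exact hsD b hbs (G.mo_mem _ _ hm).2

end Limit

/-! ### Sequential consistency: effect of labels -/

section SCStep

variable {Tid Loc Val L : Type*} [MemLabel L Loc Val] [Zero Val]

open Classical in
/-- The effect of a label on the memory. -/
noncomputable def scApply (a : L) (M : Loc → Val) : Loc → Val :=
  match (MemLabel.access a : Option (ELab Loc Val)) with
  | some (.read _ _) => M
  | some (.write x v) => Function.update M x v
  | some (.rmw x _ v) => Function.update M x v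
  | none => M

theorem scApply_of_isW {k : ℕ} {τ : Tid} {a : L} {x : Loc} {v : Val} (M : Loc → Val)
    (hx : (Event.ev k τ a : Event Tid Loc L).loc = some x)
    (hv : (Event.ev k τ a : Event Tid Loc L).valW = some v) : scApply a M x = v := by
  unfold scApply
  change (MemLabel.access a : Option (ELab Loc Val)).map ELab.loc = some x at hx
  change (MemLabel.access a : Option (ELab Loc Val)).bind ELab.valW = some v at hv
  classical
  rcases hacc : (MemLabel.access a : Option (ELab Loc Val)) with _ | (⟨y, u⟩ | ⟨y, u⟩ | ⟨y, u, u'⟩) <;>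
    rw [hacc] at hx hv <;> cases hx <;> cases hv <;> exact Function.update_self ..

theorem scApply_of_not_isW {k : ℕ} {τ : Tid} {a : L} {x : Loc} (M : Loc → Val)
    (hx : ¬ ((Event.ev k τ a : Event Tid Loc L).IsW ∧
      (Event.ev k τ a : Event Tid Loc L).loc = some x)) : scApply a M x = M x := by
  unfold scApply
  change ¬ (((MemLabel.access a : Option (ELab Loc Val)).bind ELab.valW).isSome = true ∧
    (MemLabel.access a : Option (ELab Loc Val)).map ELab.loc = some x) at hx
  classical
  rcases hacc : (MemLabel.access a : Option (ELab Loc Val)) with _ | (⟨y, u⟩ | ⟨y, u⟩ | ⟨y, u, u'⟩) <;>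
    rw [hacc] at hx <;>
    first
    | rfl
    | exact Function.update_of_ne (fun h => hx ⟨rfl, congrArg some h.symm⟩) _ _

/-- Separates the effect of a label from the condition on the value read, uniformly for plain and
RC11 labels, fences included. The serial number `k` plays no role in either. -/
theorem MSC_step_iff {k : ℕ} {τ : Tid} {a : L} {M M' : Loc → Val} :
    (MSC Tid Loc Val L).step M (Sum.inl (τ, a)) M' ↔ M' = scApply a M ∧
      ∀ x v, (Event.ev k τ a : Event Tid Loc L).loc = some x →
        (Event.ev k τ a : Event Tid Loc L).valR = some v → M x = v := by
  unfold scApply Event.loc Event.valR Event.access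
  simp only [MSC]
  rcases (MemLabel.access a : Option (ELab Loc Val)) with _ | (⟨y, u⟩ | ⟨y, u⟩ | ⟨y, u, u'⟩) <;>
    simp [ELab.loc, ELab.valR, and_comm]

end SCStep

/-! ### Linearization of sequentially consistent graphs -/

section Linearize

variable {Tid Loc Val L : Type*}

open Classical in
/-- The history in which the events of `β` occur at the times given by `rank`. -/
noncomputable def rankHist (β : Behavior Tid L) (rank : Event Tid Loc L → ℕ) (n : ℕ) :
    Option (Tid × L) :=
  if h : ∃ σ : Tid × L, ∃ k, (β σ.1).get? k = some σ.2 ∧ rank (.ev k σ.1 σ.2) = n then some h.choose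
  else none

variable {β : Behavior Tid L} {rank : Event Tid Loc L → ℕ}

theorem rankHist_eq_some (hinj : ∀ a ∈ eventsOf Loc β, ∀ b ∈ eventsOf Loc β, ¬ a.IsInit →
      ¬ b.IsInit → rank a = rank b → a = b) {n : ℕ} {τ : Tid} {a : L} :
    rankHist β rank n = some (τ, a) ↔ ∃ k, (β τ).get? k = some a ∧ rank (.ev k τ a) = n := by
  unfold rankHist
  constructor
  · intro h
    split_ifs at h with hex
    have := hex.choose_spec
    rwa [Option.some.inj h] at this
  · rintro ⟨k, hk, hn⟩
    have hex : ∃ σ : Tid × L, ∃ k, (β σ.1).get? k = some σ.2 ∧ rank (.ev k σ.1 σ.2) = n :=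
      ⟨(τ, a), k, hk, hn⟩
    rw [dif_pos hex]
    obtain ⟨k', hk', hn'⟩ := hex.choose_spec
    have := hinj _ (ev_mem_eventsOf.2 hk') _ (ev_mem_eventsOf.2 hk) id id (hn'.trans hn.symm)
    injection this with _ h1 h2
    exact congrArg some (Prod.ext h1 h2)

/-- `rank` respects the order within each thread, so removing the gaps gives back the sequence of
the thread. -/
theorem histBeh_rankHist (hinj : ∀ a ∈ eventsOf Loc β, ∀ b ∈ eventsOf Loc β, ¬ a.IsInit →
      ¬ b.IsInit → rank a = rank b → a = b)
    (hmono : ∀ a ∈ eventsOf Loc β, ∀ b ∈ eventsOf Loc β, ¬ a.IsInit → ¬ b.IsInit → a.Sb b →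
      rank a < rank b) : histBeh (rankHist β rank) = β := by
  funext τ
  refine (compact_reindex (g := (β τ).get?) (fun k => match (β τ).get? k with
    | some a => rank (.ev k τ a)
    | none => 0) ?_ ?_).trans (compact_get? _)
  · intro i j a b hi hj hij
    simp only [hi, hj]
    exact hmono _ (ev_mem_eventsOf.2 hi) _ (ev_mem_eventsOf.2 hj) id id ⟨rfl, hij⟩
  · intro n a
    rw [thr_eq_some, rankHist_eq_some hinj]
    refine exists_congr fun k => and_congr_right fun hk => ?_
    simp only [hk]

/-- An acyclic relation with finite prefixes on countably many events can be linearized. -/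
theorem exists_rank [Countable Tid] {E : Set (Event Tid Loc L)} (wf : WellFormed E)
    {R : Event Tid Loc L → Event Tid Loc L → Prop} (hE : ∀ a b, R a b → a ∈ E ∧ b ∈ E)
    (hac : Irrefl (Relation.TransGen R))
    (hfin : ∀ b, {a | Relation.ReflTransGen (NonInit R) a b}.Finite) :
    ∃ rank : Event Tid Loc L → ℕ,
      (∀ a ∈ E, ∀ b ∈ E, ¬ a.IsInit → ¬ b.IsInit → rank a = rank b → a = b) ∧
      ∀ a b, NonInit R a b → rank a < rank b := by
  classical
  obtain ⟨f, hf⟩ := exists_injective_nat Tid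
  let code : Event Tid Loc L → ℕ := fun e => match e with
    | .init _ => 0
    | .ev k τ _ => Nat.pair k (f τ)
  have hcode : ∀ a ∈ E, ∀ b ∈ E, ¬ a.IsInit → ¬ b.IsInit → code a = code b → a = b := by
    intro a ha b hb hai hbi hab
    rcases a with x | ⟨k, τ, l⟩
    · exact absurd trivial hai
    rcases b with x | ⟨k', τ', l'⟩
    · exact absurd trivial hbi
    obtain ⟨rfl, h2⟩ := Nat.pair_eq_pair.1 hab
    obtain rfl := hf h2
    rw [wf.unique _ _ _ _ ha hb]
  have hdown : ∀ a b, Relation.ReflTransGen (NonInit R) a b → b ∈ E → ¬ b.IsInit →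
      a ∈ E ∧ ¬ a.IsInit := by
    intro a b hab hb hbi
    rcases Relation.ReflTransGen.cases_head hab with rfl | ⟨c, hc, _⟩
    · exact ⟨hb, hbi⟩
    · exact ⟨(hE _ _ hc.1).1, hc.2.1⟩
  let D : Event Tid Loc L → Finset ℕ := fun e => (hfin e).toFinset.image code
  have hD : ∀ a ∈ E, ¬ a.IsInit → ∀ b ∈ E, ¬ b.IsInit → code a ∈ D b →
      Relation.ReflTransGen (NonInit R) a b := by
    intro a ha hai b hb hbi h
    obtain ⟨c, hc, hca⟩ := Finset.mem_image.1 h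
    rw [Set.Finite.mem_toFinset] at hc
    obtain ⟨hcE, hci⟩ := hdown _ _ hc hb hbi
    obtain rfl := hcode c hcE a ha hci hai hca
    exact hc
  have hself : ∀ a, code a ∈ D a := fun a =>
    Finset.mem_image_of_mem _ ((Set.Finite.mem_toFinset _).2 Relation.ReflTransGen.refl)
  -- The finite set of codes of the predecessors is read as a binary number. Equal numbers mean
  -- equal sets, so each event precedes the other, and by acyclicity they coincide; an edge strictly
  -- enlarges the set.
  refine ⟨fun e => ∑ i ∈ D e, 2 ^ i, ?_, ?_⟩
  · intro a ha b hb hai hbi hab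
    have hDab : D a = D b := Finset.geomSum_injective le_rfl hab
    have h1 := hD a ha hai b hb hbi (hDab ▸ hself a)
    have h2 := hD b hb hbi a ha hai (hDab ▸ hself b)
    rcases Relation.reflTransGen_iff_eq_or_transGen.1 h1 with h1 | h1
    · exact h1.symm
    · exact absurd (NonInit.transGen (h1.trans_left h2)) (hac a)
  · intro a b hab
    obtain ⟨haE, hbE⟩ := hE _ _ hab.1
    refine Finset.sum_lt_sum_of_subset (i := code b) ?_ (hself b) ?_ (by positivity) ?_
    · refine Finset.image_subset_image fun c hc => ?_
      rw [Set.Finite.mem_toFinset] at hc ⊢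
      exact Relation.ReflTransGen.tail hc hab
    · intro h
      have h2 := hD b hbE hab.2.2 a haE hab.2.1 h
      exact hac a (NonInit.transGen (Relation.TransGen.trans_left (.single hab) h2))
    · intros
      positivity

variable [MemLabel L Loc Val] [Zero Val]

open Classical in
/-- The memories reached along a history. -/
noncomputable def scState (h : ℕ → Option (Tid × L)) : ℕ → Loc → Val
  | 0 => fun _ => 0
  | n + 1 => match h n with
    | some σ => scApply σ.2 (scState h n)
    | none => scState h n

/-- A fair sequentially consistent graph is produced by a run of the interleaving memory. -/
theorem mem_behMF_MSC_of_graph [Finite Tid] {G : EGraph Tid L} (hG : G ∈ GSC Tid L) (hf : G.Fair)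
    (hE : eventsOf Loc β = G.E) : β ∈ (MSC Tid Loc Val L).BehMF := by
  classical
  let R : Event Tid Loc L → Event Tid Loc L → Prop :=
    fun a b => G.po a b ∨ G.rf a b ∨ G.mo a b ∨ G.fr a b
  have hRE : ∀ a b, R a b → a ∈ G.E ∧ b ∈ G.E := by
    rintro a b (h | h | h | ⟨⟨w, hw, hm⟩, _⟩)
    · exact ⟨h.1, h.2.1⟩
    · exact G.rf_mem _ _ h
    · exact G.mo_mem _ _ h
    · exact ⟨(G.rf_mem _ _ hw).2, (G.mo_mem _ _ hm).2⟩
  have hfin := finite_prefix_of_acyclic G.wf (R := R) hRE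
    (fun a ha b hb h => Or.inl ⟨ha, hb, h⟩) hG fun b _ =>
      (((po_prefix_finite G.wf b).union (G.rf_prefixFinite b)).union
        ((hf.1 b).union (hf.2 b))).subset fun a ha => by
          rcases ha.1 with h | h | h | h
          · exact Or.inl (Or.inl ⟨h.1, h.2.2, ha.2⟩)
          · exact Or.inl (Or.inr h)
          · exact Or.inr (Or.inl h)
          · exact Or.inr (Or.inr h)
  obtain ⟨rank, hinj, hmono⟩ := exists_rank G.wf hRE hG hfin
  -- Initialization is `po`-before every other event, so a `mo` edge into it from such an event
  -- would close a cycle.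
  have hnomo : ∀ w x, w ∈ G.E → ¬ G.mo w (.init x) := by
    intro w x hw h
    obtain ⟨_, _, y, hy, hy'⟩ := G.mo_type _ _ h
    cases hy'
    rcases w with z | ⟨k, τ, l⟩
    · cases hy
      exact G.mo_irrefl _ h
    · exact hG _ (Relation.TransGen.tail (.single (Or.inl ⟨G.wf.init_mem x, hw, trivial⟩))
        (Or.inr (Or.inr (Or.inl h))))
  rw [← hE] at hinj
  let h := rankHist β rank
  have hh : ∀ {n τ a}, h n = some (τ, a) ↔ ∃ k, (β τ).get? k = some a ∧ rank (.ev k τ a) = n :=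
    rankHist_eq_some hinj
  have hbeh : histBeh h = β := histBeh_rankHist hinj fun a ha b hb hai hbi hab =>
    hmono a b ⟨Or.inl ⟨hE ▸ ha, hE ▸ hb, hab⟩, hai, hbi⟩
  rw [hE] at hinj
  -- As `rank` respects `mo`, the last write executed on `x` is also the `mo`-latest one executed.
  have hinv : ∀ n x, ∃ w ∈ G.E, w.IsW ∧ w.loc = some x ∧ w.valW = some (scState h n x) ∧
      (w.IsInit ∨ rank w < n) ∧ ∀ w' ∈ G.E, w'.IsW → w'.loc = some x → ¬ w'.IsInit → rank w' < n →
        w' = w ∨ G.mo w' w := by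
    intro n
    induction n with
    | zero =>
      exact fun x => ⟨.init x, G.wf.init_mem x, Event.isW_init x, rfl, rfl, Or.inl trivial,
        fun w' _ _ _ _ hlt => absurd hlt (Nat.not_lt_zero _)⟩
    | succ n ih =>
      intro x
      obtain ⟨w, hw, hwW, hwx, hwv, hwn, hlast⟩ := ih x
      rcases hn : h n with _ | ⟨τ, a⟩
      · refine ⟨w, hw, hwW, hwx, by simpa only [scState, hn] using hwv,
          hwn.imp_right fun h => by omega, fun w' hw' hW' hx' hi' hlt => ?_⟩
        refine hlast w' hw' hW' hx' hi' (lt_of_le_of_ne (Nat.lt_succ_iff.1 hlt) ?_)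
        rintro rfl
        rcases w' with y | ⟨k, τ, a⟩
        · exact hi' trivial
        · rw [← hE, ev_mem_eventsOf] at hw'
          rw [hh.2 ⟨k, hw', rfl⟩] at hn
          cases hn
      · obtain ⟨k, hk, hrk⟩ := hh.1 hn
        have heE : Event.ev k τ a ∈ G.E := hE ▸ ev_mem_eventsOf.2 hk
        by_cases hex : (Event.ev k τ a : Event Tid Loc L).IsW ∧
            (Event.ev k τ a : Event Tid Loc L).loc = some x
        · obtain ⟨v, hv⟩ := Option.isSome_iff_exists.1 hex.1
          refine ⟨_, heE, hex.1, hex.2, ?_, Or.inr (by omega), fun w' hw' hW' hx' hi' hlt => ?_⟩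
          · simp only [scState, hn]
            rw [hv, scApply_of_isW _ hex.2 hv]
          · by_cases hne : w' = .ev k τ a
            · exact Or.inl hne
            rcases G.mo_total w' hw' _ heE hW' hex.1 ⟨x, hx', hex.2⟩ hne with hm | hm
            · exact Or.inr hm
            · have := hmono _ _ ⟨Or.inr (Or.inr (Or.inl hm)), id, hi'⟩
              omega
        · refine ⟨w, hw, hwW, hwx, ?_, hwn.imp_right fun h => by omega,
            fun w' hw' hW' hx' hi' hlt => ?_⟩
          · simp only [scState, hn]
            rw [hwv, scApply_of_not_isW _ hex]
          · refine hlast w' hw' hW' hx' hi' (lt_of_le_of_ne (Nat.lt_succ_iff.1 hlt) fun heq => ?_)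
            obtain rfl := hinj _ hw' _ heE hi' id (heq.trans hrk.symm)
            exact hex ⟨hW', hx'⟩
  have hrun : StutterRun (MSC Tid Loc Val L) (scState h) (fun n => (h n).map Sum.inl) := by
    refine ⟨rfl, ?_, ?_⟩
    · intro n σ hσ
      obtain ⟨⟨τ, a⟩, hn, rfl⟩ := Option.map_eq_some_iff.1 hσ
      obtain ⟨k, hk, hrk⟩ := hh.1 hn
      have heE : Event.ev k τ a ∈ G.E := hE ▸ ev_mem_eventsOf.2 hk
      refine (MSC_step_iff (k := k)).2 ⟨by simp only [scState, hn], fun x v hx hv => ?_⟩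
      obtain ⟨w, hw, hwW, hwx, hwv, hwn, hlast⟩ := hinv n x
      obtain ⟨w₀, hrf⟩ := G.rf_total _ heE (by rw [Event.IsR, hv]; rfl)
      obtain ⟨hw₀, -⟩ := G.rf_mem _ _ hrf
      obtain ⟨hw₀W, -⟩ := G.rf_type _ _ hrf
      have hw₀x : w₀.loc = some x := (G.rf_loc _ _ hrf).trans hx
      -- If the source `w₀` were not the current write `w`, it would be `mo`-before `w`, so the read
      -- would be `fr`-before `w`, although `w` has been executed already.
      have hww : w₀ = w := by
        by_contra hne
        have hm : G.mo w₀ w := by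
          by_cases hi : w₀.IsInit
          · refine (G.mo_total w₀ hw₀ w hw hw₀W hwW ⟨x, hw₀x, hwx⟩ hne).resolve_right ?_
            rcases w₀ with y | _
            · exact hnomo w y hw
            · exact hi.elim
          · refine (hlast w₀ hw₀ hw₀W hw₀x hi ?_).resolve_left hne
            have := hmono _ _ ⟨Or.inr (Or.inl hrf), hi, id⟩
            omega
        have hwi : ¬ w.IsInit := fun hi => by
          rcases w with y | _
          · exact hnomo w₀ y hw₀ hm
          · exact hi.elim
        have hlt := hwn.resolve_left hwi
        have := hmono _ _ ⟨Or.inr (Or.inr (Or.inr ⟨⟨w₀, hrf, hm⟩, fun he => by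
          rw [← he, hrk] at hlt
          exact lt_irrefl _ hlt⟩)), id, hwi⟩
        omega
      have := G.rf_val _ _ hrf
      rw [hww, hwv, hv] at this
      exact Option.some.inj this
    · intro n hn
      simp only [scState, Option.map_eq_none_iff.1 hn]
      rfl
  have := mem_behMF_of_isEmpty hrun
  have hobs : obs (T := Empty) (fun n => (h n).map Sum.inl) = h := by
    funext n
    simp only [obs]
    rcases h n with _ | σ <;> rfl
  rwa [hobs, hbeh] at this

end Linearize

/-! ### Graphs of sequentially consistent runs -/

section SCGraph

variable {Tid Loc Val L : Type*} [MemLabel L Loc Val] [Zero Val]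

theorem time_injOn {h : ℕ → Option (Tid × L)} {a b : Event Tid Loc L}
    (ha : a ∈ eventsOf Loc (histBeh h)) (hb : b ∈ eventsOf Loc (histBeh h)) (hl : a.SameLoc b)
    (hab : time h a = time h b) : a = b := by
  rcases mem_eventsOf_histBeh.1 ha with ⟨x, rfl⟩ | ⟨n, hn⟩ <;>
    rcases mem_eventsOf_histBeh.1 hb with ⟨y, rfl⟩ | ⟨m, hm⟩
  · obtain ⟨z, hz, hz'⟩ := hl
    cases hz
    cases hz'
    rfl
  · rw [time_init, hm.time_eq] at hab
    omega
  · rw [time_init, hn.time_eq] at hab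
    omega
  · rw [hn.time_eq, hm.time_eq] at hab
    cases hab
    exact hn.event_unique hm

theorem exists_occursAt_of_isR {h : ℕ → Option (Tid × L)} {r : Event Tid Loc L}
    (hr : r ∈ eventsOf Loc (histBeh h)) (hR : r.IsR) : ∃ n, OccursAt h n r := by
  rcases mem_eventsOf_histBeh.1 hr with ⟨x, rfl⟩ | hn
  · exact absurd hR (Event.not_isR_init x)
  · exact hn

/-- A run of the interleaving memory yields a fair sequentially consistent graph. -/
theorem exists_graph_of_mem_behMF_MSC {β : Behavior Tid L} (hβ : β ∈ (MSC Tid Loc Val L).BehMF) :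
    ∃ G ∈ GSC Tid L, G.Fair ∧ eventsOf Loc β = G.E := by
  obtain ⟨(q : ℕ → Loc → Val), l, hr, rfl, -⟩ := exists_stutterRun_of_mem_behMF hβ
  set h := obs l
  set E := eventsOf Loc (histBeh h) with hEdef
  have hstep : ∀ n τ a, h n = some (τ, a) → ∀ k, q (n + 1) = scApply a (q n) ∧
      ∀ x v, (Event.ev k τ a : Event Tid Loc L).loc = some x →
        (Event.ev k τ a : Event Tid Loc L).valR = some v → q n x = v :=
    fun n τ a hn k => MSC_step_iff.1 (hr.step n _ (obs_eq_some.1 hn))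
  -- Initialization has time `0` and the event issued at `n` has time `n + 1`, so `time h w ≤ n`
  -- means that `w` is in effect in the state `q n`.
  have hinv : ∀ n x, ∃ w ∈ E, w.IsW ∧ w.loc = some x ∧ w.valW = some (q n x) ∧ time h w ≤ n ∧
      ∀ w' ∈ E, w'.IsW → w'.loc = some x → time h w' ≤ n → time h w' ≤ time h w := by
    intro n
    induction n with
    | zero =>
      intro x
      refine ⟨.init x, init_mem_eventsOf _ x, Event.isW_init x, rfl, ?_, by simp, ?_⟩
      · rw [hr.init]
        rfl
      · intro w' _ _ _ hw'
        omega
    | succ n ih =>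
      intro x
      obtain ⟨w, hw, hwW, hwx, hwv, hwn, hlast⟩ := ih x
      have hnew : ∀ w' ∈ E, time h w' ≤ n + 1 → time h w' ≤ n ∨ OccursAt h n w' := by
        intro w' hw' hle
        rcases mem_eventsOf_histBeh.1 hw' with ⟨y, rfl⟩ | ⟨m, hm⟩
        · exact Or.inl (by simp)
        · have := hm.time_eq
          by_cases hmn : m = n
          · exact Or.inr (hmn ▸ hm)
          · exact Or.inl (by omega)
      rcases hn : h n with _ | ⟨τ, a⟩
      · have hln : l n = none := by
          rcases hl : l n with _ | (σ | e)
          · rfl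
          · rw [show h n = some σ from obs_eq_some.2 hl] at hn
            cases hn
          · exact e.elim
        refine ⟨w, hw, hwW, hwx, by rw [hwv, hr.idle n hln], by omega,
          fun w' hw' hW' hx' hle => ?_⟩
        rcases hnew w' hw' hle with h1 | ⟨τ, a, h1, -⟩
        · exact hlast w' hw' hW' hx' h1
        · rw [hn] at h1
          cases h1
      · set e : Event Tid Loc L := .ev (cnt (thr h τ) n) τ a with he
        have hocc : OccursAt h n e := ⟨τ, a, hn, rfl⟩
        obtain ⟨hq, -⟩ := hstep n τ a hn (cnt (thr h τ) n)
        by_cases hex : e.IsW ∧ e.loc = some x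
        · obtain ⟨v, hv⟩ := Option.isSome_iff_exists.1 hex.1
          refine ⟨e, hocc.mem, hex.1, hex.2, ?_, hocc.time_eq.le, fun w' _ _ _ hle => ?_⟩
          · rw [hv, hq, scApply_of_isW _ hex.2 hv]
          · rw [hocc.time_eq]
            exact hle
        · refine ⟨w, hw, hwW, hwx, ?_, by omega, fun w' hw' hW' hx' hle => ?_⟩
          · rw [hwv, hq, scApply_of_not_isW _ hex]
          · rcases hnew w' hw' hle with h1 | h1
            · exact hlast w' hw' hW' hx' h1
            · obtain rfl := h1.event_unique hocc
              exact absurd ⟨hW', hx'⟩ hex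
  have hsrc : ∀ r : Event Tid Loc L, ∃ w : Event Tid Loc L, r ∈ E → r.IsR →
      w ∈ E ∧ w.IsW ∧ w.loc = r.loc ∧ w.valW = r.valR ∧ time h w < time h r ∧
      ∀ w' ∈ E, w'.IsW → w'.loc = r.loc → time h w' < time h r → time h w' ≤ time h w := by
    intro r
    by_cases hrE : r ∈ E ∧ r.IsR
    · obtain ⟨hrE, hR⟩ := hrE
      obtain ⟨n, hn⟩ := exists_occursAt_of_isR hrE hR
      obtain ⟨x, hx⟩ := Event.exists_loc_of_isR hR
      obtain ⟨v, hv⟩ := Option.isSome_iff_exists.1 hR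
      obtain ⟨w, hw, hwW, hwx, hwv, hwn, hlast⟩ := hinv n x
      refine ⟨w, fun _ _ => ⟨hw, hwW, hwx.trans hx.symm, ?_, ?_, ?_⟩⟩
      · obtain ⟨τ, a, hna, rfl⟩ := hn
        rw [hwv, hv, (hstep n τ a hna _).2 x v hx hv]
      · rw [hn.time_eq]
        omega
      · intro w' hw' hW' hx' hlt
        rw [hn.time_eq] at hlt
        exact hlast w' hw' hW' (hx'.trans hx) (by omega)
    · exact ⟨r, fun h1 h2 => absurd ⟨h1, h2⟩ hrE⟩
  choose src hsrc using hsrc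
  have d : SourceData E src (time h) :=
    { wf := wellFormed_eventsOf _
      src_mem := fun r h1 h2 => (hsrc r h1 h2).1
      src_isW := fun r h1 h2 => (hsrc r h1 h2).2.1
      src_loc := fun r h1 h2 => (hsrc r h1 h2).2.2.1
      src_val := fun r h1 h2 => (hsrc r h1 h2).2.2.2.1
      ts_inj := fun a ha b hb _ _ hl => time_injOn ha hb hl }
  -- The source is the latest write before the read, so a `mo`-later write comes after the read, or
  -- is the read itself if that is an RMW; `fr` excludes the latter.
  have hfr : ∀ a b, d.graph.fr a b → time h a < time h b := by
    rintro a b ⟨⟨w, ⟨haE, haR, rfl⟩, hm⟩, hne⟩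
    obtain ⟨-, hbE, -, hbW, hl, hlt⟩ := hm
    by_contra hle
    obtain ⟨h1, h2, h3, h4, h5, h6⟩ := hsrc a haE haR
    have hloc : b.loc = a.loc := by
      obtain ⟨x, hx, hx'⟩ := hl
      rw [← h3, hx, hx']
    rcases Nat.lt_or_eq_of_le (not_lt.1 hle) with hlt' | heq
    · have := h6 b hbE hbW hloc hlt'
      omega
    · obtain ⟨x, hx⟩ := Event.exists_loc_of_isR haR
      exact hne (time_injOn haE hbE ⟨x, hx, hloc.trans hx⟩ heq.symm)
  refine ⟨d.graph, ?_, ⟨d.mo_prefixFinite, fun b => ?_⟩, rfl⟩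
  · refine irrefl_transGen_of_measure (time h) ?_
    rintro a b (h1 | h1 | h1 | h1)
    · exact time_lt_of_sb h1.1 h1.2.1 h1.2.2
    · obtain ⟨hbE, hbR, rfl⟩ := h1
      exact (hsrc b hbE hbR).2.2.2.2.1
    · exact h1.2.2.2.2.2
    · exact hfr a b h1
  · refine finite_of_time_le (h := h) (time h b) fun a ha => ?_
    have hlt := hfr a b ha
    obtain ⟨⟨w, ⟨haE, haR, -⟩, -⟩, -⟩ := ha
    obtain ⟨n, hn⟩ := exists_occursAt_of_isR haE haR
    rw [hn.time_eq] at hlt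
    exact ⟨n, by omega, hn⟩

end SCGraph

/-! ### Sequential consistency implies RC11 consistency -/

section GSCtoRC11

variable {Tid Loc Val : Type*} [Zero Val] {G : EGraph Tid (CLab Loc Val)}
  {a b : Event Tid Loc (CLab Loc Val)}

namespace EGraph

theorem hbSC_of_po (h : G.po a b) : G.hbSC a b := .single (Or.inl h)
theorem hbSC_of_rf (h : G.rf a b) : G.hbSC a b := .single (Or.inr (Or.inl h))
theorem hbSC_of_mo (h : G.mo a b) : G.hbSC a b := .single (Or.inr (Or.inr (Or.inl h)))
theorem hbSC_of_fr (h : G.fr a b) : G.hbSC a b := .single (Or.inr (Or.inr (Or.inr h)))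

theorem hbSC_of_eco (h : G.eco a b) : G.hbSC a b := transGen_mono h fun _ _ => Or.inr

theorem hbSC_of_rs (h : G.rs a b) : a = b ∨ G.hbSC a b := by
  obtain ⟨_, _, c, hac, _, _, hcb⟩ := h
  have hcb' : c = b ∨ G.hbSC c b := by
    rcases Relation.reflTransGen_iff_eq_or_transGen.1 hcb with h | h
    · exact Or.inl h.symm
    · exact Or.inr (transGen_mono h fun _ _ h => Or.inr (Or.inl h.1))
  rcases hac with rfl | hac
  · exact hcb'
  · rcases hcb' with rfl | hcb'
    · exact Or.inr (hbSC_of_po hac.1)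
    · exact Or.inr ((hbSC_of_po hac.1).trans hcb')

theorem hbSC_of_sw (h : G.sw a b) : G.hbSC a b := by
  obtain ⟨_, _, w, w', r, haw, hrs, hrf, _, hrb⟩ := h
  have h1 : G.hbSC w' b := by
    rcases hrb with rfl | hrb
    · exact hbSC_of_rf hrf
    · exact (hbSC_of_rf hrf).trans (hbSC_of_po hrb.1)
  have h2 : G.hbSC w b := by
    rcases hbSC_of_rs hrs with rfl | h
    · exact h1
    · exact h.trans h1
  rcases haw with rfl | haw
  · exact h2
  · exact (hbSC_of_po haw.2).trans h2

theorem hbSC_of_hbRC11 (h : G.hbRC11 a b) : G.hbSC a b := by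
  induction h with
  | single h => exact h.elim hbSC_of_po hbSC_of_sw
  | tail _ h ih => exact ih.trans (h.elim hbSC_of_po hbSC_of_sw)

theorem hbSC_of_scb (h : G.scb a b) : G.hbSC a b := by
  rcases h with h | ⟨c, d, h1, h2, h3⟩ | h | h | h
  · exact hbSC_of_po h
  · exact ((hbSC_of_po h1.1).trans (hbSC_of_hbRC11 h2)).trans (hbSC_of_po h3.1)
  · exact hbSC_of_hbRC11 h.1
  · exact hbSC_of_mo h
  · exact hbSC_of_fr h

theorem hbSC_of_pscBase (h : G.pscBase a b) : G.hbSC a b := by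
  obtain ⟨_, _, c, d, hac, hcd, hdb⟩ := h
  have h1 : G.hbSC c b := by
    rcases hdb with rfl | hdb
    · exact hbSC_of_scb hcd
    · exact (hbSC_of_scb hcd).trans (hbSC_of_hbRC11 hdb.1)
  rcases hac with rfl | hac
  · exact h1
  · exact (hbSC_of_hbRC11 hac.2).trans h1

theorem hbSC_of_pscF (h : G.pscF a b) : G.hbSC a b := by
  obtain ⟨_, _, _, _, h | ⟨c, d, h1, h2, h3⟩⟩ := h
  · exact hbSC_of_hbRC11 h
  · exact ((hbSC_of_hbRC11 h1).trans (hbSC_of_eco h2)).trans (hbSC_of_hbRC11 h3)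

end EGraph

/-- The relations of RC11 are built from `po`, `rf`, `mo` and `fr` by composition; modes and fences
only restrict them. A cycle of any of them is therefore a cycle of `hbSC`. -/
theorem GSC_subset_GRC11 : GSC Tid (CLab Loc Val) ⊆ GRC11 Tid Loc Val := by
  intro G hG
  refine ⟨fun a h => hG a (EGraph.hbSC_of_hbRC11 h),
    fun a b h h' => hG a ((EGraph.hbSC_of_hbRC11 h).trans (EGraph.hbSC_of_eco h')),
    fun a h => hG a (EGraph.hbSC_of_eco h), fun a h => hG a ?_,
    fun a h => hG a (transGen_mono h fun _ _ h => h.imp_right Or.inl)⟩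
  have key : ∀ b, Relation.TransGen (fun a b => G.pscBase a b ∨ G.pscF a b) a b → G.hbSC a b :=
    fun b h => by
      induction h with
      | single h => exact h.elim EGraph.hbSC_of_pscBase EGraph.hbSC_of_pscF
      | tail _ h ih => exact ih.trans (h.elim EGraph.hbSC_of_pscBase EGraph.hbSC_of_pscF)
  exact key a h

end GSCtoRC11

/-! ### Simulations -/

section Simulation

universe u v w w' x

variable {Tid : Type u} {L : Type v} {T : Type x}

/-- Steps at a time `k` inside a sequence of blocks of length `c + 1`. -/
theorem div_mod_succ_cases (c k : ℕ) :
    ((k + 1) / (c + 1) = k / (c + 1) ∧ (k + 1) % (c + 1) = k % (c + 1) + 1) ∨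
      ((k + 1) / (c + 1) = k / (c + 1) + 1 ∧ (k + 1) % (c + 1) = 0 ∧ k % (c + 1) = c) := by
  have hc : 0 < c + 1 := by omega
  have hlt := Nat.mod_lt k hc
  have hk := Nat.div_add_mod k (c + 1)
  rcases Nat.lt_or_ge (k % (c + 1) + 1) (c + 1) with h | h
  · exact Or.inl ((Nat.div_mod_unique hc).2 ⟨by omega, h⟩)
  · have := (Nat.div_mod_unique hc (a := k + 1) (c := 0) (d := k / (c + 1) + 1)).2
      ⟨by rw [Nat.mul_add]; omega, hc⟩
    exact Or.inr ⟨this.1, this.2, by omega⟩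

/-- If every step of `A` is simulated by a step of `B` followed by at most `c` silent steps, leading
to a state without enabled silent labels, then behaviors of `A` are memory-fair behaviors of `B`. -/
theorem mem_behMF_of_simulation {A : LTS.{max u v, 0, w} (Tid × L) Empty}
    {B : LTS.{max u v, x, w'} (Tid × L) T} (I : A.Q → B.Q → Prop) (c : ℕ) (hinit : I A.init B.init)
    (hquiet : ∀ s t, I s t → ∀ θ, ¬ B.Enabled (Sum.inr θ) t)
    (hstep : ∀ s t σ s', I s t → A.step s (Sum.inl σ) s' → ∃ (p : ℕ → B.Q) (m : ℕ → Option T),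
      B.step t (Sum.inl σ) (p 0) ∧ (∀ i < c, ∀ θ, m i = some θ → B.step (p i) (Sum.inr θ) (p (i + 1)))
        ∧ (∀ i < c, m i = none → p (i + 1) = p i) ∧ I s' (p c))
    {β : Behavior Tid L} (hβ : β ∈ A.BehMF) : β ∈ B.BehMF := by
  obtain ⟨q, l, hr, rfl, -⟩ := exists_stutterRun_of_mem_behMF hβ
  -- Every step of `A` becomes a block of exactly `c + 1` steps, padded by idling; an idle step
  -- becomes an idle block.
  have hblock : ∀ n (t : {t // I (q n) t}), ∃ (p : ℕ → B.Q) (m : ℕ → Option ((Tid × L) ⊕ T)),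
      p 0 = t.1 ∧ (∀ i ≤ c, ∀ σ, m i = some σ → B.step (p i) σ (p (i + 1))) ∧
      (∀ i ≤ c, m i = none → p (i + 1) = p i) ∧ I (q (n + 1)) (p (c + 1)) ∧
      (∀ σ, m 0 = some (Sum.inl σ) ↔ l n = some (Sum.inl σ)) ∧
      ∀ i σ, m (i + 1) ≠ some (Sum.inl σ) := by
    rintro n ⟨t, ht⟩
    rcases hl : l n with _ | (σ | e)
    · refine ⟨fun _ => t, fun _ => none, rfl, ?_, fun _ _ _ => rfl, ?_, ?_, ?_⟩
      · rintro i - σ ⟨⟩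
      · rw [hr.idle n hl]
        exact ht
      · simp
      · rintro i σ ⟨⟩
    · obtain ⟨p, m, h0, h1, h2, h3⟩ := hstep _ t σ _ ht (hr.step n _ hl)
      refine ⟨fun i => match i with
          | 0 => t
          | i + 1 => p i, fun i => match i with
          | 0 => some (Sum.inl σ)
          | i + 1 => (m i).map Sum.inr, rfl, ?_, ?_, h3, ?_, ?_⟩
      · rintro (_ | i) hi σ' hσ'
        · cases hσ'
          exact h0
        · obtain ⟨θ, hθ, rfl⟩ := Option.map_eq_some_iff.1 hσ'
          exact h1 i (by omega) θ hθ
      · rintro (_ | i) hi hn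
        · cases hn
        · exact h2 i (by omega) (Option.map_eq_none_iff.1 hn)
      · simp
      · intro i σ' hσ'
        obtain ⟨θ, _, h⟩ := Option.map_eq_some_iff.1 hσ'
        cases h
    · exact e.elim
  choose p m hp0 hps hpi hpI hm0 hms using hblock
  let t : ∀ n, {t // I (q n) t} := fun n =>
    Nat.rec ⟨B.init, by rw [hr.init]; exact hinit⟩ (fun n t => ⟨p n t (c + 1), hpI n t⟩) n
  have hc : 0 < c + 1 := Nat.succ_pos c
  let path : ℕ → ℕ → B.Q := fun n => p n (t n)
  let act : ℕ → ℕ → Option ((Tid × L) ⊕ T) := fun n => m n (t n)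
  have hpath0 : ∀ n, path n 0 = (t n).1 := fun n => hp0 n (t n)
  have hpath_succ : ∀ n, path (n + 1) 0 = path n (c + 1) := fun n => hpath0 (n + 1)
  let st : ℕ → B.Q := fun k => path (k / (c + 1)) (k % (c + 1))
  let lab : ℕ → Option ((Tid × L) ⊕ T) := fun k => act (k / (c + 1)) (k % (c + 1))
  have hst : ∀ k, st (k + 1) = path (k / (c + 1)) (k % (c + 1) + 1) := by
    intro k
    rcases div_mod_succ_cases c k with ⟨h1, h2⟩ | ⟨h1, h2, h3⟩
    · simp only [st, h1, h2]
    · simp only [st, h1, h2, h3, hpath_succ]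
  have hrun : StutterRun B st lab := by
    refine ⟨?_, ?_, ?_⟩
    · simp only [st, Nat.zero_div, Nat.zero_mod]
      exact hpath0 0
    · intro k σ hσ
      rw [hst]
      exact hps _ _ _ (Nat.lt_succ_iff.1 (Nat.mod_lt _ hc)) _ hσ
    · intro k hk
      rw [hst]
      exact hpi _ _ _ (Nat.lt_succ_iff.1 (Nat.mod_lt _ hc)) hk
  -- At the block boundary `(c + 1) * k ≥ k` no silent label is enabled, so none is continuously
  -- enabled.
  have hfair : StutterFair B st lab := by
    intro θ k hen
    refine absurd (hen ((c + 1) * k) (Nat.le_mul_of_pos_left k hc)) ?_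
    simp only [st, Nat.mul_div_cancel_left k hc, Nat.mul_mod_right]
    rw [hpath0]
    exact hquiet _ _ (t k).2 θ
  have hobs : histBeh (obs lab) = histBeh (obs l) := by
    funext τ
    refine compact_reindex (fun n => (c + 1) * n) ?_ ?_
    · intro i j _ _ _ _ hij
      exact Nat.mul_lt_mul_of_pos_left hij hc
    · intro k a
      rw [thr_eq_some, obs_eq_some]
      constructor
      · intro h
        have hk := Nat.div_add_mod k (c + 1)
        rcases hmod : k % (c + 1) with _ | i
        · simp only [lab, hmod] at h
          refine ⟨k / (c + 1), thr_eq_some.2 (obs_eq_some.2 ((hm0 _ _ _).1 h)), ?_⟩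
          omega
        · simp only [lab, hmod] at h
          exact absurd h (hms _ _ _ _)
      · rintro ⟨n, hn, rfl⟩
        simp only [lab, Nat.mul_div_cancel_left n hc, Nat.mul_mod_right]
        exact (hm0 _ _ _).2 (obs_eq_some.1 (thr_eq_some.1 hn))
  rw [← hobs]
  exact hrun.mem_behMF hfair

end Simulation

/-! ### Interleaving memory inside TSO and the timestamp-based memories -/

section SCSimulations

variable {Tid Loc Val : Type*} [Zero Val]

/-- Each write is propagated at once, so all buffers are empty between blocks and one silent step
per block suffices. -/
theorem behMF_MSC_subset_MTSO {β : Behavior Tid (ELab Loc Val)}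
    (hβ : β ∈ (MSC Tid Loc Val (ELab Loc Val)).BehMF) : β ∈ (MTSO Tid Loc Val).BehMF := by
  classical
  refine mem_behMF_of_simulation (A := MSC Tid Loc Val (ELab Loc Val)) (B := MTSO Tid Loc Val)
    (fun s t => t = (s, fun _ => [])) 1 rfl ?_ ?_ hβ
  · rintro s t rfl θ ⟨q', b, x, v, hb, -⟩
    simp at hb
  · rintro s t ⟨τ, a⟩ s' rfl hstep
    rcases a with ⟨x, v⟩ | ⟨x, v⟩ | ⟨x, v, v'⟩
    · obtain ⟨h1, rfl⟩ := hstep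
      exact ⟨fun _ => (s', fun _ => []), fun _ => none, ⟨h1, rfl⟩, by simp, fun _ _ _ => rfl, rfl⟩
    · obtain rfl : s' = Function.update s x v := hstep
      refine ⟨fun i => if i = 0 then (s, Function.update (fun _ => []) τ [(x, v)]) else
        (Function.update s x v, fun _ => []), fun _ => some τ, rfl, ?_, by simp, rfl⟩
      intro i hi θ hθ
      obtain rfl : i = 0 := by omega
      cases hθ
      refine ⟨[], x, v, by simp, ?_⟩
      simp
    · obtain ⟨h1, rfl⟩ := hstep
      exact ⟨fun _ => (Function.update s x v', fun _ => []), fun _ => none, ⟨rfl, h1, rfl⟩, by simp,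
        fun _ _ _ => rfl, rfl⟩

/-- The thread views agree with `V`, which is an upper bound of all messages, and the memory `s`
holds the newest messages. -/
def ViewSynced (s : Loc → Val) (t : ViewState Tid Loc Val) : Prop :=
  ∃ V : View Loc, (∀ τ, t.2 τ = V) ∧ (∀ m ∈ t.1, m.ts ≤ V m.loc ∧ m.view ≤ V) ∧
    ∀ x, ∃ m ∈ t.1, m.loc = x ∧ m.val = s x ∧ m.ts = V x

-- After the write the message is propagated to the other threads one by one, in the order of an
-- enumeration of `Tid`. Its timestamp is one above the common view, as an RMW demands.
open Classical in
theorem exists_write_block [Finite Tid] {upd : View Loc → Msg Loc Val → View Loc} {s : Loc → Val}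
    {t : ViewState Tid Loc Val} (ht : ViewSynced s t) (τ : Tid) (x : Loc) (v : Val) :
    ∃ (p : ℕ → ViewState Tid Loc Val) (m : ℕ → Option (Tid × Msg Loc Val)),
      viewWrite τ x v t (p 0) ∧ (p 0).2 τ x = t.2 τ x + 1 ∧
      (∀ i < Nat.card Tid, ∀ θ, m i = some θ → (viewMem upd).step (p i) (Sum.inr θ) (p (i + 1))) ∧
      (∀ i < Nat.card Tid, m i = none → p (i + 1) = p i) ∧
      ViewSynced (Function.update s x v) (p (Nat.card Tid)) := by
  obtain ⟨V, hV, hle, hmem⟩ := ht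
  let e := Finite.equivFin Tid
  set V' : View Loc := Function.update V x (V x + 1) with hV'
  have hVV' : V ≤ V' := by
    intro y
    by_cases hy : y = x
    · subst hy
      simp [hV']
    · simp [hV', hy]
  set M : Msg Loc Val := ⟨x, v, V x + 1, V'⟩ with hM
  -- After `i` turns the writer and the threads numbered below `i` know the message. The turn of the
  -- writer is idle, since propagation to it is not enabled.
  let p : ℕ → ViewState Tid Loc Val := fun i =>
    (t.1 ∪ {M}, fun τ' => if τ' = τ ∨ (e τ' : ℕ) < i then V' else V)
  let m : ℕ → Option (Tid × Msg Loc Val) := fun i =>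
    if h : i < Nat.card Tid then if e.symm ⟨i, h⟩ = τ then none else some (e.symm ⟨i, h⟩, M)
    else none
  have hp0 : (p 0).2 τ = V' := by simp [p]
  refine ⟨p, m, ⟨V x + 1, ?_, ?_, ?_, ?_⟩, ?_, ?_, ?_, V', ?_, ?_, ?_⟩
  · rintro ⟨m', hm', hloc, hts⟩
    have := (hle m' hm').1
    rw [hloc] at this
    omega
  · rw [hV]
    exact Nat.lt_succ_self _
  · funext τ'
    by_cases hτ : τ' = τ
    · subst hτ
      simp [p, hV, hV']
    · simp [p, hτ, hV]
  · rw [hp0]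
  · rw [hp0, hV]
    simp [hV']
  · intro i hi θ hθ
    simp only [m, dif_pos hi] at hθ
    split_ifs at hθ with hτ
    cases hθ
    refine ⟨Or.inr rfl, ?_, ?_⟩
    · simp [p, hτ, hM]
    · refine Prod.ext rfl ?_
      funext τ'
      by_cases hτ' : τ' = e.symm ⟨i, hi⟩
      · subst hτ'
        simp [p, hτ, hM, hV']
      · simp only [ne_eq, hτ', not_false_eq_true, Function.update_of_ne]
        have hne : (e τ' : ℕ) ≠ i := fun h => hτ' (by
          rw [Equiv.eq_symm_apply]
          exact Fin.ext h)
        simp only [p]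
        congr 1
        refine propext (or_congr_right ?_)
        omega
  · intro i hi hn
    simp only [m, dif_pos hi] at hn
    split_ifs at hn with hτ
    refine Prod.ext rfl ?_
    funext τ'
    simp only [p]
    congr 1
    refine propext ?_
    by_cases hτ' : τ' = τ
    · simp [hτ']
    · refine or_congr_right ?_
      have hne : (e τ' : ℕ) ≠ i := fun h => hτ' (by
        rw [← hτ, Equiv.eq_symm_apply]
        exact Fin.ext h)
      omega
  · intro τ'
    simp [p]
  · rintro m' (hm' | hm')
    · exact ⟨(hle m' hm').1.trans (hVV' _), (hle m' hm').2.trans hVV'⟩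
    · rw [Set.mem_singleton_iff] at hm'
      subst hm'
      exact ⟨by simp [hM, hV'], le_rfl⟩
  · intro y
    by_cases hy : y = x
    · subst hy
      exact ⟨M, Or.inr rfl, rfl, by simp [hM], by simp [hM, hV']⟩
    · obtain ⟨m', hm', h1, h2, h3⟩ := hmem y
      exact ⟨m', Or.inl hm', h1, by simp [hy, h2], by simp [hV', hy, h3]⟩

/-- In a synchronized state, reading the newest message leaves the view unchanged by `hupd`, and no
message is above any view, so no propagation is enabled. -/
theorem behMF_MSC_subset_viewMem [Finite Tid] {upd : View Loc → Msg Loc Val → View Loc}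
    (hupd : ∀ V m, m.ts = V m.loc → m.view ≤ V → upd V m = V) {β : Behavior Tid (ELab Loc Val)}
    (hβ : β ∈ (MSC Tid Loc Val (ELab Loc Val)).BehMF) :
    β ∈ (viewMem upd : LTS (Tid × ELab Loc Val) _).BehMF := by
  classical
  refine mem_behMF_of_simulation (A := MSC Tid Loc Val (ELab Loc Val)) (B := viewMem upd)
    ViewSynced (Nat.card Tid) ?_ ?_ ?_ hβ
  · refine ⟨fun _ => 0, fun _ => rfl, ?_, fun x => ⟨_, ⟨x, rfl⟩, rfl, rfl, rfl⟩⟩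
    rintro m ⟨x, rfl⟩
    exact ⟨le_rfl, le_rfl⟩
  · rintro s t ⟨V, hV, hle, -⟩ ⟨τ, m⟩ ⟨q', hm, hlt, -⟩
    rw [hV] at hlt
    exact absurd (hle m hm).1 (not_le.2 hlt)
  · rintro s t ⟨τ, a⟩ s' ht hstep
    have hread : ∀ x, viewRead upd τ x (s x) t t := by
      intro x
      obtain ⟨V, hV, hle, hmem⟩ := ht
      obtain ⟨m, hm, rfl, h2, h3⟩ := hmem x
      refine ⟨m, hm, rfl, h2, by rw [hV, h3], Prod.ext rfl ?_⟩
      rw [hV, hupd V m h3 (hle m hm).2, Function.update_eq_self_iff.2 (hV τ).symm]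
    rcases a with ⟨x, v⟩ | ⟨x, v⟩ | ⟨x, v, v'⟩
    · obtain ⟨rfl, rfl⟩ := hstep
      exact ⟨fun _ => t, fun _ => none, hread x, by simp, fun _ _ _ => rfl, ht⟩
    · obtain rfl : s' = Function.update s x v := hstep
      obtain ⟨p, m, h0, -, h1, h2, h3⟩ := exists_write_block (upd := upd) ht τ x v
      exact ⟨p, m, h0, h1, h2, h3⟩
    · obtain ⟨rfl, rfl⟩ := hstep
      obtain ⟨p, m, h0, h4, h1, h2, h3⟩ := exists_write_block (upd := upd) ht τ x v'
      exact ⟨p, m, ⟨t, hread x, h0, h4⟩, h1, h2, h3⟩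

theorem behMF_MSC_subset_MRA [Finite Tid] {β : Behavior Tid (ELab Loc Val)}
    (hβ : β ∈ (MSC Tid Loc Val (ELab Loc Val)).BehMF) : β ∈ (MRA Tid Loc Val).BehMF :=
  behMF_MSC_subset_viewMem (fun _ _ _ h => sup_eq_left.2 h) hβ

theorem behMF_MSC_subset_MStrongCOH [Finite Tid] {β : Behavior Tid (ELab Loc Val)}
    (hβ : β ∈ (MSC Tid Loc Val (ELab Loc Val)).BehMF) : β ∈ (MStrongCOH Tid Loc Val).BehMF :=
  behMF_MSC_subset_viewMem (fun V m h _ => by simp [h]) hβ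

end SCSimulations

/-! ### Graphs of runs of the timestamp-based memory systems -/

section ViewSteps

variable {Tid Loc Val : Type*} {upd : View Loc → Msg Loc Val → View Loc}

/-- The requirements on the update of a view by a read. -/
structure GoodUpdate (upd : View Loc → Msg Loc Val → View Loc) : Prop where
  le : ∀ V m, V m.loc ≤ m.ts → V ≤ upd V m
  at_loc : ∀ V m, m.view m.loc = m.ts → V m.loc ≤ m.ts → upd V m m.loc = m.ts

theorem goodUpdate_sup : GoodUpdate (fun (V : View Loc) (m : Msg Loc Val) => V ⊔ m.view) where
  le _ _ _ := le_sup_left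
  at_loc V m h h' := by
    rw [Pi.sup_apply, h]
    exact sup_eq_right.2 h'

open Classical in
theorem goodUpdate_update :
    GoodUpdate (fun (V : View Loc) (m : Msg Loc Val) => Function.update V m.loc m.ts) where
  le V m h x := by
    by_cases hx : x = m.loc
    · subst hx
      simpa using h
    · simp [hx]
  at_loc V m _ _ := by simp

/-- What a write of `v` to `x` by `τ` does to the state. -/
structure WriteFacts (τ : Tid) (x : Loc) (v : Val) (q q' : ViewState Tid Loc Val) : Prop where
  sub : q.1 ⊆ q'.1
  mono : ∀ τ', q.2 τ' ≤ q'.2 τ'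
  new : ∀ m ∈ q'.1, m ∈ q.1 ∨ m = ⟨x, v, q'.2 τ x, q'.2 τ⟩
  mem : ⟨x, v, q'.2 τ x, q'.2 τ⟩ ∈ q'.1
  fresh : ∀ m ∈ q.1, m.loc = x → m.ts ≠ q'.2 τ x

theorem viewWrite.facts {τ : Tid} {x : Loc} {v : Val} {q q' : ViewState Tid Loc Val}
    (h : viewWrite τ x v q q') : WriteFacts τ x v q q' := by
  classical
  obtain ⟨t, hfresh, hlt, h2, h1⟩ := h
  have ht : q'.2 τ x = t := by rw [h2]; simp
  refine ⟨?_, ?_, ?_, ?_, ?_⟩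
  · rw [h1]
    exact Set.subset_union_left
  · intro τ'
    by_cases hτ : τ' = τ
    · subst hτ
      intro y
      by_cases hy : y = x
      · subst hy
        rw [ht]
        exact hlt.le
      · rw [h2]
        simp [hy]
    · rw [h2]
      simp [hτ]
  · intro m hm
    rw [h1] at hm
    rw [ht]
    exact hm
  · rw [h1, ht]
    exact Or.inr rfl
  · intro m hm hx hts
    exact hfresh ⟨m, hm, hx, hts.trans ht⟩

theorem viewRead.facts (hu : GoodUpdate upd) {τ : Tid} {x : Loc} {v : Val}
    {q q' : ViewState Tid Loc Val} (h : viewRead upd τ x v q q')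
    (hc : ∀ m ∈ q.1, m.view m.loc = m.ts) :
    q'.1 = q.1 ∧ (∀ τ', q.2 τ' ≤ q'.2 τ') ∧ ∃ m ∈ q.1, m.loc = x ∧ m.val = v ∧ q'.2 τ x = m.ts ∧
      upd (q.2 τ) m ≤ q'.2 τ := by
  classical
  obtain ⟨m, hm, rfl, rfl, hle, rfl⟩ := h
  refine ⟨rfl, fun τ' => ?_, m, hm, rfl, rfl, ?_, ?_⟩
  · by_cases hτ : τ' = τ
    · subst hτ
      simpa using hu.le _ _ hle
    · simp [hτ]
  · simpa using hu.at_loc _ _ (hc m hm) hle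
  · simp

/-- What a step does to the state. -/
structure StepFacts (upd : View Loc → Msg Loc Val → View Loc) (q : ViewState Tid Loc Val)
    (σ : (Tid × ELab Loc Val) ⊕ (Tid × Msg Loc Val)) (q' : ViewState Tid Loc Val) : Prop where
  sub : q.1 ⊆ q'.1
  mono : ∀ τ', q.2 τ' ≤ q'.2 τ'
  new : ∀ m ∈ q'.1, m ∈ q.1 ∨ ∃ τ a v, σ = Sum.inl (τ, a) ∧ a.valW = some v ∧
    m = ⟨a.loc, v, q'.2 τ a.loc, q'.2 τ⟩
  mem : ∀ τ a v, σ = Sum.inl (τ, a) → a.valW = some v → ⟨a.loc, v, q'.2 τ a.loc, q'.2 τ⟩ ∈ q'.1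
  fresh : ∀ τ a v, σ = Sum.inl (τ, a) → a.valW = some v → ∀ m ∈ q.1, m.loc = a.loc →
    m.ts ≠ q'.2 τ a.loc
  read : ∀ τ a v, σ = Sum.inl (τ, a) → a.valR = some v → ∃ m ∈ q.1, m.loc = a.loc ∧ m.val = v ∧
    (q'.2 τ a.loc = m.ts ∨ (a.valW.isSome ∧ q'.2 τ a.loc = m.ts + 1)) ∧ upd (q.2 τ) m ≤ q'.2 τ

variable [Zero Val]

/-- By `hc` the view of a message contains its own timestamp, so after a read the thread stands
exactly at the timestamp read, also when views are joined. -/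
theorem viewMem_step_facts (hu : GoodUpdate upd) {q q' : ViewState Tid Loc Val}
    {σ : (Tid × ELab Loc Val) ⊕ (Tid × Msg Loc Val)} (h : (viewMem upd).step q σ q')
    (hc : ∀ m ∈ q.1, m.view m.loc = m.ts) : StepFacts upd q σ q' := by
  classical
  rcases σ with ⟨τ, a⟩ | ⟨τ, m⟩
  · rcases a with ⟨x, v⟩ | ⟨x, v⟩ | ⟨x, v, v'⟩
    · obtain ⟨h1, h2, h3⟩ := viewRead.facts hu h hc
      refine ⟨h1.ge, h2, fun m hm => Or.inl (h1 ▸ hm), ?_, ?_, ?_⟩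
      · rintro _ _ _ ⟨⟩ ⟨⟩
      · rintro _ _ _ ⟨⟩ ⟨⟩
      · rintro _ _ _ ⟨⟩ ⟨⟩
        obtain ⟨m, hm, h4, h5, h6, h7⟩ := h3
        exact ⟨m, hm, h4, h5, Or.inl h6, h7⟩
    · have hw := viewWrite.facts h
      refine ⟨hw.sub, hw.mono, fun m hm => (hw.new m hm).imp_right fun h => ⟨τ, _, v, rfl, rfl, h⟩,
        ?_, ?_, ?_⟩
      · rintro _ _ _ ⟨⟩ ⟨⟩
        exact hw.mem
      · rintro _ _ _ ⟨⟩ ⟨⟩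
        exact hw.fresh
      · rintro _ _ _ ⟨⟩ ⟨⟩
    · obtain ⟨q₁, hr, hw, hts⟩ := h
      obtain ⟨h1, h2, m, hm, h4, h5, h6, h7⟩ := viewRead.facts hu hr hc
      have hw := viewWrite.facts hw
      rw [h6] at hts
      refine ⟨h1.ge.trans hw.sub, fun τ' => (h2 τ').trans (hw.mono τ'),
        fun m hm => (hw.new m hm).imp (fun h => h1 ▸ h) fun h => ⟨τ, _, v', rfl, rfl, h⟩,
        ?_, ?_, ?_⟩
      · rintro _ _ _ ⟨⟩ ⟨⟩
        exact hw.mem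
      · rintro _ _ _ ⟨⟩ ⟨⟩
        exact fun m hm => hw.fresh m (h1 ▸ hm)
      · rintro _ _ _ ⟨⟩ ⟨⟩
        exact ⟨m, hm, h4, h5, Or.inr ⟨rfl, hts⟩, h7.trans (hw.mono τ)⟩
  · obtain ⟨hm, hlt, rfl⟩ := h
    refine ⟨le_rfl, fun τ' => ?_, fun m hm => Or.inl hm, ?_, ?_, ?_⟩
    · by_cases hτ : τ' = τ
      · subst hτ
        intro y
        by_cases hy : y = m.loc
        · subst hy
          simpa using hlt.le
        · simp [hy]
      · simp [hτ]
    · rintro _ _ _ ⟨⟩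
    · rintro _ _ _ ⟨⟩
    · rintro _ _ _ ⟨⟩

end ViewSteps

/-! ### Events, timestamps and views along a run -/

section ViewGraph

variable {Tid Loc Val : Type*} [Zero Val] {upd : View Loc → Msg Loc Val → View Loc}

theorem loc_ev_ELab {k : ℕ} {τ : Tid} {a : ELab Loc Val} :
    (Event.ev k τ a : Event Tid Loc (ELab Loc Val)).loc = some a.loc := rfl
theorem valW_ev_ELab {k : ℕ} {τ : Tid} {a : ELab Loc Val} :
    (Event.ev k τ a : Event Tid Loc (ELab Loc Val)).valW = a.valW := rfl

/-- The view of the thread of an event right after the event. -/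
noncomputable def viewAfter (q : ℕ → ViewState Tid Loc Val) (h : ℕ → Option (Tid × ELab Loc Val))
    (e : Event Tid Loc (ELab Loc Val)) : View Loc :=
  match e with
  | .init _ => fun _ => 0
  | .ev k τ a => (q (time h (.ev k τ a : Event Tid Loc (ELab Loc Val)))).2 τ

/-- The timestamp written by a write, or read by a read. -/
noncomputable def stamp (q : ℕ → ViewState Tid Loc Val) (h : ℕ → Option (Tid × ELab Loc Val))
    (e : Event Tid Loc (ELab Loc Val)) : ℕ :=
  match e with
  | .init _ => 0
  | .ev k τ a => viewAfter q h (.ev k τ a) a.loc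

theorem viewAfter_loc (q : ℕ → ViewState Tid Loc Val) (h : ℕ → Option (Tid × ELab Loc Val))
    {e : Event Tid Loc (ELab Loc Val)} {x : Loc} (hx : e.loc = some x) :
    viewAfter q h e x = stamp q h e := by
  rcases e with y | ⟨k, τ, a⟩
  · rfl
  · cases hx
    rfl

omit [Zero Val] in
theorem viewAfter_ev {q : ℕ → ViewState Tid Loc Val} {h : ℕ → Option (Tid × ELab Loc Val)}
    {n : ℕ} {τ : Tid} {a : ELab Loc Val} (hn : h n = some (τ, a)) :
    viewAfter q h (.ev (cnt (thr h τ) n) τ a) = (q (n + 1)).2 τ := by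
  simp only [viewAfter]
  rw [OccursAt.time_eq ⟨τ, a, hn, rfl⟩]

omit [Zero Val] in
theorem stamp_ev {q : ℕ → ViewState Tid Loc Val} {h : ℕ → Option (Tid × ELab Loc Val)}
    {n : ℕ} {τ : Tid} {a : ELab Loc Val} (hn : h n = some (τ, a)) :
    stamp q h (.ev (cnt (thr h τ) n) τ a) = (q (n + 1)).2 τ a.loc := by
  simp only [stamp]
  rw [viewAfter_ev hn]

section Run

variable {q : ℕ → ViewState Tid Loc Val}
  {l : ℕ → Option ((Tid × ELab Loc Val) ⊕ (Tid × Msg Loc Val))}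

theorem ViewRun.msg_view (hu : GoodUpdate upd) (hr : StutterRun (viewMem upd) q l) (n : ℕ) :
    ∀ m ∈ (q n).1, m.view m.loc = m.ts := by
  induction n with
  | zero =>
    rw [hr.init]
    rintro m ⟨x, rfl⟩
    rfl
  | succ n ih =>
    rcases hl : l n with _ | σ
    · rw [hr.idle n hl]
      exact ih
    · intro m hm
      rcases (viewMem_step_facts hu (hr.step n σ hl) ih).new m hm with h | ⟨τ, a, v, -, -, rfl⟩
      · exact ih m h
      · rfl

theorem ViewRun.facts (hu : GoodUpdate upd) (hr : StutterRun (viewMem upd) q l) {n : ℕ}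
    {σ : (Tid × ELab Loc Val) ⊕ (Tid × Msg Loc Val)} (hl : l n = some σ) :
    StepFacts upd (q n) σ (q (n + 1)) :=
  viewMem_step_facts hu (hr.step n σ hl) (ViewRun.msg_view hu hr n)

theorem ViewRun.mono (hu : GoodUpdate upd) (hr : StutterRun (viewMem upd) q l) {i j : ℕ}
    (hij : i ≤ j) : (q i).1 ⊆ (q j).1 ∧ ∀ τ, (q i).2 τ ≤ (q j).2 τ := by
  induction j, hij using Nat.le_induction with
  | base => exact ⟨le_rfl, fun _ => le_rfl⟩
  | succ j _ ih =>
    rcases hl : l j with _ | σ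
    · rw [hr.idle j hl]
      exact ih
    · have hf := ViewRun.facts hu hr hl
      exact ⟨ih.1.trans hf.sub, fun τ => (ih.2 τ).trans (hf.mono τ)⟩

/-- A message is either initial or created by a write step. The corresponding event will be the
source of the reads of this message. -/
theorem ViewRun.exists_event (hu : GoodUpdate upd) (hr : StutterRun (viewMem upd) q l) (n : ℕ) :
    ∀ m ∈ (q n).1, ∃ w ∈ eventsOf Loc (histBeh (obs l)), w.IsW ∧ w.loc = some m.loc ∧
      w.valW = some m.val ∧ stamp q (obs l) w = m.ts ∧ viewAfter q (obs l) w = m.view ∧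
      time (obs l) w ≤ n := by
  induction n with
  | zero =>
    rw [hr.init]
    rintro m ⟨x, rfl⟩
    exact ⟨.init x, init_mem_eventsOf _ x, Event.isW_init x, rfl, rfl, rfl, rfl, by simp⟩
  | succ n ih =>
    have hold : ∀ m ∈ (q n).1, ∃ w ∈ eventsOf Loc (histBeh (obs l)), w.IsW ∧ w.loc = some m.loc ∧
      w.valW = some m.val ∧ stamp q (obs l) w = m.ts ∧ viewAfter q (obs l) w = m.view ∧
      time (obs l) w ≤ n + 1 := fun m hm => by
        obtain ⟨w, h1, h2, h3, h4, h5, h6, h7⟩ := ih m hm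
        exact ⟨w, h1, h2, h3, h4, h5, h6, by omega⟩
    rcases hl : l n with _ | σ
    · rw [hr.idle n hl]
      exact hold
    · intro m hm
      rcases (ViewRun.facts hu hr hl).new m hm with h | ⟨τ, a, v, rfl, hv, rfl⟩
      · exact hold m h
      · have hn := obs_eq_some.2 hl
        have hocc : OccursAt (Loc := Loc) (obs l) n (.ev (cnt (thr (obs l) τ) n) τ a) :=
          ⟨τ, a, hn, rfl⟩
        refine ⟨_, hocc.mem, ?_, rfl, hv, stamp_ev hn, viewAfter_ev hn, hocc.time_eq.le⟩
        rw [Event.IsW, valW_ev_ELab, hv]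
        rfl

theorem ViewRun.exists_msg (hu : GoodUpdate upd) (hr : StutterRun (viewMem upd) q l)
    {w : Event Tid Loc (ELab Loc Val)} (hw : w ∈ eventsOf Loc (histBeh (obs l))) (hW : w.IsW)
    {n : ℕ} (hn : time (obs l) w ≤ n) :
    ∃ m ∈ (q n).1, w.loc = some m.loc ∧ m.ts = stamp q (obs l) w := by
  rcases mem_eventsOf_histBeh.1 hw with ⟨x, rfl⟩ | ⟨i, hi⟩
  · refine ⟨⟨x, 0, 0, fun _ => 0⟩, (ViewRun.mono hu hr (Nat.zero_le n)).1 ?_, rfl, rfl⟩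
    rw [hr.init]
    exact ⟨x, rfl⟩
  · rw [hi.time_eq] at hn
    obtain ⟨τ, a, hi, rfl⟩ := hi
    obtain ⟨v, hv⟩ := Option.isSome_iff_exists.1 hW
    exact ⟨_, (ViewRun.mono hu hr hn).1 ((ViewRun.facts hu hr (obs_eq_some.1 hi)).mem τ a v rfl hv),
      rfl, (stamp_ev hi).symm⟩

/-- The message of the earlier write is in the memory when the later write picks a fresh timestamp.
-/
theorem ViewRun.stamp_ne (hu : GoodUpdate upd) (hr : StutterRun (viewMem upd) q l)
    {a b : Event Tid Loc (ELab Loc Val)} (ha : a ∈ eventsOf Loc (histBeh (obs l)))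
    (hb : b ∈ eventsOf Loc (histBeh (obs l))) (haW : a.IsW) (hbW : b.IsW) (hl : a.SameLoc b)
    (hlt : time (obs l) a < time (obs l) b) : stamp q (obs l) a ≠ stamp q (obs l) b := by
  rcases mem_eventsOf_histBeh.1 hb with ⟨x, rfl⟩ | ⟨n, hn⟩
  · rw [time_init] at hlt
    omega
  · rw [hn.time_eq] at hlt
    obtain ⟨m, hm, hx, hts⟩ := ViewRun.exists_msg hu hr ha haW (Nat.lt_succ_iff.1 hlt)
    obtain ⟨τ, c, hn, rfl⟩ := hn
    obtain ⟨v, hv⟩ := Option.isSome_iff_exists.1 hbW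
    rw [← hts, stamp_ev hn]
    refine (ViewRun.facts hu hr (obs_eq_some.1 hn)).fresh τ c v rfl hv m hm ?_
    obtain ⟨y, hy, hby⟩ := hl
    rw [hx] at hy
    rw [loc_ev_ELab, ← hy] at hby
    exact (Option.some.inj hby).symm

/-- A thread eventually observes every write, if the run is fair. -/
theorem ViewRun.eventually_view_ge (hu : GoodUpdate upd) (hr : StutterRun (viewMem upd) q l)
    (hf : StutterFair (viewMem upd) q l) {m : Msg Loc Val} {j : ℕ} (hm : m ∈ (q j).1) (τ : Tid) :
    ∃ N, ∀ n ≥ N, m.ts ≤ (q n).2 τ m.loc := by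
  classical
  by_contra hne
  push Not at hne
  have hlt : ∀ n, (q n).2 τ m.loc < m.ts := fun n => by
    obtain ⟨n', hn', hlt⟩ := hne n
    exact ((ViewRun.mono hu hr hn').2 τ m.loc).trans_lt hlt
  -- If the view of `τ` stayed below `m`, the propagation of `m` to `τ` would stay enabled and be
  -- taken, which raises the view.
  obtain ⟨i, hi, hli⟩ := hf (τ, m) j fun i hi =>
    ⟨_, (ViewRun.mono hu hr hi).1 hm, hlt i, rfl⟩
  obtain ⟨-, -, hq⟩ := hr.step i _ hli
  have := hlt (i + 1)
  rw [hq] at this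
  simp at this

end Run

/-- The graph of a memory-fair run of a timestamp-based memory system. -/
theorem exists_graph_of_mem_behMF_viewMem [Finite Tid] (hu : GoodUpdate upd)
    {β : Behavior Tid (ELab Loc Val)}
    (hβ : β ∈ (viewMem upd : LTS (Tid × ELab Loc Val) _).BehMF) :
    ∃ (G : EGraph Tid (ELab Loc Val)) (tm ts : Event Tid Loc (ELab Loc Val) → ℕ)
      (V : Event Tid Loc (ELab Loc Val) → View Loc), G.Fair ∧ eventsOf Loc β = G.E ∧
      (∀ a b, G.po a b → tm a < tm b) ∧ (∀ a b, G.rf a b → tm a < tm b) ∧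
      (∀ a b, G.po a b → V a ≤ V b) ∧ (∀ a x, a.loc = some x → V a x = ts a) ∧
      (∀ a b, G.rf a b → ts a ≤ ts b) ∧ (∀ a b, G.mo a b → ts a < ts b) ∧
      (∀ a b, G.fr a b → ts a < ts b) ∧
      ∀ a b, G.rf a b → ∃ V₀ m, m.view = V a ∧ upd V₀ m ≤ V b := by
  obtain ⟨(q : ℕ → ViewState Tid Loc Val), l, hr, rfl, hfair⟩ := exists_stutterRun_of_mem_behMF hβ
  set h := obs l with hh
  set E := eventsOf Loc (histBeh h) with hEdef
  have hsrc : ∀ r : Event Tid Loc (ELab Loc Val), ∃ w : Event Tid Loc (ELab Loc Val),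
      r ∈ E → r.IsR → w ∈ E ∧ w.IsW ∧ w.loc = r.loc ∧ w.valW = r.valR ∧ time h w < time h r ∧
      (stamp q h r = stamp q h w ∨ (r.IsW ∧ stamp q h r = stamp q h w + 1)) ∧
      ∃ V₀ m, m.view = viewAfter q h w ∧ upd V₀ m ≤ viewAfter q h r := by
    intro r
    by_cases hrE : r ∈ E ∧ r.IsR
    · obtain ⟨hrE, hR⟩ := hrE
      obtain ⟨n, τ, a, hn, rfl⟩ := exists_occursAt_of_isR hrE hR
      obtain ⟨v, hv⟩ := Option.isSome_iff_exists.1 hR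
      obtain ⟨m, hm, hloc, hval, hts, hle⟩ :=
        (ViewRun.facts hu hr (obs_eq_some.1 hn)).read τ a v rfl hv
      obtain ⟨w, h1, h2, h3, h4, h5, h6, h7⟩ := ViewRun.exists_event hu hr n m hm
      refine ⟨w, fun _ _ => ⟨h1, h2, ?_, ?_, ?_, ?_, (q n).2 τ, m, h6.symm, ?_⟩⟩
      · rw [h3, hloc]
        rfl
      · rw [h4, hval, hv]
      · rw [OccursAt.time_eq ⟨τ, a, hn, rfl⟩]
        exact Nat.lt_succ_of_le h7
      · rw [stamp_ev hn, h5]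
        exact hts
      · rw [viewAfter_ev hn]
        exact hle
    · exact ⟨r, fun h1 h2 => absurd ⟨h1, h2⟩ hrE⟩
  choose src hsrc using hsrc
  have d : SourceData E src (stamp q h) :=
    { wf := wellFormed_eventsOf _
      src_mem := fun r h1 h2 => (hsrc r h1 h2).1
      src_isW := fun r h1 h2 => (hsrc r h1 h2).2.1
      src_loc := fun r h1 h2 => (hsrc r h1 h2).2.2.1
      src_val := fun r h1 h2 => (hsrc r h1 h2).2.2.2.1
      ts_inj := fun a ha b hb haW hbW hl hts => by
        rcases lt_trichotomy (time h a) (time h b) with hlt | heq | hlt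
        · exact absurd hts (ViewRun.stamp_ne hu hr ha hb haW hbW hl hlt)
        · exact time_injOn ha hb hl heq
        · refine absurd hts.symm (ViewRun.stamp_ne hu hr hb ha hbW haW ?_ hlt)
          obtain ⟨x, hx, hx'⟩ := hl
          exact ⟨x, hx', hx⟩ }
  -- A pure read has the stamp of its source. An RMW has the next stamp, so a different `mo`-later
  -- write cannot fit in between.
  have hfr : ∀ a b, d.graph.fr a b → stamp q h a < stamp q h b := by
    intro a b hab
    have hl := EGraph.sameLoc_of_fr hab
    obtain ⟨⟨w, ⟨haE, haR, rfl⟩, hm⟩, hne⟩ := hab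
    obtain ⟨-, hbE, -, hbW, -, hlt⟩ := hm
    rcases (hsrc a haE haR).2.2.2.2.2.1 with heq | ⟨haW, heq⟩
    · omega
    · refine lt_of_le_of_ne (by omega) fun he => hne ?_
      exact d.ts_inj a haE b hbE haW hbW hl he
  refine ⟨d.graph, time h, stamp q h, viewAfter q h, ⟨d.mo_prefixFinite, fun b => ?_⟩, rfl,
    fun a b hab => time_lt_of_sb hab.1 hab.2.1 hab.2.2, ?_, ?_, fun a x hx => viewAfter_loc q h hx,
    ?_, fun a b hab => hab.2.2.2.2.2, hfr, ?_⟩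
  · by_cases hbE : b ∈ E ∧ b.IsW
    swap
    · refine Set.finite_empty.subset fun a ha => ?_
      obtain ⟨⟨w, -, hm⟩, -⟩ := ha
      exact hbE ⟨hm.2.1, hm.2.2.2.1⟩
    obtain ⟨hbE, hbW⟩ := hbE
    -- In a fair run every thread eventually has a view at least the stamp of `b`, and by finiteness
    -- of `Tid` there is a common time after which no read is `fr`-before `b`. A run that stops
    -- needs no fairness.
    have hbound : ∃ N, ∀ a, d.graph.fr a b → ∀ n, OccursAt h n a → n ≤ N := by
      rcases hfair with ⟨N, hN⟩ | hfair
      · refine ⟨N, fun a _ n hn => ?_⟩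
        by_contra hlt
        obtain ⟨τ, c, hn, -⟩ := hn
        have := obs_eq_some.1 hn
        rw [hN n (by omega)] at this
        cases this
      · obtain ⟨m, hm, hbx, hts⟩ := ViewRun.exists_msg hu hr hbE hbW le_rfl
        choose N hN using fun τ => ViewRun.eventually_view_ge hu hr hfair hm τ
        obtain ⟨B, hB⟩ := (Set.finite_range N).bddAbove
        refine ⟨B, fun a hab n hn => ?_⟩
        have hlt := hfr a b hab
        obtain ⟨x, hx, hx'⟩ := EGraph.sameLoc_of_fr hab
        rw [hbx] at hx'
        obtain ⟨τ, c, hn, rfl⟩ := hn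
        rw [loc_ev_ELab, ← hx'] at hx
        rw [stamp_ev hn, ← hts, Option.some.inj hx] at hlt
        by_contra hlt'
        have h1 := hB ⟨τ, rfl⟩
        have := hN τ (n + 1) (by omega)
        omega
    obtain ⟨N, hN⟩ := hbound
    refine finite_of_time_le (h := h) N fun a ha => ?_
    obtain ⟨n, hn⟩ : ∃ n, OccursAt h n a := by
      obtain ⟨⟨w, ⟨haE, haR, -⟩, -⟩, -⟩ := ha
      exact exists_occursAt_of_isR haE haR
    exact ⟨n, hN a ha n hn, hn⟩
  · rintro a b ⟨hbE, hbR, rfl⟩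
    exact (hsrc b hbE hbR).2.2.2.2.1
  · intro a b hab
    rcases sb_cases hab.1 hab.2.1 hab.2.2 with
      ⟨⟨x, rfl⟩, -⟩ | ⟨n, m, τ, la, lb, hlt, hn, hm, rfl, rfl⟩
    · exact fun _ => Nat.zero_le _
    · rw [viewAfter_ev hn, viewAfter_ev hm]
      exact (ViewRun.mono hu hr (by omega)).2 τ
  · rintro a b ⟨hbE, hbR, rfl⟩
    have := (hsrc b hbE hbR).2.2.2.2.2.1
    omega
  · rintro a b ⟨hbE, hbR, rfl⟩
    exact (hsrc b hbE hbR).2.2.2.2.2.2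

/-- Joining views at reads makes views grow along all of `po ∪ rf`, so happens-before on one
location does not decrease timestamps. Every edge increases (timestamp, time) lexicographically. -/
theorem exists_graph_of_mem_behMF_MRA [Finite Tid] {β : Behavior Tid (ELab Loc Val)}
    (hβ : β ∈ (MRA Tid Loc Val).BehMF) :
    ∃ G ∈ GRA Tid (ELab Loc Val), G.Fair ∧ eventsOf Loc β = G.E ∧ Irrefl G.hbRA := by
  obtain ⟨G, tm, ts, V, hfair, hE, hpo, hrf, hpoV, hV, hrft, hmo, hfr, hrfV⟩ :=
    exists_graph_of_mem_behMF_viewMem goodUpdate_sup hβ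
  have htm : ∀ a b, G.hbRA a b → tm a < tm b := fun a b hab => by
    induction hab with
    | single h => exact h.elim (hpo _ _) (hrf _ _)
    | tail _ h ih => exact ih.trans (h.elim (hpo _ _) (hrf _ _))
  have hrfV' : ∀ a b, G.rf a b → V a ≤ V b := fun a b hab => by
    obtain ⟨V₀, m, hm, hle⟩ := hrfV a b hab
    rw [← hm]
    exact le_sup_right.trans hle
  have hhb : ∀ a b, G.hbRA a b → V a ≤ V b := fun a b hab => by
    induction hab with
    | single h => exact h.elim (hpoV _ _) (hrfV' _ _)
    | tail _ h ih => exact ih.trans (h.elim (hpoV _ _) (hrfV' _ _))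
  refine ⟨G, ?_, hfair, hE, fun a ha => lt_irrefl _ (htm a a ha)⟩
  refine irrefl_transGen_of_lex ts tm ?_
  rintro a b (⟨h, x, hx, hx'⟩ | h | h | h)
  · refine Or.inr ⟨?_, htm a b h⟩
    rw [← hV a x hx, ← hV b x hx']
    exact hhb a b h x
  · exact Or.inr ⟨hrft a b h, hrf a b h⟩
  · exact Or.inl (hmo a b h)
  · exact Or.inl (hfr a b h)

/-- Views are known to grow only along `po`, which is all that `scLoc` needs; `po ∪ rf` is acyclic
because it goes forward in time. -/
theorem exists_graph_of_mem_behMF_MStrongCOH [Finite Tid] {β : Behavior Tid (ELab Loc Val)}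
    (hβ : β ∈ (MStrongCOH Tid Loc Val).BehMF) :
    ∃ G ∈ GStrongCOH Tid (ELab Loc Val), G.Fair ∧ eventsOf Loc β = G.E ∧ Irrefl G.hbRA := by
  obtain ⟨G, tm, ts, V, hfair, hE, hpo, hrf, hpoV, hV, hrft, hmo, hfr, -⟩ :=
    exists_graph_of_mem_behMF_viewMem goodUpdate_update hβ
  have hirr : Irrefl G.hbRA := irrefl_transGen_of_measure tm fun a b h => h.elim (hpo a b) (hrf a b)
  refine ⟨G, ⟨hirr, irrefl_transGen_of_lex ts tm ?_⟩, hfair, hE, hirr⟩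
  rintro a b (⟨h, x, hx, hx'⟩ | h | h | h)
  · refine Or.inr ⟨?_, hpo a b h⟩
    rw [← hV a x hx, ← hV b x hx']
    exact hpoV a b h x
  · exact Or.inr ⟨hrft a b h, hrf a b h⟩
  · exact Or.inl (hmo a b h)
  · exact Or.inl (hfr a b h)

end ViewGraph

/-! ### Store buffers that record the times of the writes -/

section Ghost

variable {Tid Loc Val : Type*}

open Classical in
/-- A step of the store buffer machine in which writes are represented by the time at which they are
issued. -/
inductive GhostStep (n : ℕ) (o : Option ((Tid × ELab Loc Val) ⊕ Tid)) (M : Loc → Option ℕ)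
    (B : Tid → List (Loc × ℕ)) (M' : Loc → Option ℕ) (B' : Tid → List (Loc × ℕ)) : Prop
  | same (ho : ∀ τ a, o = some (Sum.inl (τ, a)) → a.valW = none) (hs : ∀ τ, o ≠ some (Sum.inr τ))
      (hM : M' = M) (hB : B' = B)
  | write (τ : Tid) (x : Loc) (v : Val) (ho : o = some (Sum.inl (τ, .write x v))) (hM : M' = M)
      (hB : B' = Function.update B τ ((x, n) :: B τ))
  | rmw (τ : Tid) (x : Loc) (vR vW : Val) (ho : o = some (Sum.inl (τ, .rmw x vR vW)))
      (hB₀ : B τ = []) (hM : M' = Function.update M x (some n)) (hB : B' = B)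
  | prop (τ : Tid) (b : List (Loc × ℕ)) (x : Loc) (i : ℕ) (ho : o = some (Sum.inr τ))
      (hB₀ : B τ = b ++ [(x, i)]) (hM : M' = Function.update M x (some i))
      (hB : B' = Function.update B τ b)

/-- A run of the store buffer machine with recorded times. -/
structure GhostRun (l : ℕ → Option ((Tid × ELab Loc Val) ⊕ Tid)) (mem : ℕ → Loc → Option ℕ)
    (buf : ℕ → Tid → List (Loc × ℕ)) : Prop where
  mem_zero : ∀ x, mem 0 x = none
  buf_zero : ∀ τ, buf 0 τ = []
  step : ∀ n, GhostStep n (l n) (mem n) (buf n) (mem (n + 1)) (buf (n + 1))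

/-- The label at time `i` writes to `x`. -/
def WritesTo (l : ℕ → Option ((Tid × ELab Loc Val) ⊕ Tid)) (i : ℕ) (x : Loc) : Prop :=
  ∃ τ a, l i = some (Sum.inl (τ, a)) ∧ a.loc = x ∧ a.valW.isSome

/-- The write issued at time `i` is in a buffer at time `n`. -/
def Pending (buf : ℕ → Tid → List (Loc × ℕ)) (i n : ℕ) : Prop := ∃ τ x, (x, i) ∈ buf n τ

variable {l : ℕ → Option ((Tid × ELab Loc Val) ⊕ Tid)} {mem : ℕ → Loc → Option ℕ}
  {buf : ℕ → Tid → List (Loc × ℕ)}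

namespace GhostRun

theorem mem_buf_succ (g : GhostRun l mem buf) {n i : ℕ} {τ : Tid} {x : Loc}
    (h : (x, i) ∈ buf (n + 1) τ) :
    (x, i) ∈ buf n τ ∨ (i = n ∧ ∃ v, l n = some (Sum.inl (τ, .write x v))) := by
  classical
  rcases g.step n with ⟨ho, hs, hM, hB⟩ | ⟨τ', y, v, ho, hM, hB⟩ | ⟨τ', y, vR, vW, ho, hB₀, hM, hB⟩ |
    ⟨τ', b, y, j, ho, hB₀, hM, hB⟩
  · rw [hB] at h
    exact Or.inl h
  · rw [hB] at h
    by_cases hτ : τ = τ'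
    · subst hτ
      rw [Function.update_self] at h
      rcases List.mem_cons.1 h with h | h
      · cases h
        exact Or.inr ⟨rfl, v, ho⟩
      · exact Or.inl h
    · rw [Function.update_of_ne hτ] at h
      exact Or.inl h
  · rw [hB] at h
    exact Or.inl h
  · rw [hB] at h
    by_cases hτ : τ = τ'
    · subst hτ
      rw [Function.update_self] at h
      rw [hB₀]
      exact Or.inl (List.mem_append_left _ h)
    · rw [Function.update_of_ne hτ] at h
      exact Or.inl h

theorem label_of_mem_buf (g : GhostRun l mem buf) {n i : ℕ} {τ : Tid} {x : Loc}
    (h : (x, i) ∈ buf n τ) : i < n ∧ ∃ v, l i = some (Sum.inl (τ, .write x v)) := by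
  induction n with
  | zero =>
    rw [g.buf_zero] at h
    cases h
  | succ n ih =>
    rcases g.mem_buf_succ h with h | ⟨rfl, h⟩
    · exact ⟨(ih h).1.trans (Nat.lt_succ_self n), (ih h).2⟩
    · exact ⟨Nat.lt_succ_self _, h⟩

theorem mem_buf_unique (g : GhostRun l mem buf) {n m i : ℕ} {τ τ' : Tid} {x x' : Loc}
    (h : (x, i) ∈ buf n τ) (h' : (x', i) ∈ buf m τ') : τ = τ' ∧ x = x' := by
  obtain ⟨-, v, hv⟩ := g.label_of_mem_buf h
  obtain ⟨-, v', hv'⟩ := g.label_of_mem_buf h'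
  rw [hv] at hv'
  cases hv'
  exact ⟨rfl, rfl⟩

/-- New entries go to the front with the current time, and propagation only removes the last entry.
-/
theorem buf_sorted (g : GhostRun l mem buf) (n : ℕ) (τ : Tid) :
    (buf n τ).Pairwise fun p p' => p'.2 < p.2 := by
  classical
  induction n with
  | zero =>
    rw [g.buf_zero]
    exact List.Pairwise.nil
  | succ n ih =>
    rcases g.step n with ⟨ho, hs, hM, hB⟩ | ⟨τ', y, v, ho, hM, hB⟩ |
      ⟨τ', y, vR, vW, ho, hB₀, hM, hB⟩ | ⟨τ', b, y, j, ho, hB₀, hM, hB⟩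
    · rwa [hB]
    · rw [hB]
      by_cases hτ : τ = τ'
      · subst hτ
        rw [Function.update_self]
        exact List.Pairwise.cons (fun p hp => (g.label_of_mem_buf (x := p.1) (i := p.2) hp).1) ih
      · rwa [Function.update_of_ne hτ]
    · rwa [hB]
    · rw [hB]
      by_cases hτ : τ = τ'
      · subst hτ
        rw [Function.update_self]
        rw [hB₀] at ih
        exact (List.pairwise_append.1 ih).1
      · rwa [Function.update_of_ne hτ]

theorem last_le (g : GhostRun l mem buf) {n : ℕ} {τ : Tid} {b : List (Loc × ℕ)} {x y : Loc}
    {i j : ℕ} (h : buf n τ = b ++ [(x, i)]) (hj : (y, j) ∈ buf n τ) : i ≤ j := by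
  have hs := g.buf_sorted n τ
  rw [h] at hs hj
  rcases List.mem_append.1 hj with hj | hj
  · exact ((List.pairwise_append.1 hs).2.2 _ hj _ (List.mem_singleton.2 rfl)).le
  · cases List.mem_singleton.1 hj
    exact le_rfl

theorem not_pending_of_prop (g : GhostRun l mem buf) {n : ℕ} {τ : Tid} {b : List (Loc × ℕ)} {x : Loc}
    {i : ℕ} (h : buf n τ = b ++ [(x, i)])
    (hb : buf (n + 1) τ = b) : ¬ Pending buf i (n + 1) := by
  rintro ⟨τ', y, hy⟩
  have hmem : (x, i) ∈ buf n τ := by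
    rw [h]
    exact List.mem_append_right _ (List.mem_singleton.2 rfl)
  obtain ⟨rfl, rfl⟩ := g.mem_buf_unique hmem hy
  have hs := g.buf_sorted n τ
  rw [h] at hs
  rw [hb] at hy
  exact lt_irrefl _ ((List.pairwise_append.1 hs).2.2 _ hy _ (List.mem_singleton.2 rfl))

/-- Only propagation of the last entry removes a write from a buffer. -/
theorem prop_of_not_pending (g : GhostRun l mem buf) {n i : ℕ} {τ : Tid} {x : Loc}
    (h : (x, i) ∈ buf n τ) (h' : ¬ Pending buf i (n + 1)) :
    l n = some (Sum.inr τ) ∧ mem (n + 1) x = some i := by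
  classical
  rcases g.step n with ⟨ho, hs, hM, hB⟩ | ⟨τ', y, v, ho, hM, hB⟩ | ⟨τ', y, vR, vW, ho, hB₀, hM, hB⟩ |
    ⟨τ', b, y, j, ho, hB₀, hM, hB⟩
  · exact absurd ⟨τ, x, by rwa [hB]⟩ h'
  · refine absurd ⟨τ, x, ?_⟩ h'
    rw [hB]
    by_cases hτ : τ = τ'
    · subst hτ
      rw [Function.update_self]
      exact List.mem_cons_of_mem _ h
    · rwa [Function.update_of_ne hτ]
  · exact absurd ⟨τ, x, by rwa [hB]⟩ h'
  · by_cases hτ : τ = τ'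
    · subst hτ
      have hb : (x, i) ∉ b := fun hb => h' ⟨τ, x, by rwa [hB, Function.update_self]⟩
      rw [hB₀] at h
      cases List.mem_singleton.1 ((List.mem_append.1 h).resolve_left hb)
      exact ⟨ho, by rw [hM, Function.update_self]⟩
    · exact absurd ⟨τ, x, by rwa [hB, Function.update_of_ne hτ]⟩ h'

end GhostRun

/-- The time at which the write issued at time `i` reaches the memory. -/
noncomputable def flush (buf : ℕ → Tid → List (Loc × ℕ)) (i : ℕ) : ℕ :=
  -- The step at `m` leads to the state at `m + 1`. The bound `i ≤ m` discards the times before the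
  -- write is issued; an RMW is never pending and gets `i` itself.
  sInf {m | i ≤ m ∧ ¬ Pending buf i (m + 1)}

/-- Every write leaves its buffer. -/
def AllFlushed (buf : ℕ → Tid → List (Loc × ℕ)) : Prop := ∀ i, ∃ m, i ≤ m ∧ ¬ Pending buf i (m + 1)

/-! ### Flush times -/

section Flush

variable (g : GhostRun l mem buf) (hfl : AllFlushed buf)

include hfl

theorem le_flush (i : ℕ) : i ≤ flush buf i := (Nat.sInf_mem (hfl i)).1

theorem not_pending_flush (i : ℕ) : ¬ Pending buf i (flush buf i + 1) := (Nat.sInf_mem (hfl i)).2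

include g

/-- Only the write issued at the current time can enter a buffer, so a write that has left never
returns. -/
theorem not_pending_of_flush_lt {i n : ℕ} (h : flush buf i < n) : ¬ Pending buf i n := by
  induction n, h using Nat.le_induction with
  | base => exact not_pending_flush hfl i
  | succ n hn ih =>
    rintro ⟨τ, x, hx⟩
    rcases g.mem_buf_succ hx with h | ⟨rfl, -⟩
    · exact ih ⟨τ, x, h⟩
    · have := le_flush hfl i
      simp only [Nat.succ_eq_add_one] at hn
      omega

theorem le_flush_of_mem_buf {i n : ℕ} {τ : Tid} {x : Loc} (h : (x, i) ∈ buf n τ) :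
    n ≤ flush buf i := by
  by_contra hlt
  exact not_pending_of_flush_lt g hfl (not_le.1 hlt) ⟨τ, x, h⟩

omit hfl in
theorem mem_buf_of_le_flush {i n : ℕ} {τ : Tid} {x : Loc} {v : Val}
    (hi : l i = some (Sum.inl (τ, .write x v))) (hin : i < n) (hn : n ≤ flush buf i) :
    (x, i) ∈ buf n τ := by
  obtain ⟨m, rfl⟩ : ∃ m, n = m + 1 := ⟨n - 1, by omega⟩
  by_cases hp : Pending buf i (m + 1)
  · obtain ⟨τ', y, hy⟩ := hp
    obtain ⟨-, v', hv'⟩ := g.label_of_mem_buf hy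
    rw [hi] at hv'
    cases hv'
    exact hy
  · have : flush buf i ≤ m := Nat.sInf_le ⟨Nat.lt_succ_iff.1 hin, hp⟩
    omega

theorem flush_eq_of_prop {n i : ℕ} {τ : Tid} {x : Loc} (h : (x, i) ∈ buf n τ)
    (h' : ¬ Pending buf i (n + 1)) : flush buf i = n :=
  le_antisymm (Nat.sInf_le ⟨(g.label_of_mem_buf h).1.le, h'⟩) (le_flush_of_mem_buf g hfl h)

theorem flush_rmw {n : ℕ} {τ : Tid} {x : Loc} {vR vW : Val}
    (hn : l n = some (Sum.inl (τ, .rmw x vR vW))) : flush buf n = n := by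
  refine le_antisymm (Nat.sInf_le ⟨le_rfl, ?_⟩) (le_flush hfl n)
  rintro ⟨τ', y, hy⟩
  obtain ⟨-, v, hv⟩ := g.label_of_mem_buf hy
  rw [hn] at hv
  cases hv

theorem lt_flush_write {n : ℕ} {τ : Tid} {x : Loc} {v : Val}
    (hn : l n = some (Sum.inl (τ, .write x v))) : n < flush buf n ∧ (x, n) ∈ buf (n + 1) τ := by
  classical
  have hmem : (x, n) ∈ buf (n + 1) τ := by
    rcases g.step n with ⟨ho, hs, hM, hB⟩ | ⟨τ', y, v', ho, hM, hB⟩ |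
      ⟨τ', y, vR, vW, ho, hB₀, hM, hB⟩ | ⟨τ', b, y, j, ho, hB₀, hM, hB⟩
    · cases ho _ _ hn
    · rw [hn] at ho
      cases ho
      rw [hB, Function.update_self]
      exact List.mem_cons_self
    · rw [hn] at ho
      cases ho
    · rw [hn] at ho
      cases ho
  exact ⟨le_flush_of_mem_buf g hfl hmem, hmem⟩

/-- At its flush time, a write reaches the memory. -/
theorem mem_flush {i : ℕ} {x : Loc} (hi : WritesTo l i x) :
    mem (flush buf i + 1) x = some i ∧ (flush buf i = i ∨ ∃ τ, l (flush buf i) = some (Sum.inr τ)) := by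
  classical
  obtain ⟨τ, a, hl, rfl, hW⟩ := hi
  rcases a with ⟨x, v⟩ | ⟨x, v⟩ | ⟨x, v, v'⟩
  · cases hW
  · obtain ⟨hlt, -⟩ := lt_flush_write g hfl hl
    have hm := mem_buf_of_le_flush g hl hlt le_rfl
    obtain ⟨h1, h2⟩ := g.prop_of_not_pending hm (not_pending_flush hfl i)
    exact ⟨h2, Or.inr ⟨τ, h1⟩⟩
  · rw [flush_rmw g hfl hl]
    refine ⟨?_, Or.inl rfl⟩
    rcases g.step i with ⟨ho, hs, hM, hB⟩ | ⟨τ', y, u, ho, hM, hB⟩ |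
      ⟨τ', y, vR, vW, ho, hB₀, hM, hB⟩ | ⟨τ', b, y, j, ho, hB₀, hM, hB⟩
    · cases ho _ _ hl
    · rw [hl] at ho
      cases ho
    · rw [hl] at ho
      cases ho
      rw [hM]
      exact Function.update_self ..
    · rw [hl] at ho
      cases ho

theorem mem_succ_cases (n : ℕ) (x : Loc) :
    mem (n + 1) x = mem n x ∨ ∃ i, mem (n + 1) x = some i ∧ flush buf i = n ∧ WritesTo l i x := by
  classical
  rcases g.step n with ⟨ho, hs, hM, hB⟩ | ⟨τ', y, u, ho, hM, hB⟩ |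
      ⟨τ', y, vR, vW, ho, hB₀, hM, hB⟩ | ⟨τ', b, y, j, ho, hB₀, hM, hB⟩
  · exact Or.inl (by rw [hM])
  · exact Or.inl (by rw [hM])
  · by_cases hx : x = y
    · subst hx
      exact Or.inr ⟨n, by rw [hM, Function.update_self], flush_rmw g hfl ho, τ', _, ho, rfl, rfl⟩
    · exact Or.inl (by rw [hM, Function.update_of_ne hx])
  · by_cases hx : x = y
    · subst hx
      have hmem : (x, j) ∈ buf n τ' := by
        rw [hB₀]
        exact List.mem_append_right _ (List.mem_singleton.2 rfl)
      obtain ⟨-, v, hv⟩ := g.label_of_mem_buf hmem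
      exact Or.inr ⟨j, by rw [hM, Function.update_self], flush_eq_of_prop g hfl hmem
        (g.not_pending_of_prop hB₀ (by rw [hB, Function.update_self])), τ', _, hv, rfl, rfl⟩
    · exact Or.inl (by rw [hM, Function.update_of_ne hx])

theorem flush_lt_of_mem {n i : ℕ} {x : Loc} (h : mem n x = some i) :
    flush buf i < n ∧ WritesTo l i x := by
  induction n with
  | zero =>
    rw [g.mem_zero] at h
    cases h
  | succ n ih =>
    rcases mem_succ_cases g hfl n x with h' | ⟨j, h1, h2, h3⟩
    · rw [h'] at h
      exact ⟨(ih h).1.trans (Nat.lt_succ_self n), (ih h).2⟩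
    · rw [h1] at h
      cases h
      exact ⟨by omega, h3⟩

/-- A memory cell is overwritten only by the write flushed at that very time, so the flush times of
its contents never decrease. -/
theorem exists_mem_of_flush_lt {n i : ℕ} {x : Loc} (hi : WritesTo l i x) (h : flush buf i < n) :
    ∃ j, mem n x = some j ∧ flush buf i ≤ flush buf j := by
  induction n, h using Nat.le_induction with
  | base => exact ⟨i, (mem_flush g hfl hi).1, le_rfl⟩
  | succ n hn ih =>
    obtain ⟨j, hj, hle⟩ := ih
    simp only [Nat.succ_eq_add_one] at hn
    rcases mem_succ_cases g hfl n x with h' | ⟨k, h1, h2, -⟩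
    · exact ⟨j, h'.trans hj, hle⟩
    · exact ⟨k, h1, by omega⟩

/-- Buffers are first-in first-out. -/
theorem flush_lt_flush {n i j : ℕ} {τ : Tid} {x y : Loc} (hi : (x, i) ∈ buf n τ)
    (hj : (y, j) ∈ buf n τ) (hij : i < j) : flush buf i < flush buf j := by
  classical
  by_contra hle
  rw [not_lt] at hle
  obtain ⟨hin, v, hv⟩ := g.label_of_mem_buf hi
  obtain ⟨hjn, w, hw⟩ := g.label_of_mem_buf hj
  have hnj := le_flush_of_mem_buf g hfl hj
  -- Both entries are still in the buffer when `j` leaves it, but only the oldest entry can leave.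
  have hi' := mem_buf_of_le_flush g hv (hin.trans_le hnj) hle
  have hj' := mem_buf_of_le_flush g hw (hjn.trans_le hnj) le_rfl
  have hnp := not_pending_flush hfl j
  have ho := (g.prop_of_not_pending hj' hnp).1
  rcases g.step (flush buf j) with ⟨_, hs, _, _⟩ | ⟨τ', z, u, ho', _, _⟩ |
    ⟨τ', z, vR, vW, ho', _, _, _⟩ | ⟨τ', b, z, k, ho', hB₀, hM, hB⟩
  · exact hs _ ho
  · rw [ho] at ho'
    cases ho'
  · rw [ho] at ho'
    cases ho'
  · rw [ho] at ho'
    cases ho'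
    have hk : k ≤ i := g.last_le hB₀ hi'
    have hjb : (y, j) ∉ b := fun hb => hnp ⟨τ, y, by rwa [hB, Function.update_self]⟩
    rw [hB₀] at hj'
    cases List.mem_singleton.1 ((List.mem_append.1 hj').resolve_left hjb)
    omega

end Flush

open Classical in
/-- The memory `M` overridden by the entries of the buffer `b`, newest entry first. -/
noncomputable def overlay (b : List (Loc × ℕ)) (M : Loc → Option ℕ) : Loc → Option ℕ :=
  b.foldr (fun (p : Loc × ℕ) (M : Loc → Option ℕ) => Function.update M p.1 (some p.2)) M

theorem overlay_cons_self (p : Loc × ℕ) (b : List (Loc × ℕ)) (M : Loc → Option ℕ) :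
    overlay (p :: b) M p.1 = some p.2 := by
  simp [overlay]

theorem overlay_cons_of_ne {p : Loc × ℕ} {x : Loc} (hx : x ≠ p.1) (b : List (Loc × ℕ))
    (M : Loc → Option ℕ) : overlay (p :: b) M x = overlay b M x := by
  simp [overlay, hx]

/-- The write that thread `τ` sees at location `x` (`none` for initialization). -/
noncomputable def ghostView (mem : ℕ → Loc → Option ℕ) (buf : ℕ → Tid → List (Loc × ℕ)) (n : ℕ)
    (τ : Tid) (x : Loc) : Option ℕ :=
  overlay (buf n τ) (mem n) x

/-- The position of a write in the order of flushing, starting with initialization. -/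
noncomputable def flushPos (buf : ℕ → Tid → List (Loc × ℕ)) : Option ℕ → ℕ
  | none => 0
  | some i => flush buf i + 1

theorem flushPos_some (buf : ℕ → Tid → List (Loc × ℕ)) (i : ℕ) :
    flushPos buf (some i) = flush buf i + 1 := rfl

theorem overlay_cases (b : List (Loc × ℕ)) (hb : b.Pairwise fun p p' => p'.2 < p.2)
    (M : Loc → Option ℕ) (x : Loc) :
    (∃ i, (x, i) ∈ b ∧ overlay b M x = some i ∧ ∀ j, (x, j) ∈ b → j ≤ i) ∨
    (overlay b M x = M x ∧ ∀ j, (x, j) ∉ b) := by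
  classical
  induction b with
  | nil => exact Or.inr ⟨rfl, fun _ => List.not_mem_nil⟩
  | cons p b ih =>
    obtain ⟨h1, h2⟩ := List.pairwise_cons.1 hb
    obtain ⟨y, k⟩ := p
    by_cases hx : x = y
    · subst hx
      refine Or.inl ⟨k, List.mem_cons_self, overlay_cons_self (x, k) b M, fun j hj => ?_⟩
      rcases List.mem_cons.1 hj with hj | hj
      · cases hj
        exact le_rfl
      · exact (h1 _ hj).le
    · have hmem : ∀ j, (x, j) ∈ (y, k) :: b ↔ (x, j) ∈ b := fun j => by simp [hx]
      have hov : overlay ((y, k) :: b) M x = overlay b M x := overlay_cons_of_ne hx b M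
      simp only [hmem, hov]
      exact ih h2

/-! ### Visible writes and their flush positions -/

section View

variable (g : GhostRun l mem buf) (hfl : AllFlushed buf)

include g

theorem ghostView_cases (n : ℕ) (τ : Tid) (x : Loc) :
    (∃ i, (x, i) ∈ buf n τ ∧ ghostView mem buf n τ x = some i ∧ ∀ j, (x, j) ∈ buf n τ → j ≤ i) ∨
    (ghostView mem buf n τ x = mem n x ∧ ∀ j, (x, j) ∉ buf n τ) :=
  overlay_cases (buf n τ) (g.buf_sorted n τ) (mem n) x

include hfl

theorem flushPos_mem_le (n : ℕ) (x : Loc) : flushPos buf (mem n x) ≤ n := by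
  rcases h : mem n x with _ | i
  · exact Nat.zero_le _
  · exact (flush_lt_of_mem g hfl h).1

/-- A buffered write is flushed later than everything already in the memory. -/
theorem flushPos_mem_le_ghostView (n : ℕ) (τ : Tid) (x : Loc) :
    flushPos buf (mem n x) ≤ flushPos buf (ghostView mem buf n τ x) := by
  rcases ghostView_cases g n τ x with ⟨i, hi, hv, -⟩ | ⟨hv, -⟩
  · rw [hv]
    have h1 := flushPos_mem_le g hfl n x
    have h2 := le_flush_of_mem_buf g hfl hi
    simp only [flushPos_some]
    omega
  · rw [hv]

/-- While the visible buffered write stays buffered, it can only be hidden by one flushed later;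
when it is flushed, the memory takes it over; and the memory itself only moves forward in flush
order. Coherence of the TSO graph rests on this. -/
theorem flushPos_ghostView_succ (n : ℕ) (τ : Tid) (x : Loc) :
    flushPos buf (ghostView mem buf n τ x) ≤ flushPos buf (ghostView mem buf (n + 1) τ x) := by
  rcases ghostView_cases g n τ x with ⟨j, hj, hv, -⟩ | ⟨hv, -⟩
  · by_cases hp : Pending buf j (n + 1)
    · obtain ⟨τ', y, hy⟩ := hp
      obtain ⟨rfl, rfl⟩ := g.mem_buf_unique hj hy
      rcases ghostView_cases g (n + 1) τ x with ⟨i, hi, hv', hmax⟩ | ⟨-, hno⟩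
      · rw [hv, hv']
        rcases Nat.lt_or_eq_of_le (hmax j hy) with hlt | rfl
        · have := flush_lt_flush g hfl hy hi hlt
          simp only [flushPos_some]
          omega
        · exact le_rfl
      · exact absurd hy (hno j)
    · have hn := flush_eq_of_prop g hfl hj hp
      obtain ⟨-, v, hl⟩ := g.label_of_mem_buf hj
      obtain ⟨k, hk, hle⟩ := exists_mem_of_flush_lt g hfl (n := n + 1) (i := j) (x := x)
        ⟨τ, _, hl, rfl, rfl⟩ (by omega)
      have := flushPos_mem_le_ghostView g hfl (n + 1) τ x
      rw [hk] at this
      rw [hv]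
      simp only [flushPos_some] at this ⊢
      omega
  · rw [hv]
    refine le_trans ?_ (flushPos_mem_le_ghostView g hfl (n + 1) τ x)
    rcases mem_succ_cases g hfl n x with h | ⟨i, h1, h2, -⟩
    · rw [h]
    · rw [h1]
      have := flushPos_mem_le g hfl n x
      simp only [flushPos_some]
      omega

theorem flushPos_ghostView_mono {i j : ℕ} (hij : i ≤ j) (τ : Tid) (x : Loc) :
    flushPos buf (ghostView mem buf i τ x) ≤ flushPos buf (ghostView mem buf j τ x) := by
  induction j, hij using Nat.le_induction with
  | base => exact le_rfl
  | succ j _ ih => exact ih.trans (flushPos_ghostView_succ g hfl j τ x)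

/-- A thread sees its own write. -/
theorem ghostView_write {n : ℕ} {τ : Tid} {a : ELab Loc Val} (hn : l n = some (Sum.inl (τ, a)))
    (hW : a.valW.isSome) : ghostView mem buf (n + 1) τ a.loc = some n := by
  classical
  rcases a with ⟨x, v⟩ | ⟨x, v⟩ | ⟨x, v, v'⟩
  · cases hW
  · obtain ⟨-, hmem⟩ := lt_flush_write g hfl hn
    rcases ghostView_cases g (n + 1) τ x with ⟨i, hi, hv', hmax⟩ | ⟨-, hno⟩
    · have h1 := hmax n hmem
      have h2 := (g.label_of_mem_buf hi).1
      obtain rfl : i = n := by omega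
      exact hv'
    · exact absurd hmem (hno n)
  · rcases g.step n with ⟨ho, hs, hM, hB⟩ | ⟨τ', y, u, ho, hM, hB⟩ |
      ⟨τ', y, vR, vW, ho, hB₀, hM, hB⟩ | ⟨τ', b, y, j, ho, hB₀, hM, hB⟩
    · cases ho _ _ hn
    · rw [hn] at ho
      cases ho
    · rw [hn] at ho
      cases ho
      unfold ghostView
      rw [hB, hB₀, hM]
      simp [overlay, ELab.loc]
    · rw [hn] at ho
      cases ho

omit hfl in
theorem ghostView_read {n : ℕ} {τ : Tid} {a : ELab Loc Val} (hn : l n = some (Sum.inl (τ, a)))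
    (hW : a.valW = none) (τ' : Tid) (x : Loc) :
    ghostView mem buf (n + 1) τ' x = ghostView mem buf n τ' x := by
  rcases g.step n with ⟨ho, hs, hM, hB⟩ | ⟨τ', y, u, ho, hM, hB⟩ |
      ⟨τ', y, vR, vW, ho, hB₀, hM, hB⟩ | ⟨τ', b, y, j, ho, hB₀, hM, hB⟩
  · unfold ghostView
    rw [hM, hB]
  · rw [hn] at ho
    cases ho
    cases hW
  · rw [hn] at ho
    cases ho
    cases hW
  · rw [hn] at ho
    cases ho

omit hfl in
theorem buf_eq_nil_of_rmw {n : ℕ} {τ : Tid} {x : Loc} {vR vW : Val}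
    (hn : l n = some (Sum.inl (τ, .rmw x vR vW))) : buf n τ = [] := by
  rcases g.step n with ⟨ho, hs, hM, hB⟩ | ⟨τ', y, u, ho, hM, hB⟩ |
      ⟨τ', y, vR, vW, ho, hB₀, hM, hB⟩ | ⟨τ', b, y, j, ho, hB₀, hM, hB⟩
  · cases ho _ _ hn
  · rw [hn] at ho
    cases ho
  · rw [hn] at ho
    cases ho
    exact hB₀
  · rw [hn] at ho
    cases ho

end View

end Ghost

/-! ### Recording times along a run of the store buffer machine -/

section GhostOfRun

variable {Tid Loc Val : Type*} [Zero Val]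

/-- The value written at time `i`. -/
def writtenVal (l : ℕ → Option ((Tid × ELab Loc Val) ⊕ Tid)) : Option ℕ → Val
  | none => 0
  | some i => match l i with
    | some (Sum.inl (_, a)) => a.valW.getD 0
    | _ => 0

open Classical in
/-- One step of the machine with recorded times. -/
noncomputable def ghostNext (n : ℕ) (o : Option ((Tid × ELab Loc Val) ⊕ Tid))
    (s : (Loc → Option ℕ) × (Tid → List (Loc × ℕ))) : (Loc → Option ℕ) × (Tid → List (Loc × ℕ)) :=
  match o with
  | some (Sum.inl (τ, .write x _)) => (s.1, Function.update s.2 τ ((x, n) :: s.2 τ))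
  | some (Sum.inl (_, .rmw x _ _)) => (Function.update s.1 x (some n), s.2)
  | some (Sum.inr τ) => match (s.2 τ).getLast? with
    | some p => (Function.update s.1 p.1 (some p.2), Function.update s.2 τ (s.2 τ).dropLast)
    | none => s
  | _ => s

/-- The states of the machine with recorded times. -/
noncomputable def ghostState (l : ℕ → Option ((Tid × ELab Loc Val) ⊕ Tid)) :
    ℕ → (Loc → Option ℕ) × (Tid → List (Loc × ℕ))
  | 0 => (fun _ => none, fun _ => [])
  | n + 1 => ghostNext n (l n) (ghostState l n)

variable {q : ℕ → (Loc → Val) × (Tid → List (Loc × Val))}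
  {l : ℕ → Option ((Tid × ELab Loc Val) ⊕ Tid)}

/-- The recorded times determine the actual memory and buffers. -/
def GhostMatches (l : ℕ → Option ((Tid × ELab Loc Val) ⊕ Tid))
    (s : (Loc → Option ℕ) × (Tid → List (Loc × ℕ)))
    (q : (Loc → Val) × (Tid → List (Loc × Val))) : Prop :=
  (∀ x, q.1 x = writtenVal l (s.1 x)) ∧
    ∀ τ, q.2 τ = (s.2 τ).map fun p => (p.1, writtenVal l (some p.2))

/-- Both machines take the same actions; a recorded time determines the written value through the
label issued at that time. -/
theorem ghostNext_spec (n : ℕ) {s : (Loc → Option ℕ) × (Tid → List (Loc × ℕ))}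
    {q q' : (Loc → Val) × (Tid → List (Loc × Val))} {σ : (Tid × ELab Loc Val) ⊕ Tid}
    (hl : l n = some σ) (hq : (MTSO Tid Loc Val).step q σ q') (hm : GhostMatches l s q) :
    GhostMatches l (ghostNext n (some σ) s) q' ∧ GhostStep n (some σ) s.1 s.2
      (ghostNext n (some σ) s).1 (ghostNext n (some σ) s).2 := by
  classical
  obtain ⟨hm1, hm2⟩ := hm
  rcases σ with ⟨τ, ⟨x, v⟩ | ⟨x, v⟩ | ⟨x, v, v'⟩⟩ | τ
  · obtain ⟨-, rfl⟩ := hq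
    refine ⟨⟨hm1, hm2⟩, .same ?_ ?_ rfl rfl⟩
    · rintro _ _ ⟨⟩
      rfl
    · rintro _ ⟨⟩
  · obtain rfl := hq
    have hv : writtenVal l (some n) = v := by simp [writtenVal, hl, ELab.valW]
    refine ⟨⟨hm1, fun τ' => ?_⟩, .write τ x v rfl rfl rfl⟩
    by_cases hτ : τ' = τ
    · subst hτ
      simp [ghostNext, hm2, hv]
    · simp [ghostNext, hτ, hm2]
  · obtain ⟨hnil, -, rfl⟩ := hq
    have hv : writtenVal l (some n) = v' := by simp [writtenVal, hl, ELab.valW]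
    refine ⟨⟨fun y => ?_, hm2⟩, .rmw τ x v v' rfl ?_ rfl rfl⟩
    · by_cases hy : y = x
      · subst hy
        simp [ghostNext, hv]
      · simp [ghostNext, hy, hm1]
    · rw [hm2] at hnil
      exact List.map_eq_nil_iff.1 hnil
  · obtain ⟨b, x, v, hb, rfl⟩ := hq
    rw [hm2] at hb
    obtain ⟨b', c, hs, rfl, hc⟩ := List.map_eq_append_iff.1 hb
    obtain ⟨⟨y, i⟩, rfl⟩ : ∃ p, c = [p] := by
      rcases c with _ | ⟨p, _ | ⟨p', c⟩⟩
      · simp at hc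
      · exact ⟨p, rfl⟩
      · simp at hc
    simp only [List.map_cons, List.map_nil, List.cons.injEq, Prod.mk.injEq, and_true] at hc
    obtain ⟨rfl, rfl⟩ := hc
    have hnext : ghostNext n (some (Sum.inr τ) : Option ((Tid × ELab Loc Val) ⊕ Tid)) s =
        (Function.update s.1 y (some i), Function.update s.2 τ b') := by
      simp [ghostNext, hs]
    rw [hnext]
    refine ⟨⟨fun z => ?_, fun τ' => ?_⟩, .prop τ b' y i rfl hs rfl rfl⟩
    · by_cases hz : z = y
      · subst hz
        simp
      · simp [hz, hm1]
    · by_cases hτ : τ' = τ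
      · subst hτ
        simp
      · simp [hτ, hm2]

theorem ghostMatches_of_run (hr : StutterRun (MTSO Tid Loc Val) q l) (n : ℕ) :
    GhostMatches l (ghostState l n) (q n) := by
  induction n with
  | zero =>
    rw [hr.init]
    exact ⟨fun _ => rfl, fun _ => rfl⟩
  | succ n ih =>
    rcases hl : l n with _ | σ
    · rw [hr.idle n hl]
      simp only [ghostState, hl]
      exact ih
    · simp only [ghostState, hl]
      exact (ghostNext_spec n hl (hr.step n σ hl) ih).1

theorem ghostRun_of_run (hr : StutterRun (MTSO Tid Loc Val) q l) :
    GhostRun l (fun n => (ghostState l n).1) (fun n => (ghostState l n).2) where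
  mem_zero _ := rfl
  buf_zero _ := rfl
  step n := by
    rcases hl : l n with _ | σ
    · refine .same ?_ ?_ ?_ ?_
      · rintro _ _ ⟨⟩
      · rintro _ ⟨⟩
      · simp only [ghostState, hl]
        rfl
      · simp only [ghostState, hl]
        rfl
    · simp only [ghostState, hl]
      exact (ghostNext_spec n hl (hr.step n σ hl) (ghostMatches_of_run hr n)).2

open Classical in
theorem foldr_eq_writtenVal_overlay (b : List (Loc × ℕ)) (M : Loc → Option ℕ) (M' : Loc → Val)
    (hM : ∀ x, M' x = writtenVal l (M x)) (x : Loc) :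
    (b.map fun p => (p.1, writtenVal l (some p.2))).foldr (fun p M => Function.update M p.1 p.2) M' x
      = writtenVal l (overlay b M x) := by
  induction b generalizing x with
  | nil => exact hM x
  | cons p b ih =>
    simp only [List.map_cons, List.foldr_cons]
    by_cases hx : x = p.1
    · subst hx
      rw [Function.update_self]
      exact congrArg (writtenVal l) (overlay_cons_self p b M).symm
    · rw [Function.update_of_ne hx, ih x]
      exact congrArg (writtenVal l) (overlay_cons_of_ne hx b M).symm

/-- The value read is the one written by the visible write. -/
theorem read_value (hr : StutterRun (MTSO Tid Loc Val) q l) {n : ℕ} {τ : Tid} {a : ELab Loc Val}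
    {v : Val} (hn : l n = some (Sum.inl (τ, a))) (hv : a.valR = some v) :
    writtenVal l (ghostView (fun n => (ghostState l n).1) (fun n => (ghostState l n).2) n τ a.loc)
      = v := by
  classical
  obtain ⟨h1, h2⟩ := ghostMatches_of_run hr n
  have hstep := hr.step n _ hn
  have hfold := foldr_eq_writtenVal_overlay ((ghostState l n).2 τ) (ghostState l n).1 (q n).1 h1 a.loc
  rw [← h2] at hfold
  refine hfold.symm.trans ?_
  rcases a with ⟨x, u⟩ | ⟨x, u⟩ | ⟨x, u, u'⟩
  · cases hv
    exact hstep.1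
  · cases hv
  · cases hv
    -- An RMW requires an empty buffer, and then the overridden memory is the memory itself.
    rw [hstep.1]
    exact hstep.2.1

/-- A write stuck in the buffer of `τ` keeps propagation enabled, so it is taken infinitely often.
Each time the oldest entry leaves, which dates from time `i` or before; no such entries are added
later, so their number would decrease forever. -/
theorem allFlushed_of_fair (hr : StutterRun (MTSO Tid Loc Val) q l)
    (hf : StutterFair (MTSO Tid Loc Val) q l) : AllFlushed fun n => (ghostState l n).2 := by
  classical
  have g := ghostRun_of_run hr
  set buf := fun n => (ghostState l n).2 with hbuf
  intro i
  by_contra hne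
  push Not at hne
  obtain ⟨τ, x, hx⟩ := hne i le_rfl
  have hall : ∀ m ≥ i + 1, (x, i) ∈ buf m τ := by
    intro m hm
    obtain ⟨m, rfl⟩ : ∃ k, m = k + 1 := ⟨m - 1, by omega⟩
    obtain ⟨τ', y, hy⟩ := hne m (by omega)
    obtain ⟨rfl, rfl⟩ := g.mem_buf_unique hx hy
    exact hy
  have hprop : ∀ k ≥ i + 1, ∃ j ≥ k, l j = some (Sum.inr τ) := by
    intro k hk
    refine hf τ k fun j hj => ?_
    have hmem := hall j (by omega)
    have hne : (q j).2 τ ≠ [] := by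
      rw [(ghostMatches_of_run hr j).2 τ]
      exact fun h => List.ne_nil_of_mem hmem (List.map_eq_nil_iff.1 h)
    obtain ⟨b, ⟨y, v⟩, hb⟩ := (List.eq_nil_or_concat ((q j).2 τ)).resolve_left hne
    exact ⟨_, b, y, v, by simpa using hb, rfl⟩
  let c : ℕ → ℕ := fun m => (buf m τ).countP fun p => decide (p.2 ≤ i)
  have hc : ∀ m ≥ i + 1, c (m + 1) ≤ c m ∧ (l m = some (Sum.inr τ) → c (m + 1) < c m) := by
    intro m hm
    rcases g.step m with ⟨ho, hs, hM, hB⟩ | ⟨τ', y, u, ho, hM, hB⟩ |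
      ⟨τ', y, vR, vW, ho, hB₀, hM, hB⟩ | ⟨τ', b, y, j, ho, hB₀, hM, hB⟩
    · have : c (m + 1) = c m := by
        change (buf (m + 1) τ).countP _ = (buf m τ).countP _
        rw [show buf (m + 1) = buf m from hB]
      exact ⟨this.le, fun h => absurd h (hs τ)⟩
    · have : c (m + 1) = c m := by
        change (buf (m + 1) τ).countP _ = (buf m τ).countP _
        rw [show buf (m + 1) = _ from hB]
        by_cases hτ : τ = τ'
        · subst hτ
          rw [Function.update_self, List.countP_cons_of_neg]
          simp only [decide_eq_true_eq]
          omega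
        · rw [Function.update_of_ne hτ]
      refine ⟨this.le, fun h => ?_⟩
      rw [ho] at h
      cases h
    · have : c (m + 1) = c m := by
        change (buf (m + 1) τ).countP _ = (buf m τ).countP _
        rw [show buf (m + 1) = buf m from hB]
      refine ⟨this.le, fun h => ?_⟩
      rw [ho] at h
      cases h
    · by_cases hτ : τ = τ'
      · subst hτ
        have hj : j ≤ i := g.last_le hB₀ (hall m hm)
        have : c (m + 1) < c m := by
          change (buf (m + 1) τ).countP _ < (buf m τ).countP _
          rw [show buf (m + 1) = _ from hB, show buf m τ = _ from hB₀, Function.update_self,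
            List.countP_append, List.countP_singleton]
          simp [hj]
        exact ⟨this.le, fun _ => this⟩
      · have : c (m + 1) = c m := by
          change (buf (m + 1) τ).countP _ = (buf m τ).countP _
          rw [show buf (m + 1) = _ from hB, Function.update_of_ne hτ]
        refine ⟨this.le, fun h => ?_⟩
        rw [ho] at h
        cases h
        exact absurd rfl hτ
  have hanti : ∀ k m, i + 1 ≤ k → k ≤ m → c m ≤ c k := by
    intro k m hk hkm
    induction m, hkm using Nat.le_induction with
    | base => exact le_rfl
    | succ m hkm ih => exact (hc m (by omega)).1.trans ih
  have hdesc : ∀ N k, i + 1 ≤ k → c k < N → False := by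
    intro N
    induction N with
    | zero => exact fun k _ h => Nat.not_lt_zero _ h
    | succ N ih =>
      intro k hk hlt
      obtain ⟨j, hj, hlj⟩ := hprop k hk
      have h1 := hanti k j hk hj
      have h2 := (hc j (by omega)).2 hlj
      exact ih (j + 1) (by omega) (by omega)
  exact hdesc _ (i + 1) le_rfl (Nat.lt_succ_self _)

end GhostOfRun

/-! ### Graphs of runs of the store buffer machine -/

section TSOGraph

variable {Tid Loc Val : Type*} [Zero Val]

/-- The flush position of a write, or of the source of a read. -/
noncomputable def flushStamp (mem : ℕ → Loc → Option ℕ) (buf : ℕ → Tid → List (Loc × ℕ))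
    (h : ℕ → Option (Tid × ELab Loc Val)) (e : Event Tid Loc (ELab Loc Val)) : ℕ :=
  match e with
  | .init _ => 0
  | .ev k τ a => flushPos buf
      (ghostView mem buf (time h (.ev k τ a : Event Tid Loc (ELab Loc Val))) τ a.loc)

variable {l : ℕ → Option ((Tid × ELab Loc Val) ⊕ Tid)} {mem : ℕ → Loc → Option ℕ}
  {buf : ℕ → Tid → List (Loc × ℕ)}

omit [Zero Val] in
theorem flushStamp_ev {h : ℕ → Option (Tid × ELab Loc Val)} {n : ℕ} {τ : Tid} {a : ELab Loc Val}
    (hn : h n = some (τ, a)) : flushStamp mem buf h (.ev (cnt (thr h τ) n) τ a) =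
      flushPos buf (ghostView mem buf (n + 1) τ a.loc) := by
  simp only [flushStamp]
  rw [OccursAt.time_eq ⟨τ, a, hn, rfl⟩]

variable (g : GhostRun l mem buf) (hfl : AllFlushed buf)

include g hfl

omit [Zero Val] in
theorem flushStamp_write {n : ℕ} {τ : Tid} {a : ELab Loc Val} (hn : obs l n = some (τ, a))
    (hW : a.valW.isSome) : flushStamp mem buf (obs l) (.ev (cnt (thr (obs l) τ) n) τ a) =
      flush buf n + 1 := by
  rw [flushStamp_ev hn, ghostView_write g hfl (obs_eq_some.1 hn) hW, flushPos_some]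

theorem exists_event_of_writesTo {i : ℕ} {x : Loc} (hi : WritesTo l i x) :
    ∃ τ a, obs l i = some (τ, a) ∧ a.loc = x ∧ a.valW = some (writtenVal l (some i)) ∧
      flushStamp mem buf (obs l) (.ev (cnt (thr (obs l) τ) i) τ a) = flush buf i + 1 := by
  obtain ⟨τ, a, hl, hx, hW⟩ := hi
  refine ⟨τ, a, obs_eq_some.2 hl, hx, ?_, flushStamp_write g hfl (obs_eq_some.2 hl) hW⟩
  obtain ⟨v, hv⟩ := Option.isSome_iff_exists.1 hW
  simp [writtenVal, hl, hv]

/-- The event seen by a thread at a location. -/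
theorem exists_visible_event (n : ℕ) (τ : Tid) (x : Loc) :
    ∃ w ∈ eventsOf Loc (histBeh (obs l)), w.IsW ∧ w.loc = some x ∧
      w.valW = some (writtenVal l (ghostView mem buf n τ x)) ∧
      flushStamp mem buf (obs l) w = flushPos buf (ghostView mem buf n τ x) ∧
      time (obs l) w ≤ n ∧ (flushStamp mem buf (obs l) w ≤ n ∨
        ∃ i a, i < n ∧ obs l i = some (τ, a) ∧ w = .ev (cnt (thr (obs l) τ) i) τ a) := by
  have hex : ∀ i, WritesTo l i x → ghostView mem buf n τ x = some i → i < n →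
      (flush buf i < n ∨ ∃ v, l i = some (Sum.inl (τ, .write x v))) →
      ∃ w ∈ eventsOf Loc (histBeh (obs l)), w.IsW ∧ w.loc = some x ∧
      w.valW = some (writtenVal l (ghostView mem buf n τ x)) ∧
      flushStamp mem buf (obs l) w = flushPos buf (ghostView mem buf n τ x) ∧
      time (obs l) w ≤ n ∧ (flushStamp mem buf (obs l) w ≤ n ∨
        ∃ i a, i < n ∧ obs l i = some (τ, a) ∧ w = .ev (cnt (thr (obs l) τ) i) τ a) := by
    intro i hi hv hin hcase
    obtain ⟨τ', a, hl, hx, hval, hst⟩ := exists_event_of_writesTo g hfl hi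
    have hocc : OccursAt (Loc := Loc) (obs l) i (.ev (cnt (thr (obs l) τ') i) τ' a) :=
      ⟨τ', a, hl, rfl⟩
    refine ⟨_, hocc.mem, ?_, congrArg some hx, ?_, ?_, ?_, ?_⟩
    · rw [Event.IsW, valW_ev_ELab, hval]
      rfl
    · rw [hv]
      exact hval
    · rw [hst, hv, flushPos_some]
    · rw [hocc.time_eq]
      exact hin
    · rcases hcase with h | ⟨v, h⟩
      · exact Or.inl (by rw [hst]; exact h)
      · have := obs_eq_some.1 hl
        rw [h] at this
        cases this
        exact Or.inr ⟨i, _, hin, hl, rfl⟩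
  rcases ghostView_cases g n τ x with ⟨i, hi, hv, -⟩ | ⟨hv, -⟩
  · obtain ⟨hin, v, hl⟩ := g.label_of_mem_buf hi
    exact hex i ⟨τ, _, hl, rfl, rfl⟩ hv hin (Or.inr ⟨v, hl⟩)
  · rcases hm : mem n x with _ | i
    · rw [hv, hm]
      exact ⟨.init x, init_mem_eventsOf _ x, Event.isW_init x, rfl, rfl, rfl, by simp,
        Or.inl (Nat.zero_le _)⟩
    · obtain ⟨h1, h2⟩ := flush_lt_of_mem g hfl hm
      exact hex i h2 (hv.trans hm) ((le_flush hfl i).trans_lt h1) (Or.inl h1)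

omit [Zero Val] in
/-- A write that comes after the one visible at time `n` is not flushed before time `n`. -/
theorem le_flush_of_visible_lt {n j : ℕ} {τ : Tid} {x : Loc} (hj : WritesTo l j x)
    (h : flushPos buf (ghostView mem buf n τ x) < flush buf j + 1) : n ≤ flush buf j := by
  by_contra hlt
  obtain ⟨k, hk, hle⟩ := exists_mem_of_flush_lt g hfl hj (not_le.1 hlt)
  have := flushPos_mem_le_ghostView g hfl n τ x
  rw [hk, flushPos_some] at this
  omega

omit [Zero Val] in
/-- Writes of a thread are flushed in program order. -/
theorem flush_lt_flush_of_lt {n m : ℕ} {τ : Tid} {a b : ELab Loc Val}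
    (hn : l n = some (Sum.inl (τ, a))) (hm : l m = some (Sum.inl (τ, b))) (ha : a.valW.isSome)
    (hb : b.valW.isSome) (hnm : n < m) : flush buf n < flush buf m := by
  rcases a with ⟨x, v⟩ | ⟨x, v⟩ | ⟨x, v, v'⟩
  · cases ha
  · by_contra hle
    have hmm := le_flush hfl m
    rcases b with ⟨y, u⟩ | ⟨y, u⟩ | ⟨y, u, u'⟩
    · cases hb
    · obtain ⟨hlt, hmem⟩ := lt_flush_write g hfl hm
      have hmem' := mem_buf_of_le_flush g hn (n := m + 1) (by omega) (by omega)
      exact hle (flush_lt_flush g hfl hmem' hmem hnm)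
    -- An RMW flushed no later than the earlier write would find that write in its own buffer, which
    -- must be empty.
    · have hmem' := mem_buf_of_le_flush g hn hnm (by omega)
      rw [buf_eq_nil_of_rmw g hm] at hmem'
      cases hmem'
  · rw [flush_rmw g hfl hn]
    exact hnm.trans_le (le_flush hfl m)

omit g hfl

theorem exists_graph_of_mem_behMF_MTSO [Finite Tid] {β : Behavior Tid (ELab Loc Val)}
    (hβ : β ∈ (MTSO Tid Loc Val).BehMF) :
    ∃ G ∈ GTSO Tid (ELab Loc Val), G.Fair ∧ eventsOf Loc β = G.E ∧ Irrefl G.hbRA := by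
  classical
  obtain ⟨(q : ℕ → (Loc → Val) × (Tid → List (Loc × Val))), l, hr, rfl, hf⟩ :=
    exists_fair_stutterRun_of_mem_behMF hβ
  have g := ghostRun_of_run hr
  have hfl := allFlushed_of_fair hr hf
  have hval := fun {n τ a v} => read_value (n := n) (τ := τ) (a := a) (v := v) hr
  generalize (fun n => (ghostState l n).1) = mem at g hval
  generalize (fun n => (ghostState l n).2) = buf at g hfl hval
  clear hf
  set h := obs l with hh
  set E := eventsOf Loc (histBeh h) with hEdef
  set st := flushStamp mem buf h with hst
  have hsrc : ∀ r : Event Tid Loc (ELab Loc Val), ∃ w : Event Tid Loc (ELab Loc Val),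
      r ∈ E → r.IsR → w ∈ E ∧ w.IsW ∧ w.loc = r.loc ∧ w.valW = r.valR ∧ time h w < time h r ∧
      ∃ n τ a, h n = some (τ, a) ∧ r = .ev (cnt (thr h τ) n) τ a ∧
        st w = flushPos buf (ghostView mem buf n τ a.loc) ∧ (st w ≤ n ∨
          ∃ i a, i < n ∧ obs l i = some (τ, a) ∧ w = .ev (cnt (thr (obs l) τ) i) τ a) := by
    intro r
    by_cases hrE : r ∈ E ∧ r.IsR
    · obtain ⟨hrE, hR⟩ := hrE
      obtain ⟨n, τ, a, hn, rfl⟩ := exists_occursAt_of_isR hrE hR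
      obtain ⟨v, hv⟩ := Option.isSome_iff_exists.1 hR
      obtain ⟨w, h1, h2, h3, h4, h5, h6, h7⟩ := exists_visible_event g hfl n τ a.loc
      refine ⟨w, fun _ _ => ⟨h1, h2, h3, ?_, ?_, n, τ, a, hn, rfl, h5, h7⟩⟩
      · rw [h4, hval (obs_eq_some.1 hn) hv, hv]
      · rw [OccursAt.time_eq ⟨τ, a, hn, rfl⟩]
        exact Nat.lt_succ_of_le h6
    · exact ⟨r, fun h1 h2 => absurd ⟨h1, h2⟩ hrE⟩
  choose src hsrc using hsrc
  have hwrite : ∀ e ∈ E, e.IsW → (∃ x, e = .init x) ∨ ∃ n τ a, h n = some (τ, a) ∧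
      e = .ev (cnt (thr h τ) n) τ a ∧ a.valW.isSome ∧ st e = flush buf n + 1 := by
    intro e he hW
    refine (mem_eventsOf_histBeh.1 he).imp_right ?_
    rintro ⟨n, τ, a, hn, rfl⟩
    exact ⟨n, τ, a, hn, rfl, hW, flushStamp_write g hfl hn hW⟩
  have d : SourceData E src st :=
    { wf := wellFormed_eventsOf _
      src_mem := fun r h1 h2 => (hsrc r h1 h2).1
      src_isW := fun r h1 h2 => (hsrc r h1 h2).2.1
      src_loc := fun r h1 h2 => (hsrc r h1 h2).2.2.1
      src_val := fun r h1 h2 => (hsrc r h1 h2).2.2.2.1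
      ts_inj := by
        rintro a ha b hb haW hbW ⟨x, hx, hx'⟩ hab
        rcases hwrite a ha haW with ⟨y, rfl⟩ | ⟨n, τ, c, hn, rfl, hcW, hn'⟩ <;>
          rcases hwrite b hb hbW with ⟨z, rfl⟩ | ⟨m, τ', c', hm, rfl, hcW', hm'⟩
        · cases hx
          cases hx'
          rfl
        · rw [hm'] at hab
          exact absurd hab (Nat.succ_ne_zero _).symm
        · rw [hn'] at hab
          exact absurd hab (Nat.succ_ne_zero _)
        -- Right after a common flush time the memory cell would have to hold both writes.
        · have hflush : flush buf n = flush buf m := by omega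
          have h1 := (mem_flush g hfl ⟨τ, c, obs_eq_some.1 hn, Option.some.inj hx, hcW⟩).1
          have h2 := (mem_flush g hfl ⟨τ', c', obs_eq_some.1 hm, Option.some.inj hx', hcW'⟩).1
          rw [hflush, h2] at h1
          cases h1
          rw [hm] at hn
          cases hn
          rfl }
  have hstR : ∀ n τ a, h n = some (τ, a) → a.valR.isSome → a.valW.isSome →
      st (.ev (cnt (thr h τ) n) τ a) = n + 1 := by
    intro n τ a hn hR hW
    rw [hst, flushStamp_write g hfl hn hW]
    rcases a with ⟨x, v⟩ | ⟨x, v⟩ | ⟨x, v, v'⟩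
    · cases hW
    · cases hR
    · rw [flush_rmw g hfl (obs_eq_some.1 hn)]
  -- A write missed by a read at time `n` is not flushed before `n`. It is not flushed at `n`
  -- either, unless it is the reading RMW: the step at `n` is observable, hence no propagation.
  have hfrt : ∀ a b, d.graph.fr a b → time h a < st b := by
    intro a b hab
    obtain ⟨x, hx, hx'⟩ := EGraph.sameLoc_of_fr hab
    obtain ⟨⟨w, ⟨haE, haR, rfl⟩, hm⟩, hne⟩ := hab
    obtain ⟨-, hbE, -, hbW, -, hlt⟩ := hm
    obtain ⟨-, -, -, -, -, n, τ, c, hn, rfl, hw, -⟩ := hsrc a haE haR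
    rcases hwrite b hbE hbW with ⟨y, rfl⟩ | ⟨j, τ', c', hj, rfl, hjW, hjst⟩
    · exact absurd hlt (Nat.not_lt_zero _)
    rw [hjst, hw] at hlt
    have hwr : WritesTo l j c.loc :=
      ⟨τ', c', obs_eq_some.1 hj, Option.some.inj (hx'.trans hx.symm), hjW⟩
    have hle := le_flush_of_visible_lt g hfl hwr hlt
    rw [OccursAt.time_eq ⟨τ, c, hn, rfl⟩, hjst]
    refine Nat.succ_lt_succ (lt_of_le_of_ne hle fun heq => ?_)
    rcases (mem_flush g hfl hwr).2 with h1 | ⟨τ₀, h1⟩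
    · rw [← heq] at h1
      subst h1
      rw [hn] at hj
      cases hj
      exact hne rfl
    · rw [← heq, obs_eq_some.1 hn] at h1
      cases h1
  have hfrs : ∀ a b, d.graph.fr a b → st a < st b := by
    intro a b hab
    have ht := hfrt a b hab
    obtain ⟨⟨w, ⟨haE, haR, rfl⟩, hm⟩, hne⟩ := hab
    have hlt := hm.2.2.2.2.2
    obtain ⟨-, -, -, -, -, n, τ, c, hn, rfl, hw, -⟩ := hsrc a haE haR
    rcases hc : c.valW with _ | v
    · rw [hst, flushStamp_ev hn, ghostView_read g (obs_eq_some.1 hn) hc, ← hw]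
      exact hlt
    · rw [hstR n τ c hn haR (by rw [hc]; rfl)]
      rwa [OccursAt.time_eq ⟨τ, c, hn, rfl⟩] at ht
  have hrf : ∀ a b, d.graph.rf a b → time h a < time h b := by
    rintro a b ⟨hbE, hbR, rfl⟩
    exact (hsrc b hbE hbR).2.2.2.2.1
  have hpo : ∀ a b, d.graph.po a b → time h a < time h b :=
    fun a b hab => time_lt_of_sb hab.1 hab.2.1 hab.2.2
  refine ⟨d.graph, ⟨?_, ?_⟩, ⟨d.mo_prefixFinite, fun b => ?_⟩, rfl,
    irrefl_transGen_of_measure (time h) fun a b hab => hab.elim (hpo a b) (hrf a b)⟩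
  -- Writes are placed at their flush and pure reads at their issue; an RMW is flushed when issued,
  -- so both agree for it.
  · refine irrefl_transGen_of_measure (fun e => if e.IsW then st e else time h e) ?_
    have hTR : ∀ n τ a, h n = some (τ, a) → a.valR.isSome →
        (if (Event.ev (cnt (thr h τ) n) τ a : Event Tid Loc (ELab Loc Val)).IsW then
          st (.ev (cnt (thr h τ) n) τ a) else
          time h (.ev (cnt (thr h τ) n) τ a : Event Tid Loc (ELab Loc Val))) = n + 1 := by
      intro n τ a hn hR
      split_ifs with hW
      · exact hstR n τ a hn hR hW
      · exact OccursAt.time_eq ⟨τ, a, hn, rfl⟩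
    have hTge : ∀ n τ a, h n = some (τ, a) →
        n + 1 ≤ if (Event.ev (cnt (thr h τ) n) τ a : Event Tid Loc (ELab Loc Val)).IsW then
          st (.ev (cnt (thr h τ) n) τ a) else
          time h (.ev (cnt (thr h τ) n) τ a : Event Tid Loc (ELab Loc Val)) := by
      intro n τ a hn
      split_ifs with hW
      · rw [hst, flushStamp_write g hfl hn hW]
        exact Nat.succ_le_succ (le_flush hfl n)
      · exact (OccursAt.time_eq ⟨τ, a, hn, rfl⟩).ge
    rintro a b (hab | hab | hab | hab)
    · obtain ⟨⟨haE, hbE, hsb⟩, hnot⟩ := hab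
      rcases sb_cases haE hbE hsb with
        ⟨⟨x, rfl⟩, m, τ, lb, hm, rfl⟩ | ⟨n, m, τ, la, lb, hlt, hn, hm, rfl, rfl⟩
      · rw [if_pos (Event.isW_init x)]
        exact lt_of_lt_of_le (Nat.succ_pos m) (hTge m τ lb hm)
      · by_cases hR : la.valR.isSome
        · rw [hTR n τ la hn hR]
          exact (Nat.succ_lt_succ hlt).trans_le (hTge m τ lb hm)
        · have haW : la.valW.isSome := by
            rcases la with _ | _ | _
            · exact absurd rfl hR
            · rfl
            · rfl
          have hbW : lb.valW.isSome := by
            by_contra hbW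
            refine hnot ⟨⟨haW, fun h => hR h.1⟩, ?_, fun h => hbW h.2⟩
            rcases lb with _ | _ | _
            · rfl
            · exact absurd rfl hbW
            · rfl
          rw [if_pos (show (Event.ev (cnt (thr h τ) n) τ la : Event Tid Loc (ELab Loc Val)).IsW
              from haW),
            if_pos (show (Event.ev (cnt (thr h τ) m) τ lb : Event Tid Loc (ELab Loc Val)).IsW
              from hbW), hst, flushStamp_write g hfl hn haW,
            flushStamp_write g hfl hm hbW]
          exact Nat.succ_lt_succ (flush_lt_flush_of_lt g hfl (obs_eq_some.1 hn) (obs_eq_some.1 hm)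
            haW hbW hlt)
    · obtain ⟨⟨hbE, hbR, rfl⟩, hnpo⟩ := hab
      obtain ⟨hwE, hwW, -, -, -, n, τ, c, hn, hb, -, hcase⟩ := hsrc b hbE hbR
      -- The source is either flushed before the read or an earlier write of the same thread; in the
      -- latter case the edge is in `po` and not external.
      rcases hcase with hle | ⟨i, c', hin, hi, hw⟩
      · rw [if_pos hwW]
        refine Nat.lt_of_le_of_lt hle ?_
        rw [hb] at hbR ⊢
        rw [hTR n τ c hn hbR]
        exact Nat.lt_succ_self n
      · refine absurd ⟨hwE, hbE, ?_⟩ hnpo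
        rw [hw]
        rw [hb]
        exact (sb_iff_of_occursAt hi hn).2 ⟨rfl, hin⟩
    · obtain ⟨-, -, haW, hbW, -, hlt⟩ := hab
      rw [if_pos haW, if_pos hbW]
      exact hlt
    · have ht := hfrt a b hab
      obtain ⟨⟨w, ⟨haE, haR, -⟩, hm⟩, -⟩ := hab
      obtain ⟨n, τ, c, hn, rfl⟩ := exists_occursAt_of_isR haE haR
      rw [OccursAt.time_eq ⟨τ, c, hn, rfl⟩] at ht
      rw [hTR n τ c hn haR, if_pos hm.2.2.2.1]
      exact ht
  -- On one location the flush position seen by a thread never decreases; the time of issue breaks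
  -- ties.
  · refine irrefl_transGen_of_lex st (time h) ?_
    rintro a b (⟨hab, x, hx, hx'⟩ | hab | hab | hab)
    · refine Or.inr ⟨?_, hpo a b hab⟩
      rcases sb_cases hab.1 hab.2.1 hab.2.2 with
        ⟨⟨y, rfl⟩, -⟩ | ⟨n, m, τ, la, lb, hlt, hn, hm, rfl, rfl⟩
      · exact Nat.zero_le _
      · rw [hst, flushStamp_ev hn, flushStamp_ev hm,
          Option.some.inj (hx.trans hx'.symm : some la.loc = some lb.loc)]
        exact flushPos_ghostView_mono g hfl (by omega) τ lb.loc
    · refine Or.inr ⟨?_, hrf a b hab⟩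
      obtain ⟨hbE, hbR, rfl⟩ := hab
      obtain ⟨-, -, -, -, -, n, τ, c, hn, hb, hw, -⟩ := hsrc b hbE hbR
      rw [hw, hb, hst, flushStamp_ev hn]
      exact flushPos_ghostView_succ g hfl n τ c.loc
    · exact Or.inl hab.2.2.2.2.2
    · exact Or.inl (hfrs a b hab)
  -- All `fr`-predecessors of `b` are issued before `b` is flushed.
  · refine finite_of_time_le (h := h) (st b) fun a ha => ?_
    have hlt := hfrt a b ha
    obtain ⟨⟨w, ⟨haE, haR, -⟩, -⟩, -⟩ := ha
    obtain ⟨n, hn⟩ := exists_occursAt_of_isR haE haR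
    rw [hn.time_eq] at hlt
    exact ⟨n, by omega, hn⟩

end TSOGraph

/-! ### Robust programs -/

section Robust

variable {Tid Loc Val L : Type*} [MemLabel L Loc Val] [Zero Val]

theorem Program.behTF_subset_beh (P : Program Tid L) : P.BehTF ⊆ P.Beh := by
  rintro β ⟨μ, hμ, rfl⟩
  exact ⟨_, ⟨μ, hμ.1, rfl⟩, rfl⟩

/-- Intersecting `P.Beh` or `P.BehTF` with sets that agree on `P.Beh`. -/
theorem Program.inter_eq_of_iff {P : Program Tid L} {A B : Set (Behavior Tid L)}
    (h : ∀ β ∈ P.Beh, β ∈ A ↔ β ∈ B) : P.Beh ∩ A = P.Beh ∩ B ∧ P.BehTF ∩ A = P.BehTF ∩ B :=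
  ⟨Set.ext fun β => and_congr_right fun hβ => h β hβ,
    Set.ext fun β => and_congr_right fun hβ => h β (P.behTF_subset_beh hβ)⟩

/-- A fair consistent graph of a finitely robust program yields a sequentially consistent run. -/
theorem FinitelyRobust.mem_behMF_MSC [Finite Tid] {P : Program Tid L} {𝒢 : DeclMem Tid L}
    (hP : FinitelyRobust P 𝒢) (h𝒢 : PrefixClosed 𝒢) {β : Behavior Tid L} (hβ : β ∈ P.Beh)
    {G : EGraph Tid L} (hG : G ∈ 𝒢) (hf : G.Fair) (hE : eventsOf Loc β = G.E)
    (hac : Irrefl G.hbRA) : β ∈ (MSC Tid Loc Val L).BehMF :=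
  mem_behMF_MSC_of_graph (hP.mem_GSC h𝒢 hβ hG hE hac) hf hE

end Robust

end WeakMem

open WeakMem in
theorem corollary4p12 {Tid Loc Val : Type*} [Finite Tid] [Zero Val] :
    (∀ P : Program Tid (ELab Loc Val), FinitelyRobust P (GTSO Tid (ELab Loc Val)) →
      P.MemFairBehUnder (MTSO Tid Loc Val) =
          P.MemFairBehUnder (MSC Tid Loc Val (ELab Loc Val)) ∧
      P.ThreadMemFairBehUnder (MTSO Tid Loc Val) =
          P.ThreadMemFairBehUnder (MSC Tid Loc Val (ELab Loc Val))) ∧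
    (∀ P : Program Tid (ELab Loc Val), FinitelyRobust P (GRA Tid (ELab Loc Val)) →
      P.MemFairBehUnder (MRA Tid Loc Val) =
          P.MemFairBehUnder (MSC Tid Loc Val (ELab Loc Val)) ∧
      P.ThreadMemFairBehUnder (MRA Tid Loc Val) =
          P.ThreadMemFairBehUnder (MSC Tid Loc Val (ELab Loc Val))) ∧
    (∀ P : Program Tid (ELab Loc Val), FinitelyRobust P (GStrongCOH Tid (ELab Loc Val)) →
      P.MemFairBehUnder (MStrongCOH Tid Loc Val) =
          P.MemFairBehUnder (MSC Tid Loc Val (ELab Loc Val)) ∧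
      P.ThreadMemFairBehUnder (MStrongCOH Tid Loc Val) =
          P.ThreadMemFairBehUnder (MSC Tid Loc Val (ELab Loc Val))) ∧
    (∀ P : Program Tid (CLab Loc Val), FinitelyRobust P (GRC11 Tid Loc Val) →
      P.DeclFairBehUnder (GRC11 Tid Loc Val) =
          P.MemFairBehUnder (MSC Tid Loc Val (CLab Loc Val)) ∧
      P.DeclThreadFairBehUnder (GRC11 Tid Loc Val) =
          P.ThreadMemFairBehUnder (MSC Tid Loc Val (CLab Loc Val))) := by
  refine ⟨fun P hP => Program.inter_eq_of_iff fun β hβ => ⟨fun h => ?_, ?_⟩,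
    fun P hP => Program.inter_eq_of_iff fun β hβ => ⟨fun h => ?_, ?_⟩,
    fun P hP => Program.inter_eq_of_iff fun β hβ => ⟨fun h => ?_, ?_⟩,
    fun P hP => Program.inter_eq_of_iff fun β hβ => ⟨?_, fun h => ?_⟩⟩
  · obtain ⟨G, hG, hf, hE, hac⟩ := exists_graph_of_mem_behMF_MTSO h
    exact hP.mem_behMF_MSC prefixClosed_GTSO hβ hG hf hE hac
  · exact behMF_MSC_subset_MTSO
  · obtain ⟨G, hG, hf, hE, hac⟩ := exists_graph_of_mem_behMF_MRA h
    exact hP.mem_behMF_MSC prefixClosed_GRA hβ hG hf hE hac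
  · exact behMF_MSC_subset_MRA
  · obtain ⟨G, hG, hf, hE, hac⟩ := exists_graph_of_mem_behMF_MStrongCOH h
    exact hP.mem_behMF_MSC prefixClosed_GStrongCOH hβ hG hf hE hac
  · exact behMF_MSC_subset_MStrongCOH
  · rintro ⟨G, ⟨hG, hf⟩, hE⟩
    -- Acyclicity of `po ∪ rf` is an axiom of RC11; for the operational models it came from the
    -- order of the run.
    exact hP.mem_behMF_MSC prefixClosed_GRC11 hβ hG hf hE hG.2.2.2.2
  · obtain ⟨G, hG, hf, hE⟩ := exists_graph_of_mem_behMF_MSC h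
    exact ⟨G, ⟨GSC_subset_GRC11 hG, hf⟩, hE⟩
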